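/- Let $M$ be a closed (compact, without boundary) smooth Riemannian manifold of dimension $n$, and let $W\in C^2(\mathbb R)$ be a double-well potential: $W\ge 0$, $W$ has exactly three critical points, namely $\pm1$, with $W(\pm1)=0$ and $W''(\pm1)>0$, and $\gamma\in(-1,1)$, which is a local maximum. Set $$C=\max_{s\in[-1,1]}\frac{-W'(s)}{s-\gamma},$$ where the quotient is given its limit $-W''(\gamma)$ at $s=\gamma$, and let $$h(M)=\inf\frac{\mathrm{Area}(\partial A)}{\mathrm{Vol}(A)}$$ be the Cheeger constant of $M$, the infimum being over all nonempty open sets $A\subset M$ with smooth boundary and $\mathrm{Vol}(A)\le \mathrm{Vol}(M)/2$. Then the maximum $C$ is attained and positive (and it depends only on $W$), and whenever $\varepsilon>2\sqrt C/h(M)$ (read as $+\infty$ if $h(M)=0$), the constants $1$, $-1$ and $\gamma$ are exactly the solutions $u\in H^1(M)$ of the Allen-Cahn equation $$-\varepsilon\Delta u+\frac1\varepsilon W'(u)=0 .$$ Here a solution is a function $u\in H^1(M)$ (square integrable, with square integrable weak gradient) such that $W'(u)\in L^1(M)$ and $\varepsilon\int_M\langle\nabla u,\nabla\varphi\rangle+\frac1\varepsilon\int_M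 W'(u)\varphi=0$ for all $\varphi\in C^\infty(M)$, and functions that agree almost everywhere are identified. -/

import Mathlib

open Set Filter MeasureTheory Bundle Manifold
open scoped ContDiff Topology ENNReal

/-- A double-well potential with wells at `-1` and `1`, whose third critical point is a local
maximum at `γ ∈ (-1, 1)`. -/
structure IsDoubleWell (W : ℝ → ℝ) (γ : ℝ) : Prop where
  contDiff : ContDiff ℝ 2 W
  nonneg : ∀ s, 0 ≤ W s
  gamma_mem : γ ∈ Ioo (-1 : ℝ) 1
  critical_iff : ∀ s, deriv W s = 0 ↔ s = -1 ∨ s = γ ∨ s = 1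
  apply_neg_one : W (-1) = 0
  apply_one : W 1 = 0
  deriv2_neg_one : 0 < deriv (deriv W) (-1)
  deriv2_one : 0 < deriv (deriv W) 1
  isLocalMax : IsLocalMax W γ

/-- The function `s ↦ -W'(s) / (s - γ)`, with its limit `-W''(γ)` as value at `s = γ`. -/
noncomputable def wellQuotient (W : ℝ → ℝ) (γ s : ℝ) : ℝ :=
  open Classical in if s = γ then -deriv (deriv W) γ else -deriv W s / (s - γ)

/-- The constant `C = max_{s ∈ [-1, 1]} -W'(s) / (s - γ)`. -/
noncomputable def wellConstant (W : ℝ → ℝ) (γ : ℝ) : ℝ :=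
  sSup (wellQuotient W γ '' Icc (-1) 1)

section Manifold

variable {n : ℕ} {M : Type*} [EMetricSpace M] [MeasurableSpace M] [BorelSpace M]
  [ChartedSpace (EuclideanSpace ℝ (Fin n)) M]

variable (n M) in
/-- The Riemannian volume, as the `n`-dimensional Hausdorff measure of the Riemannian distance,
normalized to agree with Lebesgue measure on `ℝⁿ`. -/
noncomputable def riemannianVolume : Measure M := μHE[n]

variable (n) in
/-- The `(n - 1)`-dimensional area of a subset of `M`, as normalized Hausdorff measure. -/
noncomputable def riemannianArea (S : Set M) : ℝ≥0∞ := (μHE[n - 1] : Measure M) S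

/-- `A` is an open set with smooth boundary: near each of its boundary points, `A` is a sublevel
set `{f < 0}` of a smooth function `f` with nonzero differential at that point. -/
def IsOpenWithSmoothBoundary (n : ℕ) {M : Type*} [TopologicalSpace M]
    [ChartedSpace (EuclideanSpace ℝ (Fin n)) M] (A : Set M) : Prop :=
  IsOpen A ∧ ∀ x ∈ frontier A, ∃ U : Set M, IsOpen U ∧ x ∈ U ∧ ∃ f : M → ℝ,
    ContMDiffOn (𝓡 n) 𝓘(ℝ, ℝ) ∞ f U ∧ mvfderiv (𝓡 n) f x ≠ 0 ∧ A ∩ U = {y ∈ U | f y < 0}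

variable (n M) in
/-- The Cheeger constant `h(M) = inf Area(∂A) / Vol(A)`, over the nonempty open sets `A ⊆ M` with
smooth boundary and `Vol(A) ≤ Vol(M) / 2`. -/
noncomputable def cheegerConstant : ℝ≥0∞ :=
  ⨅ (A : Set M) (_ : A.Nonempty ∧ IsOpenWithSmoothBoundary n A ∧
      riemannianVolume n M A ≤ riemannianVolume n M univ / 2),
    riemannianArea n (frontier A) / riemannianVolume n M A

variable [IsManifold (𝓡 n) ∞ M] [RiemannianBundle (fun x : M ↦ TangentSpace (𝓡 n) x)]

/-- The vector field `G` is the weak gradient of `u`: in every chart `φ` of the atlas, for every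
direction `e`, the function `y ↦ ⟨G, ∂φ⁻¹/∂e⟩` is the weak partial derivative of `u ∘ φ⁻¹` in the
direction `e`. -/
def IsWeakGradient (u : M → ℝ) (G : ∀ x : M, TangentSpace (𝓡 n) x) : Prop :=
  ∀ (x₀ : M) (ψ : EuclideanSpace ℝ (Fin n) → ℝ), ContDiff ℝ ∞ ψ → HasCompactSupport ψ →
    tsupport ψ ⊆ (extChartAt (𝓡 n) x₀).target → ∀ e : EuclideanSpace ℝ (Fin n),
      ∫ y, u ((extChartAt (𝓡 n) x₀).symm y) * fderiv ℝ ψ y e =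
        -∫ y, inner ℝ (G ((extChartAt (𝓡 n) x₀).symm y))
          (mfderiv (𝓡 n) (𝓡 n) (extChartAt (𝓡 n) x₀).symm y e) * ψ y

/-- `u` lies in the Sobolev space `H¹(M)`, with weak gradient `G`: both are square integrable. -/
structure IsSobolevH1 (u : M → ℝ) (G : ∀ x : M, TangentSpace (𝓡 n) x) : Prop where
  memLp : MemLp u 2 (riemannianVolume n M)
  aestronglyMeasurable : AEStronglyMeasurable
    (fun x ↦ (⟨x, G x⟩ : TangentBundle (𝓡 n) M)) (riemannianVolume n M)
  lintegral_lt_top : ∫⁻ x, ‖G x‖ₑ ^ 2 ∂(riemannianVolume n M) < ⊤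
  isWeakGradient : IsWeakGradient u G

variable (n) in
/-- `u ∈ H¹(M)` is a (weak) solution of the Allen-Cahn equation `-ε Δu + W'(u) / ε = 0`, that is
`ε ∫ ⟨∇u, ∇φ⟩ + (1 / ε) ∫ W'(u) φ = 0` for all smooth `φ`. Here `⟨∇u, ∇φ⟩` is written
as `dφ(∇u)`. -/
def IsAllenCahnSolution (W : ℝ → ℝ) (ε : ℝ) (u : M → ℝ) : Prop :=
  ∃ G : ∀ x : M, TangentSpace (𝓡 n) x, IsSobolevH1 u G ∧
    Integrable (fun x ↦ deriv W (u x)) (riemannianVolume n M) ∧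
    ∀ φ : M → ℝ, ContMDiff (𝓡 n) 𝓘(ℝ, ℝ) ∞ φ →
      ε * ∫ x, mvfderiv (𝓡 n) φ x (G x) ∂(riemannianVolume n M) +
        1 / ε * ∫ x, deriv W (u x) * φ x ∂(riemannianVolume n M) = 0

end Manifold

open scoped NNReal

/-! Let h be the Cheeger constant and u a solution. Testing the equation with an increasing function
of u that vanishes for u ≤ 1 gives u ≤ 1, and u ≥ -1 follows in the same way. The problem is
symmetric under u ↦ -u, so {u > γ} may be assumed to have no more volume than {u ≤ γ}. Put w = (u -
γ)⁺. The equation tested with w gives ε ∫ |∇w|² = -(1/ε) ∫ W'(u) w ≤ (C/ε) ∫ w². Since w vanishes on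
at least half of M, Cheeger's inequality gives (h²/4) ∫ w² ≤ ∫ |∇w|². For ε > 2√C/h both can hold
only if w = 0 (`ae_le_gamma`). Now u lies between -1 and γ, where W' ≥ 0. The test function 1 forces
W'(u) = 0, so u takes only the values -1 and γ; the test function u forces ∇u = 0; and h > 0
excludes a jump between the two values (`ae_eq_or_of_ae_le_gamma`).

The analytic input is Cheeger's inequality in L¹ form, which bounds h times `crossVolume` of f by ∫
|∇f|. For f with finitely many critical points it follows from the definition of h on the level sets
and the coarea inequality `lintegral_area_level_le`. It passes to all smooth f by perturbation
(`exists_perturbation_finite_critical`), and to smooth functions of u by density of smooth functions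
in H¹ (`exists_smooth_approximation`). Both limits are harmless because `crossVolume` is 1-Lipschitz
for the L¹ distance (`crossVolume_le_add`).

Only one direction of the coarea formula is needed. It comes from charts adapted to f whose
bilipschitz constant is as near to 1 as desired, so no formula for the volume density in coordinates
is involved. `IsTestedSolution` isolates what the last part of the argument uses of the manifold. -/

theorem enorm_le_coe_mul_enorm_of_norm_le {G H : Type*} [SeminormedAddCommGroup G]
    [SeminormedAddCommGroup H] {K : ℝ≥0} {a : G} {b : H} (h : ‖a‖ ≤ K * ‖b‖) :
    ‖a‖ₑ ≤ K * ‖b‖ₑ := by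
  rw [← ofReal_norm, ← ofReal_norm, ← ENNReal.ofReal_coe_nnreal, ← ENNReal.ofReal_mul K.coe_nonneg]
  exact ENNReal.ofReal_le_ofReal h

/-! ### Lipschitz bounds from derivative bounds, for the Riemannian distance. -/

section Lipschitz

variable {n : ℕ} {M : Type*} [EMetricSpace M]
  [ChartedSpace (EuclideanSpace ℝ (Fin n)) M]
  [RiemannianBundle (fun x : M ↦ TangentSpace (𝓡 n) x)]
  [IsRiemannianManifold (𝓡 n) M]
  {F : Type*} [NormedAddCommGroup F] [NormedSpace ℝ F]

/-- The image of the segment from p to q is a path of length at most K times the distance of p and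
q, and the Riemannian distance is the infimum of lengths. -/
theorem lipschitzOnWith_of_norm_mfderiv_le {θ : F → M} {s : Set F} (hs : IsOpen s)
    (hc : Convex ℝ s) {K : ℝ≥0} (hθ : ContMDiffOn 𝓘(ℝ, F) (𝓡 n) 1 θ s)
    (hK : ∀ p ∈ s, ∀ v : F, ‖(mfderiv 𝓘(ℝ, F) (𝓡 n) θ p v : TangentSpace (𝓡 n) (θ p))‖ ≤ K * ‖v‖) :
    LipschitzOnWith K θ s := by
  intro p hp q hq
  rw [IsRiemannianManifold.out (I := 𝓡 n)]
  let η := ContinuousAffineMap.lineMap (R := ℝ) p q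
  have hη : Icc 0 1 ⊆ ⇑η ⁻¹' s := by
    simp only [← image_subset_iff, ContinuousAffineMap.coe_lineMap_eq,
      ← segment_eq_image_lineMap, η]
    exact hc.segment_subset hp hq
  have ηs : ContMDiff 𝓘(ℝ, ℝ) 𝓘(ℝ, F) 1 η := by
    rw [contMDiff_iff_contDiff]
    exact ContinuousAffineMap.contDiff _
  have : riemannianEDist (𝓡 n) (θ p) (θ q) ≤ pathELength (𝓡 n) (θ ∘ η) 0 1 := by
    apply riemannianEDist_le_pathELength _ _ _ zero_le_one
    · exact hθ.comp ηs.contMDiffOn hη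
    · simp [η, ContinuousAffineMap.coe_lineMap_eq]
    · simp [η, ContinuousAffineMap.coe_lineMap_eq]
  apply this.trans
  rw [pathELength_eq_lintegral_mfderiv_Icc]
  have hle : ∀ t ∈ Icc (0 : ℝ) 1, ‖(mfderiv 𝓘(ℝ, ℝ) (𝓡 n) (θ ∘ η) t (1 : ℝ) :
      TangentSpace (𝓡 n) (θ (η t)))‖ₑ ≤ K * edist p q := by
    intro t ht
    have h1 : mfderiv 𝓘(ℝ, ℝ) (𝓡 n) (θ ∘ η) t =
        (mfderiv 𝓘(ℝ, F) (𝓡 n) θ (η t)).comp (mfderiv 𝓘(ℝ, ℝ) 𝓘(ℝ, F) η t) := by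
      apply mfderiv_comp
      · exact ((hθ.contMDiffAt (hs.mem_nhds (hη ht))).mdifferentiableAt one_ne_zero)
      · exact (ηs t).mdifferentiableAt one_ne_zero
    have h2 : (mfderiv 𝓘(ℝ, ℝ) 𝓘(ℝ, F) η t) (1 : ℝ) = (q - p : F) := by
      rw [mfderiv_eq_fderiv]
      change fderiv ℝ (AffineMap.lineMap p q : ℝ → F) t 1 = _
      simp
    have h3 : (mfderiv 𝓘(ℝ, ℝ) (𝓡 n) (θ ∘ η) t (1 : ℝ) : TangentSpace (𝓡 n) (θ (η t)))
        = mfderiv 𝓘(ℝ, F) (𝓡 n) θ (η t) (q - p : F) := by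
      rw [h1]
      exact congrArg (mfderiv 𝓘(ℝ, F) (𝓡 n) θ (η t)) h2
    rw [h3, edist_comm, edist_eq_enorm_sub]
    exact enorm_le_coe_mul_enorm_of_norm_le (hK _ (hη ht) (q - p))
  calc _ ≤ ∫⁻ t in Icc (0 : ℝ) 1, K * edist p q := setLIntegral_mono' measurableSet_Icc hle
    _ = _ := by simp

/-- A nearly shortest path between two points close to `x₀` stays in `U`, and ψ is estimated along
it. The neighbourhood shrinks because U need not contain the short paths between all of its points.
-/
theorem exists_lipschitzOnWith_of_norm_mvfderiv_le {ψ : M → F} {U : Set M} (hU : IsOpen U)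
    {K : ℝ≥0} (hψ : ContMDiffOn (𝓡 n) 𝓘(ℝ, F) 1 ψ U)
    (hK : ∀ x ∈ U, ‖mvfderiv (𝓡 n) ψ x‖ ≤ K) {x₀ : M} (hx₀ : x₀ ∈ U) :
    ∃ V : Set M, IsOpen V ∧ x₀ ∈ V ∧ V ⊆ U ∧ LipschitzOnWith K ψ V := by
  obtain ⟨ε, hε, hεU⟩ := EMetric.isOpen_iff.1 hU x₀ hx₀
  -- Two points of the r-ball are joined by a path of length below 2r, which cannot leave the
  -- 3r-ball.
  obtain ⟨r, hr, hrε⟩ : ∃ r : ℝ≥0∞, 0 < r ∧ 3 * r < ε := by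
    obtain ⟨ε', h0, h1⟩ := exists_between hε
    refine ⟨ε' / 3, ENNReal.div_pos h0.ne' (by simp), ?_⟩
    rwa [ENNReal.mul_div_cancel (by simp) (by simp)]
  have hrtop : r ≠ ⊤ := by rintro rfl; simp at hrε
  refine ⟨Metric.eball x₀ r, Metric.isOpen_eball, Metric.mem_eball_self hr, fun y hy ↦ hεU ?_, ?_⟩
  · refine lt_of_lt_of_le hy (le_trans ?_ hrε.le)
    exact le_mul_of_one_le_left (by simp) (by norm_num)
  intro x hx y hy
  have hxy : edist x y < 2 * r := by
    calc edist x y ≤ edist x x₀ + edist y x₀ := edist_triangle_right _ _ _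
      _ < r + r := ENNReal.add_lt_add hx hy
      _ = 2 * r := (two_mul r).symm
  -- A shortest path may not exist, so paths of length below l are used and l decreases to the
  -- distance.
  suffices h : ∀ l : ℝ≥0∞, edist x y < l → l < 2 * r → edist (ψ x) (ψ y) ≤ K * l by
    have : Tendsto (fun l ↦ (K : ℝ≥0∞) * l) (𝓝[>] (edist x y)) (𝓝 (K * edist x y)) :=
      ((ENNReal.continuous_const_mul ENNReal.coe_ne_top).tendsto _).mono_left nhdsWithin_le_nhds
    have hne : (𝓝[>] (edist x y)).NeBot := nhdsGT_neBot_of_exists_gt ⟨_, hxy⟩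
    refine ge_of_tendsto this ?_
    filter_upwards [Ioo_mem_nhdsGT hxy] with l hl using h l hl.1 hl.2
  intro l hl hlr
  rw [IsRiemannianManifold.out (I := 𝓡 n)] at hl
  obtain ⟨γ, h0, h1, hγ, hlen⟩ := exists_lt_of_riemannianEDist_lt hl
  have hmem : ∀ t ∈ Icc (0 : ℝ) 1, γ t ∈ U := by
    intro t ht
    apply hεU
    have : edist x (γ t) < 2 * r := by
      rw [IsRiemannianManifold.out (I := 𝓡 n)]
      calc riemannianEDist (𝓡 n) x (γ t) ≤ pathELength (𝓡 n) γ 0 t :=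
            riemannianEDist_le_pathELength (hγ.mono (Icc_subset_Icc_right ht.2)) h0 rfl ht.1
        _ ≤ pathELength (𝓡 n) γ 0 1 := pathELength_mono le_rfl ht.2
        _ < 2 * r := hlen.trans hlr
    calc edist (γ t) x₀ ≤ edist (γ t) x + edist x x₀ := edist_triangle _ _ _
      _ < 2 * r + r := ENNReal.add_lt_add (by rwa [edist_comm]) hx
      _ = 3 * r := by ring
      _ < ε := hrε
  have hC : ContMDiffOn 𝓘(ℝ, ℝ) 𝓘(ℝ, F) 1 (ψ ∘ γ) (Icc 0 1) := hψ.comp hγ hmem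
  calc edist (ψ x) (ψ y) = ‖(ψ ∘ γ) 1 - (ψ ∘ γ) 0‖ₑ := by
        rw [edist_comm, edist_eq_enorm_sub, ← h0, ← h1]; rfl
    _ ≤ ∫⁻ t in Icc (0 : ℝ) 1, ‖derivWithin (ψ ∘ γ) (Icc 0 1) t‖ₑ := by
      apply enorm_sub_le_lintegral_derivWithin_Icc_of_contDiffOn_Icc _ zero_le_one
      rwa [← contMDiffOn_iff_contDiffOn]
    _ ≤ ∫⁻ t in Icc (0 : ℝ) 1, K * ‖(mfderivWithin 𝓘(ℝ, ℝ) (𝓡 n) γ (Icc 0 1) t (1 : ℝ) :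
          TangentSpace (𝓡 n) (γ t))‖ₑ := by
      apply setLIntegral_mono' measurableSet_Icc (fun t ht ↦ ?_)
      have e1 : mfderivWithin 𝓘(ℝ, ℝ) 𝓘(ℝ, F) (ψ ∘ γ) (Icc 0 1) t =
          (mfderiv (𝓡 n) 𝓘(ℝ, F) ψ (γ t)).comp (mfderivWithin 𝓘(ℝ, ℝ) (𝓡 n) γ (Icc 0 1) t) := by
        apply mfderiv_comp_mfderivWithin
        · exact (hψ.contMDiffAt (hU.mem_nhds (hmem t ht))).mdifferentiableAt one_ne_zero
        · exact hγ.mdifferentiableOn one_ne_zero t ht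
        · rw [uniqueMDiffWithinAt_iff_uniqueDiffWithinAt]
          exact uniqueDiffOn_Icc zero_lt_one _ ht
      have e2 : derivWithin (ψ ∘ γ) (Icc 0 1) t = mvfderiv (𝓡 n) ψ (γ t)
          (mfderivWithin 𝓘(ℝ, ℝ) (𝓡 n) γ (Icc 0 1) t (1 : ℝ)) := by
        rw [← fderivWithin_derivWithin, ← mfderivWithin_eq_fderivWithin]
        exact congrArg (fun L : ℝ →L[ℝ] F ↦ L 1) e1
      rw [e2]
      refine enorm_le_coe_mul_enorm_of_norm_le ((ContinuousLinearMap.le_opNorm _ _).trans ?_)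
      gcongr
      exact hK _ (hmem t ht)
    _ = K * pathELength (𝓡 n) γ 0 1 := by
      rw [lintegral_const_mul' _ _ ENNReal.coe_ne_top, pathELength_eq_lintegral_mfderivWithin_Icc]
      rfl
    _ ≤ K * l := by gcongr

end Lipschitz

/-! ### Derivatives of functions and maps read in a preferred chart. -/

section ChartDerivative

variable {n : ℕ} {M : Type*} [TopologicalSpace M]
  [ChartedSpace (EuclideanSpace ℝ (Fin n)) M] [IsManifold (𝓡 n) ∞ M]
  {F : Type*} [NormedAddCommGroup F] [NormedSpace ℝ F]

/-- The derivative at `x` of the preferred chart at `x₀`. -/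
noncomputable def chartDeriv (x₀ x : M) : TangentSpace (𝓡 n) x →L[ℝ] EuclideanSpace ℝ (Fin n) :=
  (trivializationAt (EuclideanSpace ℝ (Fin n)) (TangentSpace (𝓡 n)) x₀).continuousLinearMapAt ℝ x

/-- The derivative at the image of `x` of the inverse of the preferred chart at `x₀`. -/
noncomputable def chartDerivSymm (x₀ x : M) :
    EuclideanSpace ℝ (Fin n) →L[ℝ] TangentSpace (𝓡 n) x :=
  (trivializationAt (EuclideanSpace ℝ (Fin n)) (TangentSpace (𝓡 n)) x₀).symmL ℝ x

theorem chartDeriv_chartDerivSymm {x₀ x : M} (hx : x ∈ (extChartAt (𝓡 n) x₀).source)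
    (e : EuclideanSpace ℝ (Fin n)) : chartDeriv x₀ x (chartDerivSymm x₀ x e) = e :=
  Trivialization.continuousLinearMapAt_symmL _ (by simpa using hx) e

theorem chartDerivSymm_chartDeriv {x₀ x : M} (hx : x ∈ (extChartAt (𝓡 n) x₀).source)
    (v : TangentSpace (𝓡 n) x) : chartDerivSymm x₀ x (chartDeriv x₀ x v) = v :=
  Trivialization.symmL_continuousLinearMapAt _ (by simpa using hx) v

theorem mvfderiv_eq_fderiv_comp_chartDeriv {ψ : M → F} {x₀ x : M}
    (hx : x ∈ (extChartAt (𝓡 n) x₀).source) (hψ : MDifferentiableAt (𝓡 n) 𝓘(ℝ, F) ψ x) :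
    mvfderiv (𝓡 n) ψ x =
      (fderiv ℝ (ψ ∘ (extChartAt (𝓡 n) x₀).symm) (extChartAt (𝓡 n) x₀ x)).comp
        (chartDeriv x₀ x) := by
  have hx' : x ∈ (chartAt (EuclideanSpace ℝ (Fin n)) x₀).source := by simpa using hx
  have h1 : ψ =ᶠ[𝓝 x] (ψ ∘ (extChartAt (𝓡 n) x₀).symm) ∘ (extChartAt (𝓡 n) x₀) := by
    filter_upwards [extChartAt_source_mem_nhds' (I := 𝓡 n) hx] with y hy
    simp only [Function.comp_apply, (extChartAt (𝓡 n) x₀).left_inv hy]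
  have hxt := (extChartAt (𝓡 n) x₀).map_source hx
  have h2 : MDifferentiableAt 𝓘(ℝ, EuclideanSpace ℝ (Fin n)) 𝓘(ℝ, F)
      (ψ ∘ (extChartAt (𝓡 n) x₀).symm) (extChartAt (𝓡 n) x₀ x) := by
    refine MDifferentiableAt.comp (I' := 𝓡 n) _ ?_ ?_
    · rwa [(extChartAt (𝓡 n) x₀).left_inv hx]
    · exact ((contMDiffOn_extChartAt_symm (n := 1) x₀).contMDiffAt
        ((isOpen_extChartAt_target x₀).mem_nhds hxt)).mdifferentiableAt one_ne_zero
  have h3 := mfderiv_comp x h2 (mdifferentiableAt_extChartAt (I := 𝓡 n) hx')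
  rw [← h1.mfderiv_eq] at h3
  rw [mfderiv_eq_fderiv, ← TangentBundle.continuousLinearMapAt_trivializationAt hx'] at h3
  exact h3

theorem fderiv_comp_extChartAt_symm {ψ : M → F} {x₀ x : M}
    (hx : x ∈ (extChartAt (𝓡 n) x₀).source) (hψ : MDifferentiableAt (𝓡 n) 𝓘(ℝ, F) ψ x) :
    fderiv ℝ (ψ ∘ (extChartAt (𝓡 n) x₀).symm) (extChartAt (𝓡 n) x₀ x) =
      (mvfderiv (𝓡 n) ψ x).comp (chartDerivSymm x₀ x) := by
  ext e
  rw [mvfderiv_eq_fderiv_comp_chartDeriv hx hψ]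
  simp only [ContinuousLinearMap.comp_apply, chartDeriv_chartDerivSymm hx]

theorem mfderiv_extChartAt_symm_apply {x₀ x : M} (hx : x ∈ (extChartAt (𝓡 n) x₀).source) :
    mfderiv 𝓘(ℝ, EuclideanSpace ℝ (Fin n)) (𝓡 n) (extChartAt (𝓡 n) x₀).symm
      (extChartAt (𝓡 n) x₀ x) = chartDerivSymm x₀ x := by
  have hx' : x ∈ (chartAt (EuclideanSpace ℝ (Fin n)) x₀).source := by simpa using hx
  have := TangentBundle.symmL_trivializationAt (I := 𝓡 n) hx'
  rw [chartDerivSymm, this]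
  simp
  rfl

theorem mfderiv_extChartAt_symm_comp_apply {x₀ : M} {Θ : F → EuclideanSpace ℝ (Fin n)} {p : F}
    (hp : Θ p ∈ (extChartAt (𝓡 n) x₀).target) (hΘ : DifferentiableAt ℝ Θ p) (v : F) :
    mfderiv 𝓘(ℝ, F) (𝓡 n) ((extChartAt (𝓡 n) x₀).symm ∘ Θ) p v =
      chartDerivSymm x₀ ((extChartAt (𝓡 n) x₀).symm (Θ p)) (fderiv ℝ Θ p v) := by
  have h1 : MDifferentiableAt 𝓘(ℝ, EuclideanSpace ℝ (Fin n)) (𝓡 n) (extChartAt (𝓡 n) x₀).symm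
      (Θ p) := ((contMDiffOn_extChartAt_symm (n := 1) x₀).contMDiffAt
        ((isOpen_extChartAt_target x₀).mem_nhds hp)).mdifferentiableAt one_ne_zero
  have h2 := mfderiv_comp p h1 hΘ.mdifferentiableAt
  have h3 := mfderiv_extChartAt_symm_apply ((extChartAt (𝓡 n) x₀).map_target hp)
  rw [(extChartAt (𝓡 n) x₀).right_inv hp] at h3
  rw [h2, mfderiv_eq_fderiv, h3]
  rfl

end ChartDerivative

/-! ### Comparison of the metrics at nearby points, with constant near 1. -/

section Sharp

theorem isContinuousRiemannianBundle_of_contMDiff {n : ℕ} {M : Type*} [TopologicalSpace M] 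
    [ChartedSpace (EuclideanSpace ℝ (Fin n)) M] [IsManifold (𝓡 n) ∞ M]
    [RiemannianBundle (fun x : M ↦ TangentSpace (𝓡 n) x)]
    [h : IsContMDiffRiemannianBundle (𝓡 n) ∞ (EuclideanSpace ℝ (Fin n))
      (fun x : M ↦ TangentSpace (𝓡 n) x)] :
    IsContinuousRiemannianBundle (EuclideanSpace ℝ (Fin n))
      (fun x : M ↦ TangentSpace (𝓡 n) x) := by
  obtain ⟨g, hg, hg'⟩ := h.exists_contMDiff
  exact ⟨g, hg.continuous, hg'⟩

variable {n : ℕ} {M : Type*} [TopologicalSpace M]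
  [ChartedSpace (EuclideanSpace ℝ (Fin n)) M] [IsManifold (𝓡 n) ∞ M]
  [RiemannianBundle (fun x : M ↦ TangentSpace (𝓡 n) x)]
  [IsContinuousRiemannianBundle (EuclideanSpace ℝ (Fin n)) (fun x : M ↦ TangentSpace (𝓡 n) x)]

/-- Continuity of the metric. That r may be any number above 1 is what gives the coarea inequality
its sharp constant. -/
theorem eventually_norm_chartDerivSymm_chartDeriv_le (x₀ : M) {r : ℝ} (hr : 1 < r) :
    ∀ᶠ x in 𝓝 x₀, ∀ v : TangentSpace (𝓡 n) x,
      ‖chartDerivSymm x₀ x₀ (chartDeriv x₀ x v)‖ ≤ r * ‖v‖ := by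
  filter_upwards [eventually_norm_symmL_trivializationAt_self_comp_lt (EuclideanSpace ℝ (Fin n))
    (fun x : M ↦ TangentSpace (𝓡 n) x) x₀ hr] with x hx v
  exact ContinuousLinearMap.le_of_opNorm_le _ hx.le v

theorem eventually_norm_chartDerivSymm_le (x₀ : M) {r : ℝ} (hr : 1 < r) :
    ∀ᶠ x in 𝓝 x₀, ∀ e : EuclideanSpace ℝ (Fin n),
      ‖chartDerivSymm x₀ x e‖ ≤ r * ‖chartDerivSymm x₀ x₀ e‖ := by
  filter_upwards [eventually_norm_symmL_trivializationAt_comp_self_lt (EuclideanSpace ℝ (Fin n))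
    (fun x : M ↦ TangentSpace (𝓡 n) x) x₀ hr] with x hx e
  have := ContinuousLinearMap.le_of_opNorm_le _ hx.le (chartDerivSymm x₀ x₀ e)
  have h2 := chartDeriv_chartDerivSymm (mem_extChartAt_source (I := 𝓡 n) x₀) e
  rw [ContinuousLinearMap.comp_apply] at this
  erw [h2] at this
  exact this

end Sharp

/-! ### Bilipschitz charts with controlled constant. -/

section Bilipschitz

variable {n : ℕ} {M : Type*} [EMetricSpace M]
  [ChartedSpace (EuclideanSpace ℝ (Fin n)) M] [IsManifold (𝓡 n) ∞ M]
  [RiemannianBundle (fun x : M ↦ TangentSpace (𝓡 n) x)]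
  [IsContinuousRiemannianBundle (EuclideanSpace ℝ (Fin n)) (fun x : M ↦ TangentSpace (𝓡 n) x)]
  [IsRiemannianManifold (𝓡 n) M]

/-- At `x₀` itself the derivative A distorts the metric by at most `K₁`; derivatives and metric vary
continuously, so any larger constant works nearby. It is applied with Ψ the identity, for an
ordinary chart, and with A an isometry and `K₁ = 1`, for a chart adapted to a function. -/
theorem exists_bilipschitz_openPartialHomeomorph (x₀ : M)
    {Ψ : EuclideanSpace ℝ (Fin n) → EuclideanSpace ℝ (Fin n)}
    {A : EuclideanSpace ℝ (Fin n) ≃L[ℝ] EuclideanSpace ℝ (Fin n)}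
    (hΨ : ContDiffAt ℝ ∞ Ψ (extChartAt (𝓡 n) x₀ x₀))
    (hA : HasFDerivAt Ψ (A : EuclideanSpace ℝ (Fin n) →L[ℝ] EuclideanSpace ℝ (Fin n))
      (extChartAt (𝓡 n) x₀ x₀))
    {K₁ K : ℝ≥0} (hK : K₁ < K)
    (h₁ : ∀ e, ‖A e‖ ≤ K₁ * ‖chartDerivSymm x₀ x₀ e‖)
    (h₂ : ∀ e, ‖chartDerivSymm x₀ x₀ e‖ ≤ K₁ * ‖A e‖) :
    ∃ Q : OpenPartialHomeomorph M (EuclideanSpace ℝ (Fin n)),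
      x₀ ∈ Q.source ∧ Q.source ⊆ (extChartAt (𝓡 n) x₀).source ∧
      (∀ x, Q x = Ψ (extChartAt (𝓡 n) x₀ x)) ∧
      LipschitzOnWith K Q Q.source ∧ LipschitzOnWith K Q.symm Q.target := by
  set φ := extChartAt (𝓡 n) x₀ with hφ
  set y₀ := φ x₀ with hy₀
  have hx₀ : x₀ ∈ φ.source := mem_extChartAt_source x₀
  -- constants
  obtain ⟨K₂, hK₂0, hK₂⟩ : ∃ K₂ : ℝ, 0 ≤ K₂ ∧ ∀ e : EuclideanSpace ℝ (Fin n),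
      ‖e‖ ≤ K₂ * ‖chartDerivSymm x₀ x₀ e‖ := by
    refine ⟨‖chartDeriv (n := n) x₀ x₀‖, ContinuousLinearMap.opNorm_nonneg _, fun e ↦ ?_⟩
    have := (chartDeriv x₀ x₀).le_opNorm (chartDerivSymm x₀ x₀ e)
    rwa [chartDeriv_chartDerivSymm hx₀] at this
  obtain ⟨K₃, hK₃0, hK₃⟩ : ∃ K₃ : ℝ, 0 ≤ K₃ ∧ ∀ e : EuclideanSpace ℝ (Fin n),
      ‖chartDerivSymm x₀ x₀ e‖ ≤ K₃ * ‖e‖ :=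
    ⟨‖chartDerivSymm (n := n) x₀ x₀‖, ContinuousLinearMap.opNorm_nonneg _, fun e ↦ (chartDerivSymm x₀ x₀).le_opNorm e⟩
  -- The room between `K₁` and K is shared: `K' - K₁` absorbs the variation of the derivatives of Ψ
  -- and of its inverse, the factor `K / K'` that of the metric.
  obtain ⟨K', hK1', hK'⟩ := exists_between hK
  have hK'0 : (0 : ℝ) < K' := lt_of_le_of_lt K₁.coe_nonneg (NNReal.coe_lt_coe.2 hK1')
  have hr : (1 : ℝ) < K / K' := by rw [one_lt_div hK'0]; exact_mod_cast hK'
  have hd : (0 : ℝ) < K' - K₁ := sub_pos.2 (by exact_mod_cast hK1')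
  -- the homeomorphism
  set e := hΨ.toOpenPartialHomeomorph Ψ hA (by simp) with he
  have hye : y₀ ∈ e.source := hΨ.mem_toOpenPartialHomeomorph_source hA (by simp)
  have hecoe : ∀ y, e y = Ψ y := fun y ↦ rfl
  have hesymm : ContDiffAt ℝ ∞ e.symm (e y₀) := hΨ.to_localInverse hA (by simp)
  have hesymmD : fderiv ℝ e.symm (e y₀) = (A.symm : EuclideanSpace ℝ (Fin n) →L[ℝ] _) := by
    have : HasFDerivAt e.symm (A.symm : EuclideanSpace ℝ (Fin n) →L[ℝ] _) (e y₀) := by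
      apply e.hasFDerivAt_symm (e.map_source hye)
      rw [e.left_inv hye]; exact hA
    exact this.fderiv
  set Q₀ : OpenPartialHomeomorph M (EuclideanSpace ℝ (Fin n)) :=
    (chartAt (EuclideanSpace ℝ (Fin n)) x₀).trans e with hQ₀
  have hφQ : ∀ x, Q₀ x = Ψ (φ x) := fun x ↦ rfl
  have hQs : ∀ p, Q₀.symm p = φ.symm (e.symm p) := fun x ↦ rfl
  have hx₀' : x₀ ∈ Q₀.source := by
    rw [hQ₀, OpenPartialHomeomorph.trans_source]
    exact ⟨mem_chart_source _ _, hye⟩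
  have hsrc : Q₀.source ⊆ φ.source := by
    rw [hQ₀, OpenPartialHomeomorph.trans_source, hφ, extChartAt_source]
    exact inter_subset_left
  -- control on the source side
  have ev1 : ∀ᶠ y in 𝓝 y₀, ContDiffAt ℝ 1 Ψ y :=
    (hΨ.of_le (by exact_mod_cast le_top)).eventually (by simp)
  have ev2 : ∀ᶠ y in 𝓝 y₀, ‖fderiv ℝ Ψ y - A‖ < (K' - K₁) / (K₂ + 1) := by
    have hc : ContinuousAt (fderiv ℝ Ψ) y₀ :=
      (hΨ.fderiv_right (m := 0) (by simp)).continuousAt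
    have := Metric.continuousAt_iff'.1 hc ((K' - K₁) / (K₂ + 1)) (by positivity)
    simpa [dist_eq_norm, hA.fderiv] using this
  have hφc : ContinuousAt φ x₀ := continuousAt_extChartAt x₀
  have ev3 := eventually_norm_chartDerivSymm_chartDeriv_le (n := n) x₀ hr
  have ev4 : ∀ᶠ x in 𝓝 x₀, x ∈ φ.source := extChartAt_source_mem_nhds x₀
  obtain ⟨U, hUsub, hUo, hxU⟩ := _root_.mem_nhds_iff.1
    ((hφc.eventually ev1).and ((hφc.eventually ev2).and (ev3.and ev4)))
  obtain ⟨V, hVo, hxV, hVU, hVlip⟩ : ∃ V : Set M, IsOpen V ∧ x₀ ∈ V ∧ V ⊆ U ∧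
      LipschitzOnWith K (Ψ ∘ φ) V := by
    apply exists_lipschitzOnWith_of_norm_mvfderiv_le (n := n) hUo _ _ hxU
    · intro x hx
      obtain ⟨h1, h2, h3, h4⟩ := hUsub hx
      exact (h1.contMDiffAt.comp x (contMDiffAt_extChartAt' (by simpa [hφ] using h4))).contMDiffWithinAt
    · intro x hx
      obtain ⟨h1, h2, h3, h4⟩ := hUsub hx
      have hd1 : MDifferentiableAt (𝓡 n) 𝓘(ℝ, EuclideanSpace ℝ (Fin n)) (Ψ ∘ φ) x :=
        (h1.contMDiffAt.comp x (contMDiffAt_extChartAt'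
          (by simpa [hφ] using h4))).mdifferentiableAt one_ne_zero
      refine ContinuousLinearMap.opNorm_le_bound _ K.coe_nonneg fun v ↦ ?_
      rw [mvfderiv_eq_fderiv_comp_chartDeriv h4 hd1]
      have hfd : fderiv ℝ ((Ψ ∘ φ) ∘ φ.symm) (φ x) = fderiv ℝ Ψ (φ x) := by
        apply Filter.EventuallyEq.fderiv_eq
        filter_upwards [(isOpen_extChartAt_target x₀).mem_nhds (φ.map_source h4)] with y hy
        simp only [Function.comp_apply, φ.right_inv hy]
      rw [hfd, ContinuousLinearMap.comp_apply]
      set w := chartDeriv x₀ x v with hw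
      have e1 : fderiv ℝ Ψ (φ x) w = A w + (fderiv ℝ Ψ (φ x) - A) w := by simp
      have e2 : ‖(fderiv ℝ Ψ (φ x) - A) w‖ ≤ (K' - K₁) * ‖chartDerivSymm x₀ x₀ w‖ := by
        calc _ ≤ ‖fderiv ℝ Ψ (φ x) - A‖ * ‖w‖ := ContinuousLinearMap.le_opNorm _ _
          _ ≤ (K' - K₁) / (K₂ + 1) * ((K₂ + 1) * ‖chartDerivSymm x₀ x₀ w‖) := by
            gcongr
            exact (hK₂ w).trans (by gcongr; linarith)
          _ = _ := by field_simp
      calc ‖fderiv ℝ Ψ (φ x) w‖ ≤ ‖A w‖ + ‖(fderiv ℝ Ψ (φ x) - A) w‖ := by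
            rw [e1]; exact norm_add_le _ _
        _ ≤ K₁ * ‖chartDerivSymm x₀ x₀ w‖ + (K' - K₁) * ‖chartDerivSymm x₀ x₀ w‖ :=
            add_le_add (h₁ w) e2
        _ = K' * ‖chartDerivSymm x₀ x₀ w‖ := by ring
        _ ≤ K' * (K / K' * ‖v‖) := by gcongr; exact h3 v
        _ = K * ‖v‖ := by field_simp
  -- control on the target side
  have hQc : ContinuousAt Q₀.symm (e y₀) := by
    apply Q₀.continuousAt_symm
    exact Q₀.map_source hx₀'
  have hQx : Q₀.symm (e y₀) = x₀ := Q₀.left_inv hx₀'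
  have ev5 : ∀ᶠ p in 𝓝 (e y₀), ContDiffAt ℝ 1 e.symm p :=
    (hesymm.of_le (by exact_mod_cast le_top)).eventually (by simp)
  have ev6 : ∀ᶠ p in 𝓝 (e y₀), ‖fderiv ℝ e.symm p - A.symm‖ < (K' - K₁) / (K₃ + 1) := by
    have hc : ContinuousAt (fderiv ℝ e.symm) (e y₀) :=
      (hesymm.fderiv_right (m := 0) (by simp)).continuousAt
    have := Metric.continuousAt_iff'.1 hc ((K' - K₁) / (K₃ + 1)) (by positivity)
    simpa [dist_eq_norm, hesymmD] using this
  have ev7 : ∀ᶠ p in 𝓝 (e y₀), ∀ w : EuclideanSpace ℝ (Fin n),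
      ‖chartDerivSymm x₀ (Q₀.symm p) w‖ ≤ K / K' * ‖chartDerivSymm x₀ x₀ w‖ := by
    refine hQc.eventually (p := fun x ↦ ∀ w : EuclideanSpace ℝ (Fin n),
      ‖chartDerivSymm x₀ x w‖ ≤ K / K' * ‖chartDerivSymm x₀ x₀ w‖) ?_
    rw [hQx]
    exact eventually_norm_chartDerivSymm_le x₀ hr
  have ev8 : ∀ᶠ p in 𝓝 (e y₀), p ∈ Q₀.target :=
    Q₀.open_target.mem_nhds (Q₀.map_source hx₀')
  -- A ball is taken because `lipschitzOnWith_of_norm_mfderiv_le` needs a convex domain.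
  obtain ⟨ρ, hρ, hball⟩ := Metric.eventually_nhds_iff_ball.1 (ev5.and (ev6.and (ev7.and ev8)))
  have hes : ∀ p ∈ Q₀.target, e.symm p ∈ φ.target := by
    intro p hp
    rw [hQ₀, OpenPartialHomeomorph.trans_target] at hp
    rw [hφ, extChartAt_target]
    simpa using hp.2
  have hlip2 : LipschitzOnWith K Q₀.symm (Metric.ball (e y₀) ρ) := by
    have hcoe : (Q₀.symm : EuclideanSpace ℝ (Fin n) → M) = φ.symm ∘ e.symm := rfl
    apply lipschitzOnWith_of_norm_mfderiv_le (n := n) Metric.isOpen_ball (convex_ball _ _)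
    · intro p hp
      obtain ⟨h1, h2, h3, h4⟩ := hball p hp
      rw [hcoe]
      refine ((contMDiffOn_extChartAt_symm x₀).contMDiffAt
        ((isOpen_extChartAt_target x₀).mem_nhds (hes p h4))).comp p h1.contMDiffAt
        |>.contMDiffWithinAt
    · intro p hp w
      obtain ⟨h1, h2, h3, h4⟩ := hball p hp
      have hm := mfderiv_extChartAt_symm_comp_apply (hes p h4) (h1.differentiableAt one_ne_zero) w
      have e1 : fderiv ℝ e.symm p w = A.symm w + (fderiv ℝ e.symm p - A.symm) w := by simp
      have e2 : ‖chartDerivSymm x₀ x₀ (fderiv ℝ e.symm p w)‖ ≤ K' * ‖w‖ := by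
        calc _ = ‖chartDerivSymm x₀ x₀ (A.symm w) +
              chartDerivSymm x₀ x₀ ((fderiv ℝ e.symm p - A.symm) w)‖ := by
              rw [← map_add, ← e1]
          _ ≤ ‖chartDerivSymm x₀ x₀ (A.symm w)‖ +
              ‖chartDerivSymm x₀ x₀ ((fderiv ℝ e.symm p - A.symm) w)‖ := norm_add_le _ _
          _ ≤ K₁ * ‖w‖ + (K₃ + 1) * ((K' - K₁) / (K₃ + 1) * ‖w‖) := by
            gcongr
            · simpa using h₂ (A.symm w)
            · refine (hK₃ _).trans ?_
              gcongr
              · linarith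
              · refine (ContinuousLinearMap.le_opNorm _ _).trans ?_
                gcongr
          _ = K' * ‖w‖ := by field_simp; ring
      calc _ = ‖chartDerivSymm x₀ (Q₀.symm p) (fderiv ℝ e.symm p w)‖ := congrArg norm hm
        _ ≤ K / K' * ‖chartDerivSymm x₀ x₀ (fderiv ℝ e.symm p w)‖ := h3 _
        _ ≤ K / K' * (K' * ‖w‖) := by gcongr
        _ = K * ‖w‖ := by field_simp
  -- restriction
  set Q := Q₀.restrOpen _ (hVo.inter (Q₀.isOpen_inter_preimage Metric.isOpen_ball :
    IsOpen (Q₀.source ∩ Q₀ ⁻¹' Metric.ball (e y₀) ρ))) with hQ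
  have hQsrc : Q.source = Q₀.source ∩ (V ∩ (Q₀.source ∩ Q₀ ⁻¹' Metric.ball (e y₀) ρ)) :=
    OpenPartialHomeomorph.restrOpen_source _ _ _
  refine ⟨Q, ?_, ?_, fun x ↦ rfl, ?_, ?_⟩
  · rw [hQsrc]
    exact ⟨hx₀', hxV, hx₀', Metric.mem_ball_self hρ⟩
  · rw [hQsrc]
    exact inter_subset_left.trans hsrc
  · apply hVlip.mono
    rw [hQsrc]
    exact fun x hx ↦ hx.2.1
  · apply hlip2.mono
    intro p hp
    have h1 := Q.map_target hp
    have h2 := Q.right_inv hp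
    rw [hQsrc] at h1
    have h3 : Q₀ (Q.symm p) ∈ Metric.ball (e y₀) ρ := h1.2.2.2
    have h4 : Q₀ (Q.symm p) = p := h2
    rwa [h4] at h3

/-- Each point has a neighbourhood on which the preferred chart is bilipschitz. -/
theorem exists_bilipschitz_chart (x₀ : M) : ∃ (K : ℝ≥0)
    (Q : OpenPartialHomeomorph M (EuclideanSpace ℝ (Fin n))),
      x₀ ∈ Q.source ∧ Q.source ⊆ (extChartAt (𝓡 n) x₀).source ∧
      (∀ x, Q x = extChartAt (𝓡 n) x₀ x) ∧
      LipschitzOnWith K Q Q.source ∧ LipschitzOnWith K Q.symm Q.target := by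
  set K₁ : ℝ≥0 := ‖chartDeriv (n := n) x₀ x₀‖₊ + ‖chartDerivSymm (n := n) x₀ x₀‖₊ with hK₁
  have h₁ : ∀ e : EuclideanSpace ℝ (Fin n), ‖e‖ ≤ K₁ * ‖chartDerivSymm x₀ x₀ e‖ := by
    intro e
    have := (chartDeriv (n := n) x₀ x₀).le_opNorm (chartDerivSymm x₀ x₀ e)
    rw [chartDeriv_chartDerivSymm (mem_extChartAt_source (I := 𝓡 n) x₀)] at this
    refine this.trans ?_
    gcongr
    simp [hK₁]
  have h₂ : ∀ e : EuclideanSpace ℝ (Fin n), ‖chartDerivSymm x₀ x₀ e‖ ≤ K₁ * ‖e‖ := by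
    intro e
    refine ((chartDerivSymm x₀ x₀).le_opNorm e).trans ?_
    gcongr
    simp [hK₁]
  obtain ⟨Q, h⟩ := exists_bilipschitz_openPartialHomeomorph (n := n) x₀ (Ψ := id)
    (A := ContinuousLinearEquiv.refl ℝ _) contDiffAt_id (hasFDerivAt_id _)
    (K₁ := K₁) (K := K₁ + 1) (lt_add_one _) h₁ h₂
  exact ⟨_, Q, h⟩

end Bilipschitz

/-! ### Hausdorff measures under Lipschitz maps. -/

section Hausdorff

variable {X Y : Type*} [EMetricSpace X] [MeasurableSpace X] [BorelSpace X]
  [EMetricSpace Y] [MeasurableSpace Y] [BorelSpace Y]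

theorem LipschitzOnWith.euclideanHausdorffMeasure_image_le {K : ℝ≥0} {f : X → Y} {s : Set X}
    (hf : LipschitzOnWith K f s) (d : ℕ) :
    (μHE[d] : Measure Y) (f '' s) ≤ (K : ℝ≥0∞) ^ d * (μHE[d] : Measure X) s := by
  simp only [Measure.euclideanHausdorffMeasure_def, Measure.smul_apply, ENNReal.smul_def,
    smul_eq_mul]
  calc _ ≤ _ * ((K : ℝ≥0∞) ^ (d : ℝ) * Measure.hausdorffMeasure (d : ℝ) s) := by
        gcongr
        exact hf.hausdorffMeasure_image_le (Nat.cast_nonneg d)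
    _ = _ := by rw [ENNReal.rpow_natCast]; ring

end Hausdorff

/-! ### Riemannian volume against Lebesgue measure in a bilipschitz chart. -/

section Comparison

variable {n : ℕ} {M : Type*} [EMetricSpace M] [MeasurableSpace M] [BorelSpace M]
  {Q : OpenPartialHomeomorph M (EuclideanSpace ℝ (Fin n))} {K : ℝ≥0}

theorem volume_image_le_riemannianVolume (hQ : LipschitzOnWith K Q Q.source) {s : Set M}
    (hs : s ⊆ Q.source) : volume (Q '' s) ≤ (K : ℝ≥0∞) ^ n * riemannianVolume n M s := by
  rw [← EuclideanSpace.euclideanHausdorffMeasure_eq_volume]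
  exact (hQ.mono hs).euclideanHausdorffMeasure_image_le n

theorem riemannianVolume_image_symm_le (hQ : LipschitzOnWith K Q.symm Q.target)
    {s : Set (EuclideanSpace ℝ (Fin n))} (hs : s ⊆ Q.target) :
    riemannianVolume n M (Q.symm '' s) ≤ (K : ℝ≥0∞) ^ n * volume s := by
  rw [← EuclideanSpace.euclideanHausdorffMeasure_eq_volume]
  exact (hQ.mono hs).euclideanHausdorffMeasure_image_le n

omit [MeasurableSpace M] [BorelSpace M] in
theorem OpenPartialHomeomorph.image_eq_target_inter_preimage_symm (s : Set M) :
    Q '' (s ∩ Q.source) = Q.target ∩ Q.symm ⁻¹' s := by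
  rw [inter_comm]; exact Q.image_source_inter_eq' s

theorem aemeasurable_openPartialHomeomorph_symm :
    AEMeasurable Q.symm (volume.restrict Q.target) :=
  Q.continuousOn_symm.aemeasurable Q.open_target.measurableSet

/-- With `riemannianVolume_le_map_symm` this takes the place of a change of variables formula. The
volume is known only up to the factor `K ^ n`, which suffices for null sets and for L² errors that
tend to zero. -/
theorem map_symm_le_riemannianVolume (hQ : LipschitzOnWith K Q Q.source) :
    (volume.restrict Q.target).map Q.symm ≤
      (K : ℝ≥0∞) ^ n • (riemannianVolume n M).restrict Q.source := by
  refine Measure.le_iff.2 fun s hs ↦ ?_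
  rw [Measure.map_apply_of_aemeasurable aemeasurable_openPartialHomeomorph_symm hs,
    Measure.restrict_apply' Q.open_target.measurableSet, Measure.smul_apply,
    Measure.restrict_apply hs, smul_eq_mul, inter_comm,
    ← OpenPartialHomeomorph.image_eq_target_inter_preimage_symm]
  exact volume_image_le_riemannianVolume hQ inter_subset_right

theorem riemannianVolume_le_map_symm (hQ : LipschitzOnWith K Q.symm Q.target) :
    (riemannianVolume n M).restrict Q.source ≤
      (K : ℝ≥0∞) ^ n • (volume.restrict Q.target).map Q.symm := by
  refine Measure.le_iff.2 fun s hs ↦ ?_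
  rw [Measure.smul_apply, Measure.map_apply_of_aemeasurable
    aemeasurable_openPartialHomeomorph_symm hs,
    Measure.restrict_apply' Q.open_target.measurableSet,
    Measure.restrict_apply hs, smul_eq_mul, inter_comm (Q.symm ⁻¹' s),
    ← OpenPartialHomeomorph.image_eq_target_inter_preimage_symm]
  have h : Q.symm '' (Q '' (s ∩ Q.source)) = s ∩ Q.source := by
    rw [image_image]
    exact (image_congr fun x hx ↦ Q.left_inv hx.2).trans (image_id' _)
  conv_lhs => rw [← h]
  apply riemannianVolume_image_symm_le hQ
  rintro _ ⟨x, hx, rfl⟩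
  exact Q.map_source hx.2

theorem lintegral_source_le (hQ : LipschitzOnWith K Q.symm Q.target) {h : M → ℝ≥0∞}
    (hm : AEMeasurable h ((volume.restrict Q.target).map Q.symm)) :
    ∫⁻ x in Q.source, h x ∂(riemannianVolume n M) ≤
      (K : ℝ≥0∞) ^ n * ∫⁻ y in Q.target, h (Q.symm y) := by
  calc _ ≤ ∫⁻ x, h x ∂((K : ℝ≥0∞) ^ n • (volume.restrict Q.target).map Q.symm) :=
        lintegral_mono' (riemannianVolume_le_map_symm hQ) le_rfl
    _ = _ := by
      rw [lintegral_smul_measure, smul_eq_mul,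
        lintegral_map' hm aemeasurable_openPartialHomeomorph_symm]

theorem map_symm_absolutelyContinuous (hQ : LipschitzOnWith K Q Q.source) :
    (volume.restrict Q.target).map Q.symm ≪ riemannianVolume n M :=
  ((map_symm_le_riemannianVolume hQ).absolutelyContinuous.trans
    (Measure.smul_absolutelyContinuous)).trans Measure.absolutelyContinuous_restrict

theorem quasiMeasurePreserving_symm (hQ : LipschitzOnWith K Q Q.source) {p : M → Prop}
    (h : ∀ᵐ x ∂(riemannianVolume n M), p x) : ∀ᵐ y ∂(volume.restrict Q.target), p (Q.symm y) :=
  ae_of_ae_map aemeasurable_openPartialHomeomorph_symm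
    ((map_symm_absolutelyContinuous hQ).ae_le h)

end Comparison

/-- For a norm g taken in a fibre that varies with x: N is the same quantity measured in the fixed
fibre at `x₀`, and the ratio of the two tends to 1. -/
theorem continuousAt_of_forall_le_mul {X : Type*} [TopologicalSpace X] {g N : X → ℝ} {x₀ : X}
    (hN : ContinuousAt N x₀) (hN0 : 0 ≤ N x₀) (hg : g x₀ = N x₀) (hg0 : ∀ x, 0 ≤ g x)
    (h : ∀ r : ℝ, 1 < r → ∀ᶠ x in 𝓝 x₀, N x ≤ r * g x ∧ g x ≤ r * N x) :
    ContinuousAt g x₀ := by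
  have key : ∀ a b : ℝ, 0 ≤ a → a < b → ∃ r : ℝ, 1 < r ∧ r * a < b := by
    intro a b ha hab
    refine ⟨1 + (b - a) / (2 * (a + 1)), ?_, ?_⟩
    · have : 0 < (b - a) / (2 * (a + 1)) := div_pos (by linarith) (by linarith)
      linarith
    · have h1 : (b - a) / (2 * (a + 1)) * a ≤ (b - a) / 2 := by
        rw [div_mul_eq_mul_div, div_le_div_iff₀ (by linarith) (by norm_num)]
        nlinarith
      nlinarith
  refine tendsto_order.2 ⟨fun b hb ↦ ?_, fun b hb ↦ ?_⟩
  · rcases lt_or_ge b 0 with hb0 | hb0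
    · exact Eventually.of_forall fun x ↦ hb0.trans_le (hg0 x)
    · rw [hg] at hb
      obtain ⟨r, hr, hrb⟩ := key b _ hb0 hb
      filter_upwards [h r hr, hN.eventually (lt_mem_nhds hrb)] with x hx hx'
      by_contra! hc
      nlinarith [hx.1]
  · rw [hg] at hb
    obtain ⟨r, hr, hrb⟩ := key _ b hN0 hb
    have : ContinuousAt (fun x ↦ r * N x) x₀ := continuousAt_const.mul hN
    filter_upwards [h r hr, this.eventually (gt_mem_nhds hrb)] with x hx hx'
    exact hx.2.trans_lt hx'

/-! ### Continuity of the norm of the differential. -/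

section Norm

variable {n : ℕ} {M : Type*} [TopologicalSpace M]
  [ChartedSpace (EuclideanSpace ℝ (Fin n)) M] [IsManifold (𝓡 n) ∞ M]
  [RiemannianBundle (fun x : M ↦ TangentSpace (𝓡 n) x)]
  {F : Type*} [NormedAddCommGroup F] [NormedSpace ℝ F]
  [IsContinuousRiemannianBundle (EuclideanSpace ℝ (Fin n)) (fun x : M ↦ TangentSpace (𝓡 n) x)]

/-- The coordinate differential `L x` lives in a fixed space and is continuous in x. Measuring it
with the metric at `x₀` instead of x changes its norm by a factor near 1. -/
theorem continuous_norm_mvfderiv {f : M → F} (hf : ContMDiff (𝓡 n) 𝓘(ℝ, F) ∞ f) :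
    Continuous fun x ↦ ‖mvfderiv (𝓡 n) f x‖ := by
  refine continuous_iff_continuousAt.2 fun x₀ ↦ ?_
  set φ := extChartAt (𝓡 n) x₀ with hφ
  have hx₀ : x₀ ∈ φ.source := mem_extChartAt_source x₀
  have hfd : ∀ x, MDifferentiableAt (𝓡 n) 𝓘(ℝ, F) f x := fun x ↦
    (hf x).mdifferentiableAt (by simp)
  set L : M → EuclideanSpace ℝ (Fin n) →L[ℝ] F := fun x ↦ fderiv ℝ (f ∘ φ.symm) (φ x) with hL
  have hLc : ContinuousAt L x₀ := by
    have h1 : ContDiffAt ℝ ∞ (f ∘ φ.symm) (φ x₀) := by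
      rw [← contMDiffAt_iff_contDiffAt]
      refine ContMDiffAt.comp (I' := 𝓡 n) _ hf.contMDiffAt ?_
      exact (contMDiffOn_extChartAt_symm x₀).contMDiffAt
        ((isOpen_extChartAt_target x₀).mem_nhds (φ.map_source hx₀))
    have h2 : ContinuousAt (fderiv ℝ (f ∘ φ.symm)) (φ x₀) :=
      (h1.fderiv_right (m := 0) (by simp)).continuousAt
    exact ContinuousAt.comp (f := φ) h2 (continuousAt_extChartAt x₀)
  have hdf : ∀ x ∈ φ.source, ∀ v, mvfderiv (𝓡 n) f x v = L x (chartDeriv x₀ x v) := by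
    intro x hx v
    rw [mvfderiv_eq_fderiv_comp_chartDeriv hx (hfd x)]; rfl
  refine continuousAt_of_forall_le_mul (N := fun x ↦ ‖(L x).comp (chartDeriv x₀ x₀)‖)
    ?_ (ContinuousLinearMap.opNorm_nonneg _) ?_
    (fun x ↦ ContinuousLinearMap.opNorm_nonneg _) fun r hr ↦ ?_
  · have h1 : LipschitzWith ‖chartDeriv (n := n) x₀ x₀‖₊
        fun T : EuclideanSpace ℝ (Fin n) →L[ℝ] F ↦ ‖T.comp (chartDeriv (n := n) x₀ x₀)‖ := by
      refine LipschitzWith.of_le_add_mul _ fun T T' ↦ ?_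
      refine ContinuousLinearMap.opNorm_le_bound _ (add_nonneg (ContinuousLinearMap.opNorm_nonneg _)
        (mul_nonneg (NNReal.coe_nonneg _) dist_nonneg)) fun v ↦ ?_
      have e1 : T.comp (chartDeriv x₀ x₀) v =
        T'.comp (chartDeriv x₀ x₀) v + (T - T') (chartDeriv x₀ x₀ v) := by simp
      rw [e1, add_mul]
      refine (norm_add_le _ _).trans (add_le_add (ContinuousLinearMap.le_opNorm _ _) ?_)
      calc _ ≤ ‖T - T'‖ * (‖chartDeriv (n := n) x₀ x₀‖ * ‖v‖) :=
            ContinuousLinearMap.le_opNorm_of_le _ (ContinuousLinearMap.le_opNorm _ _)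
        _ = _ := by rw [dist_eq_norm, coe_nnnorm]; ring
    exact h1.continuous.continuousAt.comp hLc
  · congr 1
    ext v
    rw [hdf x₀ hx₀]; rfl
  · filter_upwards [eventually_norm_chartDerivSymm_chartDeriv_le (n := n) x₀ hr,
      eventually_norm_chartDerivSymm_le (n := n) x₀ hr, extChartAt_source_mem_nhds (I := 𝓡 n) x₀]
      with x h1 h2 h3
    have hr0 : 0 ≤ r := by linarith
    constructor
    · refine ContinuousLinearMap.opNorm_le_bound _
        (mul_nonneg hr0 (ContinuousLinearMap.opNorm_nonneg _)) fun v ↦ ?_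
      have e1 : (L x).comp (chartDeriv x₀ x₀) v =
          mvfderiv (𝓡 n) f x (chartDerivSymm x₀ x (chartDeriv x₀ x₀ v)) := by
        rw [hdf x h3, chartDeriv_chartDerivSymm h3]; rfl
      rw [e1]
      have e2 := h2 (chartDeriv x₀ x₀ v)
      rw [chartDerivSymm_chartDeriv hx₀] at e2
      calc _ ≤ ‖mvfderiv (𝓡 n) f x‖ * ‖chartDerivSymm x₀ x (chartDeriv x₀ x₀ v)‖ :=
            ContinuousLinearMap.le_opNorm _ _
        _ ≤ ‖mvfderiv (𝓡 n) f x‖ * (r * ‖v‖) :=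
            mul_le_mul_of_nonneg_left e2 (ContinuousLinearMap.opNorm_nonneg _)
        _ = _ := by ring
    · refine ContinuousLinearMap.opNorm_le_bound _
        (mul_nonneg hr0 (ContinuousLinearMap.opNorm_nonneg _)) fun v ↦ ?_
      have e1 : mvfderiv (𝓡 n) f x v =
          (L x).comp (chartDeriv x₀ x₀) (chartDerivSymm x₀ x₀ (chartDeriv x₀ x v)) := by
        rw [hdf x h3, ContinuousLinearMap.comp_apply, chartDeriv_chartDerivSymm hx₀]
      rw [e1]
      calc _ ≤ ‖(L x).comp (chartDeriv x₀ x₀)‖ * ‖chartDerivSymm x₀ x₀ (chartDeriv x₀ x v)‖ :=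
            ContinuousLinearMap.le_opNorm _ _
        _ ≤ ‖(L x).comp (chartDeriv x₀ x₀)‖ * (r * ‖v‖) :=
            mul_le_mul_of_nonneg_left (h1 v) (ContinuousLinearMap.opNorm_nonneg _)
        _ = _ := by ring

end Norm

/-! ### Finiteness of the volume. -/

section Finite

variable {n : ℕ} {M : Type*} [EMetricSpace M] [MeasurableSpace M] [BorelSpace M]
  [ChartedSpace (EuclideanSpace ℝ (Fin n)) M] [IsManifold (𝓡 n) ∞ M]
  [RiemannianBundle (fun x : M ↦ TangentSpace (𝓡 n) x)]
  [IsContinuousRiemannianBundle (EuclideanSpace ℝ (Fin n)) (fun x : M ↦ TangentSpace (𝓡 n) x)]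
  [IsRiemannianManifold (𝓡 n) M]

variable (n M) in
theorem isLocallyFiniteMeasure_riemannianVolume :
    IsLocallyFiniteMeasure (riemannianVolume n M) := by
  refine ⟨fun x₀ ↦ ?_⟩
  obtain ⟨K, Q, hx, -, -, hQ, hQ'⟩ := exists_bilipschitz_chart (n := n) x₀
  obtain ⟨r, hr, hball⟩ := Metric.isOpen_iff.1 Q.open_target _ (Q.map_source hx)
  refine ⟨Q.symm '' Metric.ball (Q x₀) r, ?_, ?_⟩
  · refine (Q.symm.isOpen_image_of_subset_source Metric.isOpen_ball hball).mem_nhds ?_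
    exact ⟨Q x₀, Metric.mem_ball_self hr, Q.left_inv hx⟩
  · refine (riemannianVolume_image_symm_le hQ' hball).trans_lt ?_
    exact ENNReal.mul_lt_top (by simp) measure_ball_lt_top

variable (n M) in
theorem isFiniteMeasure_riemannianVolume [CompactSpace M] :
    IsFiniteMeasure (riemannianVolume n M) := by
  have := isLocallyFiniteMeasure_riemannianVolume n M
  exact ⟨isCompact_univ.measure_lt_top⟩

end Finite

/-! ### Fubini's theorem for the slices of Euclidean space by hyperplanes. -/

section Slices

variable {m : ℕ}

/-- The isometric embedding of `ℝᵐ` onto the hyperplane `{y | y 0 = s}` of `ℝᵐ⁺¹`. -/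
def sliceMap (s : ℝ) (z : EuclideanSpace ℝ (Fin m)) : EuclideanSpace ℝ (Fin (m + 1)) :=
  WithLp.toLp 2 (Fin.cons s z)

theorem isometry_sliceMap (s : ℝ) : Isometry (sliceMap (m := m) s) := by
  refine Isometry.of_dist_eq fun z w ↦ ?_
  simp [EuclideanSpace.dist_eq, sliceMap, Fin.sum_univ_succ]

theorem exists_eq_sliceMap (y : EuclideanSpace ℝ (Fin (m + 1))) : ∃ z, sliceMap (y 0) z = y := by
  refine ⟨WithLp.toLp 2 (Fin.tail y), ?_⟩
  ext i
  refine Fin.cases ?_ (fun j ↦ ?_) i <;> simp [sliceMap]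

theorem measurePreserving_sliceMap : MeasurePreserving
    (fun p : ℝ × EuclideanSpace ℝ (Fin m) ↦ sliceMap p.1 p.2) (volume.prod volume) volume := by
  have h1 := (volume_preserving_piFinSuccAbove (fun _ : Fin (m + 1) ↦ ℝ) 0).symm
  have h2 := (MeasurePreserving.id (volume : Measure ℝ)).prod
    (PiLp.volume_preserving_ofLp (ι := Fin m))
  have h3 := (PiLp.volume_preserving_toLp (Fin (m + 1))).comp (h1.comp h2)
  have h4 : (fun p : ℝ × EuclideanSpace ℝ (Fin m) ↦ sliceMap p.1 p.2) =
      WithLp.toLp 2 ∘ (MeasurableEquiv.piFinSuccAbove (fun _ : Fin (m + 1) ↦ ℝ) 0).symm ∘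
        Prod.map id WithLp.ofLp := by
    funext p
    ext i
    refine Fin.cases ?_ (fun j ↦ ?_) i <;> simp [sliceMap, MeasurableEquiv.piFinSuccAbove]
  rw [h4]
  exact h3

theorem measurable_volume_preimage_sliceMap {A : Set (EuclideanSpace ℝ (Fin (m + 1)))}
    (hA : MeasurableSet A) : Measurable fun s : ℝ ↦ volume (sliceMap s ⁻¹' A) :=
  measurable_measure_prodMk_left (measurePreserving_sliceMap.measurable hA)

theorem lintegral_volume_preimage_sliceMap {A : Set (EuclideanSpace ℝ (Fin (m + 1)))}
    (hA : MeasurableSet A) : ∫⁻ s : ℝ, volume (sliceMap s ⁻¹' A) = volume A := by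
  rw [← measurePreserving_sliceMap.measure_preimage hA.nullMeasurableSet,
    Measure.prod_apply (measurePreserving_sliceMap.measurable hA)]
  rfl

theorem lintegral_comp_sub_div {h : ℝ → ℝ≥0∞} (hh : Measurable h) {a : ℝ} (ha : 0 < a) (c : ℝ) :
    ∫⁻ t, h ((t - c) / a) = ENNReal.ofReal a * ∫⁻ s, h s := by
  rw [lintegral_sub_right_eq_self (fun t ↦ h (t / a)) c]
  have := Real.smul_map_volume_mul_left (a := a⁻¹) (inv_ne_zero ha.ne')
  have h2 : ∫⁻ s, h s ∂(Measure.map (a⁻¹ * ·) volume) = ∫⁻ t, h (t / a) := by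
    rw [lintegral_map hh (measurable_const_mul _)]
    simp [div_eq_inv_mul]
  rw [← h2, Real.map_volume_mul_left (inv_ne_zero ha.ne'), lintegral_smul_measure]
  simp [abs_of_pos ha]

end Slices

/-- The normalized gradient of l is completed to an orthonormal basis of H, and A takes coordinates
in it. Here S is the derivative of an inverse chart, l the differential of a function. -/
theorem exists_linearEquiv_apply_zero_eq {m : ℕ} {H : Type*} [NormedAddCommGroup H]
    [InnerProductSpace ℝ H] (S : EuclideanSpace ℝ (Fin (m + 1)) →L[ℝ] H)
    (hS : Function.Bijective S) (l : H →L[ℝ] ℝ) (hl : ‖l‖ ≠ 0) :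
    ∃ A : EuclideanSpace ℝ (Fin (m + 1)) ≃L[ℝ] EuclideanSpace ℝ (Fin (m + 1)),
      (∀ e, ‖A e‖ = ‖S e‖) ∧ ∀ e, A e 0 = l (S e) / ‖l‖ := by
  let S' : EuclideanSpace ℝ (Fin (m + 1)) ≃ₗ[ℝ] H := LinearEquiv.ofBijective S.toLinearMap hS
  have : FiniteDimensional ℝ H := S'.finiteDimensional
  have hdim : Module.finrank ℝ H = Fintype.card (Fin (m + 1)) := by
    rw [← S'.finrank_eq]; simp
  set w := (InnerProductSpace.toDual ℝ H).symm l with hw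
  have hwn : ‖w‖ = ‖l‖ := by simp [hw]
  have hwi : ∀ v, inner ℝ w v = l v := fun v ↦ by simp [hw]
  have hon : Orthonormal ℝ (({0} : Set (Fin (m + 1))).domRestrict fun _ ↦ ‖l‖⁻¹ • w) := by
    refine ⟨fun i ↦ ?_, fun i j hij ↦ absurd (Subsingleton.elim i j) hij⟩
    simp [norm_smul, hwn, hl]
  obtain ⟨b, hb⟩ := Orthonormal.exists_orthonormalBasis_extension_of_card_eq hdim hon
  have hb0 := hb 0 rfl
  refine ⟨(S'.trans b.repr.toLinearEquiv).toContinuousLinearEquiv, fun e ↦ ?_, fun e ↦ ?_⟩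
  · change ‖b.repr (S e)‖ = _
    simp
  · change b.repr (S e) 0 = _
    rw [b.repr_apply_apply, hb0, real_inner_smul_left, hwi]
    ring

/-! ### The coarea inequality. -/

section Coarea

variable {m : ℕ} {M : Type*} [EMetricSpace M] [MeasurableSpace M] [BorelSpace M]
  [ChartedSpace (EuclideanSpace ℝ (Fin (m + 1))) M] [IsManifold (𝓡 (m + 1)) ∞ M]
  [RiemannianBundle (fun x : M ↦ TangentSpace (𝓡 (m + 1)) x)]
  [IsContinuousRiemannianBundle (EuclideanSpace ℝ (Fin (m + 1)))
    (fun x : M ↦ TangentSpace (𝓡 (m + 1)) x)]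
  [IsRiemannianManifold (𝓡 (m + 1)) M]

omit [MeasurableSpace M] [BorelSpace M] in
-- The affine map given by A is an isometry at `x₀` whose coordinate 0 agrees to first order with
-- the normalized f. Replacing that coordinate by the normalized f itself does not change the
-- derivative at `x₀`, so the bilipschitz constant is still near 1.
theorem exists_openPartialHomeomorph_straightening {f : M → ℝ}
    (hf : ContMDiff (𝓡 (m + 1)) 𝓘(ℝ, ℝ) ∞ f) {x₀ : M}
    (hx₀ : ‖mvfderiv (𝓡 (m + 1)) f x₀‖ ≠ 0) {r : ℝ≥0} (hr : 1 < r) :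
    ∃ Q : OpenPartialHomeomorph M (EuclideanSpace ℝ (Fin (m + 1))), x₀ ∈ Q.source ∧
      (∀ x ∈ Q.source, Q x 0 = (f x - f x₀) / ‖mvfderiv (𝓡 (m + 1)) f x₀‖) ∧
      LipschitzOnWith r Q Q.source ∧ LipschitzOnWith r Q.symm Q.target := by
  set φ := extChartAt (𝓡 (m + 1)) x₀ with hφ
  set a := ‖mvfderiv (𝓡 (m + 1)) f x₀‖ with ha
  have hxs : x₀ ∈ φ.source := mem_extChartAt_source x₀
  obtain ⟨A, hA1, hA2⟩ := exists_linearEquiv_apply_zero_eq (chartDerivSymm (n := m + 1) x₀ x₀)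
    ⟨fun v w h ↦ by
      have := congrArg (chartDeriv x₀ x₀) h
      rwa [chartDeriv_chartDerivSymm hxs, chartDeriv_chartDerivSymm hxs] at this,
      fun v ↦ ⟨_, chartDerivSymm_chartDeriv hxs v⟩⟩ (mvfderiv (𝓡 (m + 1)) f x₀) hx₀
  set y₀ := φ x₀ with hy₀
  set G : EuclideanSpace ℝ (Fin (m + 1)) → ℝ := f ∘ φ.symm with hG
  have hGs : ContDiffAt ℝ ∞ G y₀ := by
    rw [← contMDiffAt_iff_contDiffAt]
    refine ContMDiffAt.comp (I' := 𝓡 (m + 1)) _ hf.contMDiffAt ?_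
    exact (contMDiffOn_extChartAt_symm x₀).contMDiffAt
      ((isOpen_extChartAt_target x₀).mem_nhds (φ.map_source hxs))
  have hGd : ∀ e, fderiv ℝ G y₀ e = mvfderiv (𝓡 (m + 1)) f x₀ (chartDerivSymm x₀ x₀ e) := by
    intro e
    rw [hG, hy₀, fderiv_comp_extChartAt_symm hxs ((hf x₀).mdifferentiableAt (by simp))]
    rfl
  set u : EuclideanSpace ℝ (Fin (m + 1)) := EuclideanSpace.single 0 1 with hu
  set p : EuclideanSpace ℝ (Fin (m + 1)) →L[ℝ] ℝ := EuclideanSpace.proj 0 with hp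
  set Ψ : EuclideanSpace ℝ (Fin (m + 1)) → EuclideanSpace ℝ (Fin (m + 1)) := fun y ↦
    A (y - y₀) + ((G y - f x₀) / a - p (A (y - y₀))) • u with hΨ
  have hΨs : ContDiffAt ℝ ∞ Ψ y₀ := by
    have h1 : ContDiffAt ℝ ∞ (fun y ↦ A (y - y₀)) y₀ :=
      A.contDiff.contDiffAt.comp y₀ (contDiffAt_id.sub contDiffAt_const)
    exact h1.add ((((hGs.sub contDiffAt_const).div_const a).sub
      (p.contDiff.contDiffAt.comp y₀ h1)).smul contDiffAt_const)
  have hΨd : HasFDerivAt Ψ (A : EuclideanSpace ℝ (Fin (m + 1)) →L[ℝ] _) y₀ := by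
    have h1 : HasFDerivAt (fun y ↦ A (y - y₀)) (A : EuclideanSpace ℝ (Fin (m + 1)) →L[ℝ] _) y₀ :=
      A.hasFDerivAt.comp y₀ ((hasFDerivAt_id y₀).sub_const y₀)
    have h2 : HasFDerivAt (fun y ↦ (G y - f x₀) / a) (a⁻¹ • fderiv ℝ G y₀) y₀ := by
      simp only [div_eq_inv_mul]
      exact ((hGs.differentiableAt (by simp)).hasFDerivAt.sub_const (f x₀)).const_mul a⁻¹
    have h3 := h1.add ((h2.sub (p.hasFDerivAt.comp y₀ h1)).smul_const u)
    have h4 : a⁻¹ • fderiv ℝ G y₀ -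
        p.comp (A : EuclideanSpace ℝ (Fin (m + 1)) →L[ℝ] EuclideanSpace ℝ (Fin (m + 1))) = 0 := by
      ext e
      change a⁻¹ * fderiv ℝ G y₀ e - (A e) 0 = 0
      rw [hGd, hA2]; ring
    rw [h4, ContinuousLinearMap.zero_smulRight, add_zero] at h3
    exact h3
  obtain ⟨Q, h1, h2, h3, h4, h5⟩ := exists_bilipschitz_openPartialHomeomorph (n := m + 1) x₀ hΨs hΨd
    (K₁ := 1) hr (fun e ↦ by rw [hA1]; simp) (fun e ↦ by rw [hA1]; simp)
  refine ⟨Q, h1, fun x hx ↦ ?_, h4, h5⟩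
  have hGx : G (φ x) = f x := by
    simp only [hG, Function.comp_apply, φ.left_inv (h2 hx)]
  rw [h3, ← hGx]
  simp [hΨ, hu, hp, hφ]

/-- In the adapted chart the level sets of f lie in parallel hyperplanes, and Fubini gives equality.
Going back costs `r ^ m` for areas, `r ^ (m + 1)` for volumes, and one more r for replacing |df| by
its value a at `x₀`. The measurable majorant g avoids the question whether the area of a level set
is measurable in t. -/
theorem exists_nhds_coarea {f : M → ℝ} (hf : ContMDiff (𝓡 (m + 1)) 𝓘(ℝ, ℝ) ∞ f) {x₀ : M}
    (hx₀ : ‖mvfderiv (𝓡 (m + 1)) f x₀‖ ≠ 0) {r : ℝ≥0} (hr : 1 < r) :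
    ∃ U : Set M, IsOpen U ∧ x₀ ∈ U ∧ ∀ B ⊆ U, MeasurableSet B → ∃ g : ℝ → ℝ≥0∞, Measurable g ∧
      (∀ t, (μHE[m] : Measure M) ({x | f x = t} ∩ B) ≤ g t) ∧
      ∫⁻ t, g t ≤ (r : ℝ≥0∞) ^ (2 * m + 2) *
        ∫⁻ x in B, ENNReal.ofReal ‖mvfderiv (𝓡 (m + 1)) f x‖ ∂(riemannianVolume (m + 1) M) := by
  obtain ⟨Q, hxQ, hQ0, hQ, hQ'⟩ := exists_openPartialHomeomorph_straightening hf hx₀ hr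
  set a := ‖mvfderiv (𝓡 (m + 1)) f x₀‖ with ha
  have ha0 : 0 < a := lt_of_le_of_ne (ContinuousLinearMap.opNorm_nonneg _) (Ne.symm hx₀)
  have hcont := continuous_norm_mvfderiv hf
  have hr0 : (1 : ℝ) < r := by exact_mod_cast hr
  refine ⟨Q.source ∩ {x | a < r * ‖mvfderiv (𝓡 (m + 1)) f x‖},
    Q.open_source.inter (isOpen_lt continuous_const (continuous_const.mul hcont)),
    ⟨hxQ, by change a < r * a; nlinarith⟩, fun B hB hBm ↦ ?_⟩
  set A := Q '' B with hA
  have hBs : B ⊆ Q.source := fun x hx ↦ (hB hx).1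
  have hAt : A ⊆ Q.target := by
    rintro _ ⟨x, hx, rfl⟩; exact Q.map_source (hBs hx)
  have hAm : MeasurableSet A := by
    have h1 : A = Q.target ∩ Q.symm ⁻¹' B := by
      rw [← OpenPartialHomeomorph.image_eq_target_inter_preimage_symm, inter_eq_left.2 hBs]
    have h2 : Measurable (Q.target.domRestrict Q.symm) :=
      (continuousOn_iff_continuous_domRestrict.1 Q.continuousOn_symm).measurable
    have h3 := Q.open_target.measurableSet.subtype_image (h2 hBm)
    rw [h1]
    convert h3 using 1
    ext y
    simp [and_comm]
  refine ⟨fun t ↦ (r : ℝ≥0∞) ^ m * volume (sliceMap ((t - f x₀) / a) ⁻¹' A), ?_, fun t ↦ ?_, ?_⟩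
  · exact ((measurable_volume_preimage_sliceMap hAm).comp
      ((measurable_id.sub_const _).div_const _)).const_mul _
  · set s := (t - f x₀) / a with hs
    have hsub : {x | f x = t} ∩ B ⊆ Q.symm '' (sliceMap s '' (sliceMap s ⁻¹' A)) := by
      rintro x ⟨hxt, hxB⟩
      obtain ⟨z, hz⟩ := exists_eq_sliceMap (Q x)
      rw [hQ0 x (hBs hxB), show f x = t from hxt] at hz
      exact ⟨Q x, ⟨z, by rw [mem_preimage, hz]; exact mem_image_of_mem _ hxB, hz⟩,
        Q.left_inv (hBs hxB)⟩
    have hsubt : sliceMap s '' (sliceMap s ⁻¹' A) ⊆ Q.target :=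
      (image_preimage_subset _ _).trans hAt
    calc _ ≤ (μHE[m] : Measure M) (Q.symm '' (sliceMap s '' (sliceMap s ⁻¹' A))) :=
          measure_mono hsub
      _ ≤ (r : ℝ≥0∞) ^ m * (μHE[m] : Measure (EuclideanSpace ℝ (Fin (m + 1))))
            (sliceMap s '' (sliceMap s ⁻¹' A)) :=
          (hQ'.mono hsubt).euclideanHausdorffMeasure_image_le m
      _ = _ := by
          rw [(isometry_sliceMap s).euclideanHausdorffMeasure_image,
            EuclideanSpace.euclideanHausdorffMeasure_eq_volume]
  · have hgm : Measurable fun t ↦ volume (sliceMap ((t - f x₀) / a) ⁻¹' A) :=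
      (measurable_volume_preimage_sliceMap hAm).comp ((measurable_id.sub_const _).div_const _)
    rw [lintegral_const_mul _ hgm,
      lintegral_comp_sub_div (measurable_volume_preimage_sliceMap hAm) ha0,
      lintegral_volume_preimage_sliceMap hAm]
    have h1 : volume A ≤ (r : ℝ≥0∞) ^ (m + 1) * riemannianVolume (m + 1) M B :=
      volume_image_le_riemannianVolume hQ hBs
    have h2 : ENNReal.ofReal a * riemannianVolume (m + 1) M B ≤
        r * ∫⁻ x in B, ENNReal.ofReal ‖mvfderiv (𝓡 (m + 1)) f x‖
          ∂(riemannianVolume (m + 1) M) := by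
      rw [← setLIntegral_const, ← lintegral_const_mul' _ _ ENNReal.coe_ne_top]
      refine setLIntegral_mono' hBm fun x hx ↦ ?_
      rw [← ENNReal.ofReal_coe_nnreal, ← ENNReal.ofReal_mul r.coe_nonneg]
      exact ENNReal.ofReal_le_ofReal (hB hx).2.le
    calc _ ≤ (r : ℝ≥0∞) ^ m * (ENNReal.ofReal a *
          ((r : ℝ≥0∞) ^ (m + 1) * riemannianVolume (m + 1) M B)) := by gcongr
      _ = (r : ℝ≥0∞) ^ (2 * m + 1) * (ENNReal.ofReal a * riemannianVolume (m + 1) M B) := by ring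
      _ ≤ (r : ℝ≥0∞) ^ (2 * m + 1) * (r * ∫⁻ x in B, ENNReal.ofReal ‖mvfderiv (𝓡 (m + 1)) f x‖
          ∂(riemannianVolume (m + 1) M)) := by gcongr
      _ = _ := by ring

/-- The coarea inequality, away from the critical points. -/
theorem lintegral_area_level_le [SecondCountableTopology M] {f : M → ℝ}
    (hf : ContMDiff (𝓡 (m + 1)) 𝓘(ℝ, ℝ) ∞ f) :
    ∫⁻ t, (μHE[m] : Measure M) {x | f x = t ∧ ‖mvfderiv (𝓡 (m + 1)) f x‖ ≠ 0} ≤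
      ∫⁻ x, ENNReal.ofReal ‖mvfderiv (𝓡 (m + 1)) f x‖ ∂(riemannianVolume (m + 1) M) := by
  set R := {x | ‖mvfderiv (𝓡 (m + 1)) f x‖ ≠ 0} with hR
  set I := ∫⁻ x, ENNReal.ofReal ‖mvfderiv (𝓡 (m + 1)) f x‖ ∂(riemannianVolume (m + 1) M) with hI
  have hRm : MeasurableSet R :=
    (isOpen_ne_fun (continuous_norm_mvfderiv hf) continuous_const).measurableSet
  rcases R.eq_empty_or_nonempty with hRe | hRn
  · have : ∀ t, {x | f x = t ∧ ‖mvfderiv (𝓡 (m + 1)) f x‖ ≠ 0} = ∅ := by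
      intro t
      refine subset_empty_iff.1 fun x hx ↦ ?_
      rw [← hRe]; exact hx.2
    simp [this]
  -- The local inequalities are summed for a fixed r, and r tends to 1 only at the end.
  have key : ∀ r : ℝ≥0, 1 < r →
      ∫⁻ t, (μHE[m] : Measure M) {x | f x = t ∧ ‖mvfderiv (𝓡 (m + 1)) f x‖ ≠ 0} ≤
        (r : ℝ≥0∞) ^ (2 * m + 2) * I := by
    intro r hr
    have h := fun x : R ↦ exists_nhds_coarea hf x.2 hr
    choose U hUo hxU hU using h
    obtain ⟨c, hcR, hcc, hcov⟩ := TopologicalSpace.countable_cover_nhdsWithin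
      (f := fun x ↦ ⋃ h : x ∈ R, U ⟨x, h⟩) (s := R) (fun x hx ↦ by
        refine mem_nhdsWithin_of_mem_nhds ?_
        simp only [hx, iUnion_true]
        exact (hUo _).mem_nhds (hxU ⟨x, hx⟩))
    have hcn : c.Nonempty := by
      obtain ⟨x, hx⟩ := hRn
      obtain ⟨y, hy, -⟩ := mem_iUnion₂.1 (hcov hx)
      exact ⟨y, hy⟩
    obtain ⟨q, hq⟩ := hcc.exists_eq_range hcn
    have hqR : ∀ k, q k ∈ R := fun k ↦ hcR (hq ▸ mem_range_self k)
    -- The pieces of the countable cover are made disjoint so that the integrals on the right add up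
    -- to one integral.
    set B : ℕ → Set M := fun k ↦ disjointed (fun k ↦ U ⟨q k, hqR k⟩) k ∩ R with hB
    have hBm : ∀ k, MeasurableSet (B k) := fun k ↦
      (MeasurableSet.disjointed (fun k ↦ (hUo _).measurableSet) k).inter hRm
    have hBU : ∀ k, B k ⊆ U ⟨q k, hqR k⟩ := fun k ↦
      inter_subset_left.trans (disjointed_subset _ _)
    have hBd : Pairwise (Function.onFun Disjoint B) := fun i j hij ↦
      ((disjoint_disjointed _ hij).mono inter_subset_left inter_subset_left)
    have hBR : R ⊆ ⋃ k, B k := by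
      intro x hx
      obtain ⟨y, hy, hxy⟩ := mem_iUnion₂.1 (hcov hx)
      rw [hq] at hy
      obtain ⟨k, rfl⟩ := hy
      simp only [hqR k, iUnion_true] at hxy
      have : x ∈ ⋃ k, disjointed (fun k ↦ U ⟨q k, hqR k⟩) k := by
        rw [iUnion_disjointed]; exact mem_iUnion.2 ⟨k, hxy⟩
      obtain ⟨j, hj⟩ := mem_iUnion.1 this
      exact mem_iUnion.2 ⟨j, hj, hx⟩
    choose g hgm hg1 hg2 using fun k ↦ hU _ (B k) (hBU k) (hBm k)
    calc _ ≤ ∫⁻ t, ∑' k, g k t := by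
          refine lintegral_mono fun t ↦ ?_
          calc _ ≤ (μHE[m] : Measure M) (⋃ k, {x | f x = t} ∩ B k) := by
                refine measure_mono fun x hx ↦ ?_
                obtain ⟨k, hk⟩ := mem_iUnion.1 (hBR hx.2)
                exact mem_iUnion.2 ⟨k, hx.1, hk⟩
            _ ≤ ∑' k, (μHE[m] : Measure M) ({x | f x = t} ∩ B k) := measure_iUnion_le _
            _ ≤ ∑' k, g k t := ENNReal.tsum_le_tsum fun k ↦ hg1 k t
      _ = ∑' k, ∫⁻ t, g k t := lintegral_tsum fun k ↦ (hgm k).aemeasurable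
      _ ≤ ∑' k, (r : ℝ≥0∞) ^ (2 * m + 2) * ∫⁻ x in B k,
            ENNReal.ofReal ‖mvfderiv (𝓡 (m + 1)) f x‖ ∂(riemannianVolume (m + 1) M) :=
          ENNReal.tsum_le_tsum hg2
      _ = (r : ℝ≥0∞) ^ (2 * m + 2) * ∫⁻ x in ⋃ k, B k,
            ENNReal.ofReal ‖mvfderiv (𝓡 (m + 1)) f x‖ ∂(riemannianVolume (m + 1) M) := by
          rw [ENNReal.tsum_mul_left, lintegral_iUnion hBm hBd]
      _ ≤ _ := by gcongr; exact setLIntegral_le_lintegral _ _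
  rcases eq_or_ne I ⊤ with hItop | hItop
  · rw [hItop]; exact le_top
  have hcont : Tendsto (fun r : ℝ≥0 ↦ (r : ℝ≥0∞) ^ (2 * m + 2) * I) (𝓝[>] 1)
      (𝓝 (((1 : ℝ≥0) : ℝ≥0∞) ^ (2 * m + 2) * I)) := by
    refine ENNReal.Tendsto.mul_const ?_ (Or.inr hItop)
    exact ((ENNReal.continuous_pow _).comp ENNReal.continuous_coe).continuousAt.mono_left
      nhdsWithin_le_nhds
  have := ge_of_tendsto hcont (Filter.mem_of_superset self_mem_nhdsWithin fun r hr ↦ key r hr)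
  simpa using this

end Coarea

/-! ### Generic functions on Euclidean space have isolated critical points. -/

section Morse

variable {V P : Type*} [NormedAddCommGroup V] [NormedSpace ℝ V] [FiniteDimensional ℝ V]
  [NormedAddCommGroup P] [NormedSpace ℝ P] [FiniteDimensional ℝ P]

theorem IsCompact.finite_of_eventually_ne {X : Type*} [TopologicalSpace X] {s : Set X}
    (hs : IsCompact s) (h : ∀ x ∈ s, ∀ᶠ z in 𝓝[≠] x, z ∉ s) : s.Finite := by
  refine hs.finite (isDiscrete_iff_nhdsNE.2 fun x hx ↦ ?_)
  exact inf_principal_eq_bot.2 (h x hx)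

theorem Continuous.clm_flip_apply {X E F G : Type*} [TopologicalSpace X] [NormedAddCommGroup E]
    [NormedSpace ℝ E] [NormedAddCommGroup F] [NormedSpace ℝ F] [NormedAddCommGroup G]
    [NormedSpace ℝ G] {T : X → E →L[ℝ] F →L[ℝ] G} {a : X → F} (hT : Continuous T)
    (ha : Continuous a) : Continuous fun x ↦ (T x).flip (a x) :=
  ((ContinuousLinearMap.flipₗᵢ ℝ E F G).continuous.comp hT).clm_apply ha

set_option synthInstance.maxHeartbeats 400000 in
set_option maxHeartbeats 800000 in
/-- Adding a generic linear combination of the coordinates makes the critical points of a smooth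
function isolated. -/
theorem ae_finite_setOf_fderiv_eq_zero {O K : Set V} (hO : IsOpen O) (hK : IsCompact K)
    (hKO : K ⊆ O) {h : V → ℝ} {X : V → P} (hh : ContDiffOn ℝ ∞ h O) (hX : ContDiffOn ℝ ∞ X O)
    (L : (V →L[ℝ] ℝ) →ₗ[ℝ] (P →L[ℝ] ℝ)) (hL : ∀ b, ∀ y ∈ O, L b (X y) = b y) :
    ∀ᵐ a ∂(Measure.addHaar : Measure (P →L[ℝ] ℝ)),
      {y ∈ K | fderiv ℝ (fun y ↦ h y + a (X y)) y = 0}.Finite := by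
  let mV : MeasurableSpace V := borel V
  have bV : BorelSpace V := ⟨rfl⟩
  -- Identifying the dual of V with V makes the gradient a map from V to V, whose derivative has a
  -- determinant.
  obtain ⟨J⟩ : Nonempty ((V →L[ℝ] ℝ) ≃L[ℝ] V) := by
    refine FiniteDimensional.nonempty_continuousLinearEquiv_of_finrank_eq ?_
    rw [← (LinearMap.toContinuousLinearMap (𝕜 := ℝ) (E := V) (F' := ℝ)).finrank_eq]
    exact Subspace.dual_finrank_eq
  have hhd : ContDiffOn ℝ ∞ (fderiv ℝ h) O := hh.fderiv_of_isOpen hO (by simp)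
  have hXd : ContDiffOn ℝ ∞ (fderiv ℝ X) O := hX.fderiv_of_isOpen hO (by simp)
  set g₀ : V → V := fun y ↦ J (fderiv ℝ h y) with hg₀
  set A : V → (P →L[ℝ] ℝ) →L[ℝ] V := fun y ↦ (J : (V →L[ℝ] ℝ) →L[ℝ] V).comp
    ((ContinuousLinearMap.compL ℝ V P ℝ).flip (fderiv ℝ X y)) with hA
  have hg₀s : ContDiffOn ℝ ∞ g₀ O := J.contDiff.comp_contDiffOn hhd
  have hAs : ContDiffOn ℝ ∞ A O := by
    refine contDiffOn_const.clm_comp ?_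
    exact (ContinuousLinearMap.contDiff _).comp_contDiffOn hXd
  set g : (P →L[ℝ] ℝ) → V → V := fun a y ↦ g₀ y + A y a with hg
  set Dg : (P →L[ℝ] ℝ) → V → V →L[ℝ] V := fun a y ↦ fderiv ℝ g₀ y + (fderiv ℝ A y).flip a
    with hDg
  have hgd : ∀ a, ∀ y ∈ O, HasFDerivAt (g a) (Dg a y) y := by
    intro a y hy
    have h1 := ((hg₀s.contDiffAt (hO.mem_nhds hy)).differentiableAt (by simp)).hasFDerivAt
    have h2 := ((hAs.contDiffAt (hO.mem_nhds hy)).differentiableAt (by simp)).hasFDerivAt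
    have h3 := h1.add (h2.clm_apply (hasFDerivAt_const a y))
    rwa [ContinuousLinearMap.comp_zero, zero_add] at h3
  have hcrit : ∀ a, ∀ y ∈ O, fderiv ℝ (fun y ↦ h y + a (X y)) y = 0 ↔ g a y = 0 := by
    intro a y hy
    have h1 := ((hh.contDiffAt (hO.mem_nhds hy)).differentiableAt (by simp)).hasFDerivAt
    have h2 := ((hX.contDiffAt (hO.mem_nhds hy)).differentiableAt (by simp)).hasFDerivAt
    have h3 := (h1.add (a.hasFDerivAt.comp y h2)).fderiv
    have h4 : fderiv ℝ (fun y ↦ h y + a (X y)) y = fderiv ℝ h y + a.comp (fderiv ℝ X y) := h3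
    have h5 : g a y = J (fderiv ℝ h y + a.comp (fderiv ℝ X y)) := by
      simp [hg, hg₀, hA]
    rw [h4, h5, map_eq_zero_iff J J.injective]
  -- Moving the parameter a by `L b` adds the linear function b, so the gradient map is translated
  -- by the constant `J b` and its derivative stays the same (`hDL`).
  have hAL : ∀ b, ∀ y ∈ O, A y (L b) = J b := by
    intro b y hy
    have h2 := ((hX.contDiffAt (hO.mem_nhds hy)).differentiableAt (by simp)).hasFDerivAt
    have h3 := (L b).hasFDerivAt.comp y h2
    have h4 : HasFDerivAt ((L b) ∘ X) b y := by
      refine b.hasFDerivAt.congr_of_eventuallyEq ?_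
      filter_upwards [hO.mem_nhds hy] with z hz using hL b z hz
    have h5 := h3.unique h4
    simp [hA, h5]
  have hDL : ∀ a b, ∀ y ∈ O, Dg (a + L b) y = Dg a y := by
    intro a b y hy
    have h1 : HasFDerivAt (g (a + L b)) (Dg a y) y := by
      refine ((hgd a y hy).add_const (J b)).congr_of_eventuallyEq ?_
      filter_upwards [hO.mem_nhds hy] with z hz
      simp only [hg, map_add, hAL b z hz, add_assoc]
    exact (hgd _ y hy).unique h1
  -- the set of parameters with a degenerate critical point
  set bad : Set (P →L[ℝ] ℝ) := {a | ∃ y ∈ K, g a y = 0 ∧ (Dg a y).det = 0} with hbad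
  -- The set is the projection of a closed set along the compact K. Closedness serves to make `bad`
  -- measurable.
  have hbadc : IsClosed bad := by
    have : CompactSpace K := isCompact_iff_compactSpace.1 hK
    have hcK : Continuous fun p : (P →L[ℝ] ℝ) × K ↦ (p.2 : V) :=
      continuous_subtype_val.comp continuous_snd
    have hmK : ∀ p : (P →L[ℝ] ℝ) × K, (p.2 : V) ∈ O := fun p ↦ hKO p.2.2
    have c1 : Continuous fun p : (P →L[ℝ] ℝ) × K ↦ g p.1 p.2 :=
      (hg₀s.continuousOn.comp_continuous hcK hmK).add
        ((hAs.continuousOn.comp_continuous hcK hmK).clm_apply continuous_fst)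
    have c2 : Continuous fun p : (P →L[ℝ] ℝ) × K ↦ Dg p.1 p.2 := by
      refine ((hg₀s.fderiv_of_isOpen hO (m := ∞) (by simp)).continuousOn.comp_continuous
        hcK hmK).add ?_
      have := (hAs.fderiv_of_isOpen hO (m := ∞) (by simp)).continuousOn.comp_continuous hcK hmK
      exact this.clm_flip_apply continuous_fst
    have hcl : IsClosed {p : (P →L[ℝ] ℝ) × K | g p.1 p.2 = 0 ∧ (Dg p.1 p.2).det = 0} :=
      (isClosed_eq c1 continuous_const).inter
        (isClosed_eq (ContinuousLinearMap.continuous_det.comp c2) continuous_const)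
    convert isClosedMap_fst_of_compactSpace _ hcl using 1
    ext a
    simp only [hbad, mem_ofPred_eq, mem_image, Prod.exists, Subtype.exists, exists_and_right,
      exists_eq_right]
    exact exists_congr fun y ↦ by tauto
  -- Fubini along the range of L: for fixed a, the translations v that make the parameter bad are
  -- negatives of critical values of `g a`, and these form a null set by Sard's theorem between
  -- spaces of equal dimension.
  have hae : ∀ᵐ a ∂(Measure.addHaar : Measure (P →L[ℝ] ℝ)), a ∈ badᶜ := by
    refine ae_mem_of_ae_add_linearMap_mem (L ∘ₗ J.symm.toLinearMap)
      (Measure.addHaar : Measure V) _ hbadc.measurableSet.compl fun a ↦ ?_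
    have hnull : (Measure.addHaar : Measure V) (g a '' {y ∈ K | (Dg a y).det = 0}) = 0 :=
      addHaar_image_eq_zero_of_det_fderivWithin_eq_zero _
        (fun y hy ↦ (hgd a y (hKO hy.1)).hasFDerivWithinAt) fun y hy ↦ hy.2
    have hnull' := (Measure.measurePreserving_neg
      (Measure.addHaar : Measure V)).quasiMeasurePreserving.preimage_null hnull
    refine measure_mono_null (fun v hv ↦ ?_) hnull'
    simp only [mem_compl_iff, not_not, mem_ofPred_eq] at hv
    obtain ⟨y, hy, h1, h2⟩ := hv
    have hLv : (L ∘ₗ J.symm.toLinearMap) v = L (J.symm v) := rfl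
    rw [hLv] at h1 h2
    rw [hDL _ _ y (hKO hy)] at h2
    refine ⟨y, ⟨hy, h2⟩, ?_⟩
    have h3 : g (a + L (J.symm v)) y = g a y + v := by
      simp only [hg, map_add, hAL _ y (hKO hy), J.apply_symm_apply, add_assoc]
    rw [h3] at h1
    exact eq_neg_of_add_eq_zero_left h1
  filter_upwards [hae] with a ha
  have heq : {y ∈ K | fderiv ℝ (fun y ↦ h y + a (X y)) y = 0} = K ∩ (g a) ⁻¹' {0} := by
    ext y
    exact and_congr_right fun hy ↦ hcrit a y (hKO hy)
  rw [heq]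
  have hgc : ContinuousOn (g a) K := fun y hy ↦ (hgd a y (hKO hy)).continuousAt.continuousWithinAt
  -- For a parameter that is not bad the derivative is invertible at each zero of `g a`, so the
  -- zeros are isolated in a compact set.
  refine IsCompact.finite_of_eventually_ne ?_ fun y hy ↦ ?_
  · exact hK.of_isClosed_subset (hgc.preimage_isClosed_of_isClosed hK.isClosed isClosed_singleton)
      inter_subset_left
  · have hdet : (Dg a y).det ≠ 0 := fun h0 ↦ ha ⟨y, hy.1, hy.2, h0⟩
    have := (hgd a y (hKO hy.1)).eventually_ne (c := 0)
      ⟨_, ((Dg a y).toContinuousLinearEquivOfDetNeZero hdet).antilipschitz⟩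
    filter_upwards [this] with z hz hz'
    exact hz hz'.2

end Morse

/-! ### Perturbation to finitely many critical points on a compact manifold. -/

section Perturbation

variable {n : ℕ} {M : Type*} [TopologicalSpace M]
  [ChartedSpace (EuclideanSpace ℝ (Fin n)) M]
  {F F' : Type*} [NormedAddCommGroup F] [NormedSpace ℝ F]
  [NormedAddCommGroup F'] [NormedSpace ℝ F']

theorem mvfderiv_comp_left {g : F → F'} {f : M → F} {x : M}
    (hg : DifferentiableAt ℝ g (f x)) (hf : MDifferentiableAt (𝓡 n) 𝓘(ℝ, F) f x) :
    mvfderiv (𝓡 n) (fun y ↦ g (f y)) x = (fderiv ℝ g (f x)).comp (mvfderiv (𝓡 n) f x) := by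
  have h := mfderiv_comp x hg.mdifferentiableAt hf
  rw [mfderiv_eq_fderiv] at h
  exact h

variable [IsManifold (𝓡 n) ∞ M]

theorem contDiffOn_comp_extChartAt_symm {θ : M → F} (hθ : ContMDiff (𝓡 n) 𝓘(ℝ, F) ∞ θ)
    (c : M) :
    ContDiffOn ℝ ∞ (θ ∘ (extChartAt (𝓡 n) c).symm) (extChartAt (𝓡 n) c).target := by
  rw [← contMDiffOn_iff_contDiffOn]
  exact hθ.comp_contMDiffOn (contMDiffOn_extChartAt_symm c)

variable
  [RiemannianBundle (fun x : M ↦ TangentSpace (𝓡 n) x)]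
  [IsContinuousRiemannianBundle (EuclideanSpace ℝ (Fin n)) (fun x : M ↦ TangentSpace (𝓡 n) x)]
  [CompactSpace M] [T2Space M]

/-- On a compact manifold, smooth functions with finitely many critical points are dense. -/
theorem exists_perturbation_finite_critical {f : M → ℝ} (hf : ContMDiff (𝓡 n) 𝓘(ℝ, ℝ) ∞ f)
    {η : ℝ} (hη : 0 < η) :
    ∃ g : M → ℝ, ContMDiff (𝓡 n) 𝓘(ℝ, ℝ) ∞ g ∧ (∀ x, |g x - f x| ≤ η) ∧
      (∀ x, ‖mvfderiv (𝓡 n) g x‖ ≤ ‖mvfderiv (𝓡 n) f x‖ + η) ∧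
      {x | mvfderiv (𝓡 n) g x = 0}.Finite := by
  set φ : M → PartialEquiv M (EuclideanSpace ℝ (Fin n)) := fun c ↦ extChartAt (𝓡 n) c with hφ
  let β : ∀ c : M, SmoothBumpFunction (𝓡 n) c := fun c ↦ Classical.arbitrary _
  have hO : ∀ c : M, ∃ O : Set M, IsOpen O ∧ c ∈ O ∧ O ⊆ (φ c).source ∧ ∀ x ∈ O, β c x = 1 := by
    intro c
    obtain ⟨O, hO1, hO2, hO3⟩ := mem_nhds_iff.1
      (inter_mem (extChartAt_source_mem_nhds (I := 𝓡 n) c) (β c).eventuallyEq_one)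
    exact ⟨O, hO2, hO3, fun x hx ↦ (hO1 hx).1, fun x hx ↦ (hO1 hx).2⟩
  choose O hOo hcO hOs hOβ using hO
  have hK : ∀ c : M, ∃ K ∈ 𝓝 c, K ⊆ O c ∧ IsCompact K := fun c ↦
    local_compact_nhds ((hOo c).mem_nhds (hcO c))
  choose K hKn hKO hKc using hK
  obtain ⟨t, ht⟩ := finite_cover_nhds hKn
  -- On `O c` the bump function is 1, so the component c of X is there the chart itself. This
  -- supplies the coordinates that `ae_finite_setOf_fderiv_eq_zero` requires.
  set X : M → (t → EuclideanSpace ℝ (Fin n)) := fun x c ↦ β c x • φ c x with hX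
  have hXs : ContMDiff (𝓡 n) 𝓘(ℝ, (t → EuclideanSpace ℝ (Fin n))) ∞ X := by
    refine contMDiff_pi_space.2 fun c ↦ (β (c : M)).contMDiff_smul ?_
    have := contMDiffOn_extChartAt (I := 𝓡 n) (n := ∞) (x := (c : M))
    exact this
  have hfin : ∀ c : t, ∀ᵐ a ∂(Measure.addHaar : Measure ((t → EuclideanSpace ℝ (Fin n)) →L[ℝ] ℝ)),
      {x ∈ K c | mvfderiv (𝓡 n) (fun x ↦ f x + a (X x)) x = 0}.Finite := by
    intro c
    set Oc : Set (EuclideanSpace ℝ (Fin n)) := (φ c).target ∩ (φ c).symm ⁻¹' O c with hOc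
    have hOc_open : IsOpen Oc := (continuousOn_extChartAt_symm (c : M)).isOpen_inter_preimage
      (isOpen_extChartAt_target _) (hOo c)
    have hsub : K c ⊆ (φ c).source := (hKO c).trans (hOs c)
    have hKI : φ c '' K c ⊆ Oc := by
      rintro _ ⟨x, hx, rfl⟩
      refine ⟨(φ c).map_source (hsub hx), ?_⟩
      simp only [mem_preimage, (φ (c : M)).left_inv (hsub hx)]
      exact hKO c hx
    have key := ae_finite_setOf_fderiv_eq_zero hOc_open
      ((hKc c).image_of_continuousOn ((continuousOn_extChartAt (c : M)).mono hsub)) hKI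
      ((contDiffOn_comp_extChartAt_symm hf c).mono inter_subset_left)
      ((contDiffOn_comp_extChartAt_symm hXs c).mono inter_subset_left)
      ((ContinuousLinearMap.compL ℝ (t → EuclideanSpace ℝ (Fin n)) (EuclideanSpace ℝ (Fin n)) ℝ).flip
        (ContinuousLinearMap.proj (R := ℝ) (φ := fun _ : t ↦ EuclideanSpace ℝ (Fin n)) c)).toLinearMap (by
          intro b y hy
          have : X ((φ c).symm y) c = y := by
            simp only [hX, hOβ c _ hy.2, one_smul, (φ (c : M)).right_inv hy.1]
          exact congrArg b this)
    filter_upwards [key] with a ha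
    refine Finite.of_finite_image (f := φ c) (ha.subset ?_) ((φ (c : M)).injOn.mono fun x hx ↦
      hsub hx.1)
    rintro _ ⟨x, ⟨hx, hx'⟩, rfl⟩
    refine ⟨mem_image_of_mem _ hx, ?_⟩
    have hd : MDifferentiableAt (𝓡 n) 𝓘(ℝ, ℝ) (fun x ↦ f x + a (X x)) x :=
      ((hf.add (a.contMDiff.comp hXs)) x).mdifferentiableAt (by simp)
    have h2 := fderiv_comp_extChartAt_symm (hsub hx) hd
    rw [hx', ContinuousLinearMap.zero_comp] at h2
    exact h2
  obtain ⟨B₁, hB₁⟩ := isCompact_univ.exists_bound_of_continuousOn hXs.continuous.continuousOn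
  obtain ⟨B₂, hB₂⟩ := isCompact_univ.exists_bound_of_continuousOn
    (continuous_norm_mvfderiv hXs).continuousOn
  set B := max (max B₁ B₂) 1 with hB
  have hBpos : 0 < B := lt_of_lt_of_le one_pos (le_max_right _ _)
  -- Almost every parameter works in all charts of the finite cover at once. A set of full measure
  -- is dense, so some such a is small enough for the perturbation to be small in C¹.
  obtain ⟨a, ha, haη⟩ := (Measure.dense_of_ae (eventually_countable_forall.2 hfin)).exists_mem_open
    (Metric.isOpen_ball (x := (0 : (t → EuclideanSpace ℝ (Fin n)) →L[ℝ] ℝ)) (ε := η / B)) ⟨0, by simp; positivity⟩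
  have haη' : ‖a‖ * B ≤ η := by
    rw [mem_ball_zero_iff, lt_div_iff₀ hBpos] at haη
    exact haη.le
  refine ⟨fun x ↦ f x + a (X x), hf.add (a.contMDiff.comp hXs), fun x ↦ ?_, fun x ↦ ?_, ?_⟩
  · rw [add_sub_cancel_left]
    refine (a.le_opNorm (X x)).trans (le_trans ?_ haη')
    gcongr
    exact (hB₁ x (mem_univ x)).trans ((le_max_left _ _).trans (le_max_left _ _))
  · have hXd : MDifferentiableAt (𝓡 n) 𝓘(ℝ, (t → EuclideanSpace ℝ (Fin n))) X x := (hXs x).mdifferentiableAt (by simp)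
    have h1 : mvfderiv (𝓡 n) (fun x ↦ f x + a (X x)) x =
        mvfderiv (𝓡 n) f x + a.comp (mvfderiv (𝓡 n) X x) := by
      have := mvfderiv_add (I := 𝓡 n) (g := f) (g' := fun x ↦ a (X x)) (x := x)
        ((hf x).mdifferentiableAt (by simp))
        (((a.contMDiff.comp hXs) x).mdifferentiableAt (by simp))
      refine Eq.trans this ?_
      rw [mvfderiv_comp_left a.differentiableAt hXd, a.fderiv]
    rw [h1]
    refine (ContinuousLinearMap.opNorm_add_le _ _).trans (add_le_add le_rfl ?_)
    refine (ContinuousLinearMap.opNorm_comp_le _ _).trans (le_trans ?_ haη')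
    gcongr
    have := hB₂ x (mem_univ x)
    rw [Real.norm_eq_abs] at this
    exact (le_abs_self _).trans (this.trans ((le_max_right _ _).trans (le_max_left _ _)))
  · have ha' : ∀ c : t, {x ∈ K c | mvfderiv (𝓡 n) (fun x ↦ f x + a (X x)) x = 0}.Finite := ha
    refine (finite_iUnion ha').subset fun x hx ↦ ?_
    have : x ∈ ⋃ c ∈ t, K c := by rw [ht]; exact mem_univ x
    simp only [mem_iUnion] at this ⊢
    obtain ⟨c, hc, hxc⟩ := this
    exact ⟨⟨c, hc⟩, hxc, hx⟩

end Perturbation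

/-! ### The functional `crossVolume` and its stability in L¹. -/

section CrossVolume

variable {X : Type*} [MeasurableSpace X] {μ : Measure X}

/-- The integral over `t` of the smaller one of the measures of `{t < f}` and `{f < t}`. -/
noncomputable def crossVolume (μ : Measure X) (f : X → ℝ) : ℝ≥0∞ :=
  ∫⁻ t, min (μ {x | t < f x}) (μ {x | f x < t})

theorem crossVolume_congr_ae {f g : X → ℝ} (h : f =ᵐ[μ] g) : crossVolume μ f = crossVolume μ g := by
  refine lintegral_congr fun t ↦ ?_
  congr 1 <;> refine measure_congr ?_ <;> filter_upwards [h] with x hx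
  · exact congrArg (fun s ↦ t < s) hx
  · exact congrArg (fun s ↦ s < t) hx

theorem lintegral_measure_crossing [SFinite μ] {f g : X → ℝ} (hf : Measurable f)
    (hg : Measurable g) :
    Measurable (fun t ↦ μ {x | g x ≤ t ∧ t < f x}) ∧
      ∫⁻ t, μ {x | g x ≤ t ∧ t < f x} = ∫⁻ x, ENNReal.ofReal (f x - g x) ∂μ := by
  have hs : MeasurableSet {p : ℝ × X | g p.2 ≤ p.1 ∧ p.1 < f p.2} :=
    (measurableSet_le (hg.comp measurable_snd) measurable_fst).inter
      (measurableSet_lt measurable_fst (hf.comp measurable_snd))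
  refine ⟨measurable_measure_prodMk_left hs, ?_⟩
  have h1 := Measure.prod_apply (μ := (volume : Measure ℝ)) (ν := μ) hs
  rw [Measure.prod_apply_symm hs] at h1
  refine Eq.trans h1.symm (lintegral_congr fun x ↦ ?_)
  have : (fun t ↦ (t, x)) ⁻¹' {p : ℝ × X | g p.2 ≤ p.1 ∧ p.1 < f p.2} = Ico (g x) (f x) := rfl
  rw [this, Real.volume_Ico]

theorem lintegral_measure_crossing' [SFinite μ] {f g : X → ℝ} (hf : Measurable f)
    (hg : Measurable g) :
    Measurable (fun t ↦ μ {x | f x < t ∧ t ≤ g x}) ∧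
      ∫⁻ t, μ {x | f x < t ∧ t ≤ g x} = ∫⁻ x, ENNReal.ofReal (g x - f x) ∂μ := by
  have hs : MeasurableSet {p : ℝ × X | f p.2 < p.1 ∧ p.1 ≤ g p.2} :=
    (measurableSet_lt (hf.comp measurable_snd) measurable_fst).inter
      (measurableSet_le measurable_fst (hg.comp measurable_snd))
  refine ⟨measurable_measure_prodMk_left hs, ?_⟩
  have h1 := Measure.prod_apply (μ := (volume : Measure ℝ)) (ν := μ) hs
  rw [Measure.prod_apply_symm hs] at h1
  refine Eq.trans h1.symm (lintegral_congr fun x ↦ ?_)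
  have : (fun t ↦ (t, x)) ⁻¹' {p : ℝ × X | f p.2 < p.1 ∧ p.1 ≤ g p.2} = Ioc (f x) (g x) := rfl
  rw [this, Real.volume_Ioc]

theorem ofReal_sub_add_ofReal_sub (a b : ℝ) :
    ENNReal.ofReal (a - b) + ENNReal.ofReal (b - a) = ENNReal.ofReal |a - b| := by
  rcases le_total a b with h | h
  · rw [ENNReal.ofReal_of_nonpos (by linarith), zero_add, abs_of_nonpos (by linarith), neg_sub]
  · rw [ENNReal.ofReal_of_nonpos (by linarith : b - a ≤ 0), add_zero, abs_of_nonneg (by linarith)]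

/-- Passing from g to f changes the superlevel and sublevel sets at t only at points where t lies
between f and g. Integrating the measure of these points over t gives the L¹ distance. This is how
Cheeger's inequality survives approximation. -/
theorem crossVolume_le_add [SFinite μ] {f g : X → ℝ} (hf : AEMeasurable f μ)
    (hg : AEMeasurable g μ) :
    crossVolume μ f ≤ crossVolume μ g + ∫⁻ x, ENNReal.ofReal |f x - g x| ∂μ := by
  wlog hm : Measurable f ∧ Measurable g generalizing f g
  · have := this hf.measurable_mk.aemeasurable hg.measurable_mk.aemeasurable
      ⟨hf.measurable_mk, hg.measurable_mk⟩
    rw [← crossVolume_congr_ae hf.ae_eq_mk, ← crossVolume_congr_ae hg.ae_eq_mk] at this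
    refine this.trans_eq (congrArg _ (lintegral_congr_ae ?_))
    filter_upwards [hf.ae_eq_mk, hg.ae_eq_mk] with x h1 h2
    rw [h1, h2]
  obtain ⟨hf, hg⟩ := hm
  obtain ⟨m1, e1⟩ := lintegral_measure_crossing (μ := μ) hf hg
  obtain ⟨m2, e2⟩ := lintegral_measure_crossing' (μ := μ) hf hg
  have : ∫⁻ x, ENNReal.ofReal |f x - g x| ∂μ =
      ∫⁻ t, (μ {x | g x ≤ t ∧ t < f x} + μ {x | f x < t ∧ t ≤ g x}) := by
    rw [lintegral_add_left m1, e1, e2, ← lintegral_add_left (by fun_prop)]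
    exact lintegral_congr fun x ↦ (ofReal_sub_add_ofReal_sub _ _).symm
  have m3 : Measurable fun t ↦ μ {x | g x ≤ t ∧ t < f x} + μ {x | f x < t ∧ t ≤ g x} := m1.add m2
  rw [this, crossVolume, crossVolume, ← lintegral_add_right _ m3]
  refine lintegral_mono fun t ↦ ?_
  have h1 : μ {x | t < f x} ≤ μ {x | t < g x} + μ {x | g x ≤ t ∧ t < f x} := by
    refine (measure_mono fun x hx ↦ ?_).trans (measure_union_le _ _)
    rcases lt_or_ge t (g x) with h | h
    · exact Or.inl h
    · exact Or.inr ⟨h, hx⟩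
  have h2 : μ {x | f x < t} ≤ μ {x | g x < t} + μ {x | f x < t ∧ t ≤ g x} := by
    refine (measure_mono fun x hx ↦ ?_).trans (measure_union_le _ _)
    rcases lt_or_ge (g x) t with h | h
    · exact Or.inl h
    · exact Or.inr ⟨hx, h⟩
  rw [min_add]
  exact min_le_min (h1.trans (by gcongr; exact le_self_add)) (h2.trans (by gcongr; exact le_add_self))

end CrossVolume

/-! ### Cheeger's inequality for smooth functions. -/

section Cheeger

variable {n : ℕ} {M : Type*} [EMetricSpace M] [MeasurableSpace M] [BorelSpace M]
  [ChartedSpace (EuclideanSpace ℝ (Fin n)) M]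

/-- The function g is itself a defining function of the open set, and the frontier lies in its zero
level. -/
theorem cheegerConstant_mul_volume_le {g : M → ℝ} (hg : ContMDiff (𝓡 n) 𝓘(ℝ, ℝ) ∞ g)
    (hr : ∀ x, g x = 0 → mvfderiv (𝓡 n) g x ≠ 0)
    (hV : riemannianVolume n M {x | g x < 0} ≤ riemannianVolume n M univ / 2) :
    cheegerConstant n M * riemannianVolume n M {x | g x < 0} ≤
      riemannianArea n {x | g x = 0} := by
  rcases {x | g x < 0}.eq_empty_or_nonempty with he | hne
  · simp [he]
  refine ENNReal.mul_le_of_le_div ?_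
  have hfr : frontier {x | g x < 0} ⊆ {x | g x = 0} :=
    frontier_lt_subset_eq hg.continuous continuous_const
  refine (iInf₂_le {x | g x < 0} ⟨hne, ⟨isOpen_lt hg.continuous continuous_const,
    fun x hx ↦ ⟨univ, isOpen_univ, mem_univ x, g, hg.contMDiffOn, hr x (hfr hx), ?_⟩⟩, hV⟩).trans ?_
  · exact ENNReal.div_le_div_right (measure_mono hfr) _
  · ext; simp

variable [IsManifold (𝓡 n) ∞ M] [RiemannianBundle (fun x : M ↦ TangentSpace (𝓡 n) x)]
  [IsContinuousRiemannianBundle (EuclideanSpace ℝ (Fin n)) (fun x : M ↦ TangentSpace (𝓡 n) x)]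
  [IsRiemannianManifold (𝓡 n) M] [CompactSpace M]

theorem lintegral_riemannianArea_level_le {f : M → ℝ} (hf : ContMDiff (𝓡 n) 𝓘(ℝ, ℝ) ∞ f) :
    ∫⁻ t, riemannianArea n {x | f x = t ∧ ‖mvfderiv (𝓡 n) f x‖ ≠ 0} ≤
      ∫⁻ x, ENNReal.ofReal ‖mvfderiv (𝓡 n) f x‖ ∂(riemannianVolume n M) := by
  have : SecondCountableTopology M := EMetric.secondCountable_of_sigmaCompact M
  rcases n with _ | m
  -- In dimension 0 the truncated `n - 1` is 0, but tangent spaces are trivial and every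
  -- differential vanishes.
  · have : ∀ t, {x | f x = t ∧ ‖mvfderiv (𝓡 0) f x‖ ≠ 0} = ∅ := by
      refine fun t ↦ subset_empty_iff.1 fun x hx ↦ hx.2 ?_
      have : mvfderiv (𝓡 0) f x = 0 := by
        ext v
        have hv : v = 0 := Subsingleton.elim (α := EuclideanSpace ℝ (Fin 0)) v 0
        rw [hv, map_zero, map_zero]
      rw [this]
      exact ContinuousLinearMap.opNorm_zero
    simp [this, riemannianArea]
  · exact lintegral_area_level_le (m := m) hf

/-- All but finitely many t are regular values, so no Sard theorem on M is needed. For these the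
smaller of {f > t} and {f < t} has at most half of the volume and is admissible in the definition of
the Cheeger constant; integrate over t and apply the coarea inequality. The finite c stands in for a
constant that may be infinite. -/
theorem mul_crossVolume_le_of_finite {f : M → ℝ} (hf : ContMDiff (𝓡 n) 𝓘(ℝ, ℝ) ∞ f)
    (hfin : {x | mvfderiv (𝓡 n) f x = 0}.Finite) {c : ℝ≥0} (hc : c ≤ cheegerConstant n M) :
    c * crossVolume (riemannianVolume n M) f ≤
      ∫⁻ x, ENNReal.ofReal ‖mvfderiv (𝓡 n) f x‖ ∂(riemannianVolume n M) := by
  set V := riemannianVolume n M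
  refine le_trans ?_ (lintegral_riemannianArea_level_le hf)
  rw [crossVolume, ← lintegral_const_mul' _ _ ENNReal.coe_ne_top]
  have hnull : ∀ᵐ t : ℝ, t ∉ f '' {x | mvfderiv (𝓡 n) f x = 0} :=
    measure_eq_zero_iff_ae_notMem.1 ((hfin.image f).measure_zero _)
  refine lintegral_mono_ae ?_
  filter_upwards [hnull] with t ht
  have hreg : ∀ x, f x = t → mvfderiv (𝓡 n) f x ≠ 0 := fun x hx h0 ↦ ht ⟨x, h0, hx⟩
  have hd : ∀ x, MDifferentiableAt (𝓡 n) 𝓘(ℝ, ℝ) f x := fun x ↦ (hf x).mdifferentiableAt (by simp)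
  have hlev : ∀ g : M → ℝ, (∀ x, g x = 0 → f x = t) →
      riemannianArea n {x | g x = 0} ≤
        riemannianArea n {x | f x = t ∧ ‖mvfderiv (𝓡 n) f x‖ ≠ 0} := by
    refine fun g hg ↦ measure_mono fun x hx ↦ ⟨hg x hx, fun h0 ↦ hreg x (hg x hx) ?_⟩
    exact (ContinuousLinearMap.opNorm_zero_iff _).1 h0
  have hsum : V {x | t < f x} + V {x | f x < t} ≤ V univ := by
    rw [← measure_union]
    · exact measure_mono (subset_univ _)
    · exact disjoint_left.2 fun x (h1 : t < f x) (h2 : f x < t) ↦ lt_asymm h1 h2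
    · exact (isOpen_lt hf.continuous continuous_const).measurableSet
  rcases le_total (V {x | t < f x}) (V {x | f x < t}) with h | h
  · have hset : {x | t < f x} = {x | t - f x < 0} := by ext; simp
    rw [min_eq_left h]
    have hle : V {x | t - f x < 0} ≤ V univ / 2 := by
      rw [← hset, ENNReal.le_div_iff_mul_le (by simp) (by simp), mul_two]
      exact (add_le_add le_rfl h).trans hsum
    have hgs : ContMDiff (𝓡 n) 𝓘(ℝ, ℝ) ∞ fun x ↦ t - f x := contMDiff_const.sub hf
    have := cheegerConstant_mul_volume_le hgs (fun x hx ↦ ?_) hle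
    · rw [hset]
      exact ((mul_le_mul_left hc _).trans this).trans (hlev _ fun x hx ↦ (sub_eq_zero.1 hx).symm)
    · intro h0
      refine hreg x (sub_eq_zero.1 hx).symm ?_
      have h1 := mvfderiv_sub (I := 𝓡 n) (g := fun _ ↦ t) (g' := f) (x := x)
        mdifferentiableAt_const (hd x)
      have h2 : mvfderiv (𝓡 n) (fun x ↦ t - f x) x = 0 - mvfderiv (𝓡 n) f x := by
        refine Eq.trans h1 ?_
        rw [mvfderiv_const]
      rw [h2, zero_sub] at h0
      exact neg_eq_zero.1 h0
  · have hset : {x | f x < t} = {x | f x - t < 0} := by ext; simp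
    rw [min_eq_right h]
    have hle : V {x | f x - t < 0} ≤ V univ / 2 := by
      rw [← hset, ENNReal.le_div_iff_mul_le (by simp) (by simp), mul_two]
      exact (add_le_add h le_rfl).trans hsum
    have hgs : ContMDiff (𝓡 n) 𝓘(ℝ, ℝ) ∞ fun x ↦ f x - t := hf.sub contMDiff_const
    have := cheegerConstant_mul_volume_le hgs (fun x hx ↦ ?_) hle
    · rw [hset]
      exact ((mul_le_mul_left hc _).trans this).trans (hlev _ fun x hx ↦ sub_eq_zero.1 hx)
    · intro h0
      refine hreg x (sub_eq_zero.1 hx) ?_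
      have h1 := mvfderiv_sub (I := 𝓡 n) (g := f) (g' := fun _ ↦ t) (x := x)
        (hd x) mdifferentiableAt_const
      have h2 : mvfderiv (𝓡 n) (fun x ↦ f x - t) x = mvfderiv (𝓡 n) f x - 0 := by
        refine Eq.trans h1 ?_
        rw [mvfderiv_const]
      rw [h2, sub_zero] at h0
      exact h0

/-- Cheeger's inequality in `L¹` form. -/
theorem mul_crossVolume_le {f : M → ℝ} (hf : ContMDiff (𝓡 n) 𝓘(ℝ, ℝ) ∞ f)
    {c : ℝ≥0} (hc : c ≤ cheegerConstant n M) :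
    c * crossVolume (riemannianVolume n M) f ≤
      ∫⁻ x, ENNReal.ofReal ‖mvfderiv (𝓡 n) f x‖ ∂(riemannianVolume n M) := by
  have := isFiniteMeasure_riemannianVolume n M
  set V := riemannianVolume n M
  refine ENNReal.le_of_forall_pos_le_add fun δ hδ _ ↦ ?_
  set v : ℝ≥0 := (V univ).toNNReal with hv
  have hvV : V univ = v := (ENNReal.coe_toNNReal (measure_ne_top V univ)).symm
  -- The perturbation costs `c * η * v` through the values of f and `η * v` through its gradient.
  set η : ℝ≥0 := δ / ((c + 1) * v + 1) with hη
  have hηpos : 0 < η := by positivity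
  have hηle : η * ((c + 1) * v) ≤ δ := by
    rw [hη, div_mul_eq_mul_div, div_le_iff₀ (by positivity)]
    gcongr
    exact le_self_add
  obtain ⟨g, hg, h1, h2, h3⟩ := exists_perturbation_finite_critical hf (η := (η : ℝ))
    (by exact_mod_cast hηpos)
  calc c * crossVolume V f
      ≤ c * (crossVolume V g + ∫⁻ x, ENNReal.ofReal |f x - g x| ∂V) := by
        gcongr
        exact crossVolume_le_add hf.continuous.aemeasurable hg.continuous.aemeasurable
    _ ≤ c * (crossVolume V g + ∫⁻ _, η ∂V) := by
        gcongr with x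
        rw [abs_sub_comm, ← ENNReal.ofReal_coe_nnreal]
        exact ENNReal.ofReal_le_ofReal (h1 x)
    _ = c * crossVolume V g + c * (η * v) := by rw [lintegral_const, hvV, mul_add]
    _ ≤ ∫⁻ x, ENNReal.ofReal ‖mvfderiv (𝓡 n) g x‖ ∂V + c * (η * v) := by
        gcongr
        exact mul_crossVolume_le_of_finite hg h3 hc
    _ ≤ ∫⁻ x, (ENNReal.ofReal ‖mvfderiv (𝓡 n) f x‖ + η) ∂V + c * (η * v) := by
        gcongr with x
        refine (ENNReal.ofReal_le_ofReal (h2 x)).trans ?_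
        refine ENNReal.ofReal_add_le.trans (by rw [ENNReal.ofReal_coe_nnreal])
    _ = ∫⁻ x, ENNReal.ofReal ‖mvfderiv (𝓡 n) f x‖ ∂V + (η * ((c + 1) * v) : ℝ≥0) := by
        rw [lintegral_add_right _ measurable_const, lintegral_const, hvV, add_assoc]
        push_cast
        ring
    _ ≤ _ := by gcongr

end Cheeger

/-! ### Mollification in L² and weak derivatives on Euclidean space. -/

section Mollification

open scoped Convolution

theorem sq_lintegral_mul_le {X : Type*} [MeasurableSpace X] {μ : Measure X} {f g : X → ℝ≥0∞}
    (hf : AEMeasurable f μ) (hg : AEMeasurable g μ) :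
    (∫⁻ x, f x * g x ∂μ) ^ 2 ≤ (∫⁻ x, f x ^ 2 ∂μ) * ∫⁻ x, g x ^ 2 ∂μ := by
  have h := ENNReal.lintegral_mul_norm_pow_le (μ := μ) (hf.pow_const (2 : ℕ))
    (hg.pow_const (2 : ℕ)) (p := 1 / 2) (q := 1 / 2) (by norm_num) (by norm_num) (by norm_num)
  have hs : ∀ a : ℝ≥0∞, (a ^ 2) ^ (1 / 2 : ℝ) = a := fun a ↦ by
    rw [← ENNReal.rpow_natCast, ← ENNReal.rpow_mul]; norm_num
  have hs' : ∀ a : ℝ≥0∞, (a ^ (1 / 2 : ℝ)) ^ 2 = a := fun a ↦ by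
    rw [← ENNReal.rpow_natCast, ← ENNReal.rpow_mul]; norm_num
  simp only [hs] at h
  calc _ ≤ ((∫⁻ x, f x ^ 2 ∂μ) ^ (1 / 2 : ℝ) * (∫⁻ x, g x ^ 2 ∂μ) ^ (1 / 2 : ℝ)) ^ 2 := by gcongr
    _ = _ := by rw [mul_pow, hs', hs']

/-- Jensen's inequality for the square, from Cauchy–Schwarz applied to √f and √f g. -/
theorem sq_lintegral_mul_le_of_lintegral_le_one {X : Type*} [MeasurableSpace X] {μ : Measure X}
    {f g : X → ℝ≥0∞} (hf : AEMeasurable f μ) (hg : AEMeasurable g μ) (h1 : ∫⁻ x, f x ∂μ ≤ 1) :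
    (∫⁻ x, f x * g x ∂μ) ^ 2 ≤ ∫⁻ x, f x * g x ^ 2 ∂μ := by
  have hs' : ∀ a : ℝ≥0∞, (a ^ (1 / 2 : ℝ)) ^ 2 = a := fun a ↦ by
    rw [← ENNReal.rpow_natCast, ← ENNReal.rpow_mul]; norm_num
  have h := sq_lintegral_mul_le (μ := μ) (f := fun x ↦ f x ^ (1 / 2 : ℝ))
    (g := fun x ↦ f x ^ (1 / 2 : ℝ) * g x) (hf.pow_const _) ((hf.pow_const _).mul hg)
  simp only [mul_pow, ← mul_assoc, ← sq, hs'] at h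
  exact h.trans (mul_le_of_le_one_left (by simp) h1)

variable {E : Type*} [NormedAddCommGroup E] [NormedSpace ℝ E] [FiniteDimensional ℝ E]
  [MeasurableSpace E] [BorelSpace E] {μ : Measure E} [μ.IsAddHaarMeasure]
  {H : Type*} [NormedAddCommGroup H]

/-- Continuity at 0 of translation as a map into L². -/
theorem exists_forall_lintegral_translate_le {g : E → H} (hg : MemLp g 2 μ) {ε : ℝ≥0∞}
    (hε : ε ≠ 0) : ∃ δ > 0, ∀ t : E, ‖t‖ < δ → ∫⁻ y, ‖g (y - t) - g y‖ₑ ^ 2 ∂μ ≤ ε := by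
  let τ : E → C(E, E) := fun t ↦ ⟨fun y ↦ y - t, by fun_prop⟩
  have hτ : Continuous τ := ContinuousMap.continuous_of_continuous_uncurry _ (by
    change Continuous fun p : E × E ↦ p.2 - p.1; fun_prop)
  have hτm : ∀ t, MeasurePreserving (τ t) μ μ := fun t ↦ measurePreserving_sub_right μ t
  have : Fact ((1 : ℝ≥0∞) ≤ 2) := ⟨by norm_num⟩
  have hc := (continuous_const (y := hg.toLp g)).compMeasurePreservingLp hτ hτm (by simp)
  have hε' : 0 < ε ^ (1 / 2 : ℝ) := ENNReal.rpow_pos_of_nonneg (pos_iff_ne_zero.2 hε) (by norm_num)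
  have h1 := (EMetric.tendsto_nhds.1 (hc.tendsto 0)) _ hε'
  obtain ⟨δ, hδ, h⟩ := Metric.eventually_nhds_iff.1 h1
  refine ⟨δ, hδ, fun t ht ↦ ?_⟩
  have h2 := h (y := t) (by simpa using ht)
  rw [Lp.toLp_compMeasurePreserving, Lp.toLp_compMeasurePreserving, Lp.edist_toLp_toLp] at h2
  have h3 : eLpNorm (g ∘ τ t - g ∘ τ 0) 2 μ = (∫⁻ y, ‖g (y - t) - g y‖ₑ ^ 2 ∂μ) ^ (1 / 2 : ℝ) := by
    rw [eLpNorm_eq_lintegral_rpow_enorm_toReal (by simp) (by simp)]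
    simp [τ]
  rw [h3] at h2
  exact ((ENNReal.rpow_lt_rpow_iff (by norm_num)).1 h2).le

variable [NormedSpace ℝ H]

theorem contDiff_normed_convolution (φ : ContDiffBump (0 : E)) {g : E → H}
    (hg : LocallyIntegrable g μ) :
    ContDiff ℝ ∞ (φ.normed μ ⋆[ContinuousLinearMap.lsmul ℝ ℝ, μ] g) :=
  φ.hasCompactSupport_normed.contDiff_convolution_left (n := ⊤) _ φ.contDiff_normed hg

variable [CompleteSpace H]

/-- Mollification converges in `L²`. -/
theorem exists_forall_lintegral_convolution_sub_le {g : E → H} (hgm : StronglyMeasurable g)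
    (hg : MemLp g 2 μ) {ε : ℝ≥0∞} (hε : ε ≠ 0) :
    ∃ δ > 0, ∀ φ : ContDiffBump (0 : E), φ.rOut ≤ δ →
      ∫⁻ y, ‖(φ.normed μ ⋆[ContinuousLinearMap.lsmul ℝ ℝ, μ] g) y - g y‖ₑ ^ 2 ∂μ ≤ ε := by
  obtain ⟨δ, hδ, h⟩ := exists_forall_lintegral_translate_le hg hε
  refine ⟨δ, hδ, fun φ hφ ↦ ?_⟩
  set ρ : E → ℝ≥0∞ := fun t ↦ ‖φ.normed μ t‖ₑ with hρ
  have hρm : Measurable ρ := φ.continuous_normed.measurable.enorm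
  have hρ1 : ∫⁻ t, ρ t ∂μ = 1 := by
    have h1 := ofReal_integral_eq_lintegral_ofReal (φ.integrable_normed (μ := μ))
      (Eventually.of_forall φ.nonneg_normed)
    rw [φ.integral_normed, ENNReal.ofReal_one] at h1
    rw [h1]
    exact lintegral_congr fun t ↦ Real.enorm_of_nonneg (φ.nonneg_normed t)
  have hli := hg.locallyIntegrable (by norm_num)
  have hgm2 : StronglyMeasurable fun p : E × E ↦ g (p.1 - p.2) - g p.1 :=
    (hgm.comp_measurable (measurable_fst.sub measurable_snd)).sub
      (hgm.comp_measurable measurable_fst)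
  -- Jensen for the probability density ρ moves the square inside the average. Tonelli then reduces
  -- the claim to translations shorter than δ.
  have hpt : ∀ y, ‖(φ.normed μ ⋆[ContinuousLinearMap.lsmul ℝ ℝ, μ] g) y - g y‖ₑ ^ 2 ≤
      ∫⁻ t, ρ t * ‖g (y - t) - g y‖ₑ ^ 2 ∂μ := by
    intro y
    have hi : Integrable (fun t ↦ φ.normed μ t • g (y - t)) μ :=
      φ.hasCompactSupport_normed.convolutionExists_left (ContinuousLinearMap.lsmul ℝ ℝ)
        φ.continuous_normed hli y
    have h1 : (φ.normed μ ⋆[ContinuousLinearMap.lsmul ℝ ℝ, μ] g) y - g y =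
        ∫ t, φ.normed μ t • (g (y - t) - g y) ∂μ := by
      simp only [smul_sub]
      rw [integral_sub hi (φ.integrable_normed.smul_const _), φ.integral_normed_smul]
      rfl
    rw [h1]
    refine le_trans ?_ (sq_lintegral_mul_le_of_lintegral_le_one hρm.aemeasurable ?_ hρ1.le)
    · gcongr
      refine (enorm_integral_le_lintegral_enorm _).trans_eq ?_
      simp only [enorm_smul, hρ]
    · exact ((hgm2.comp_measurable measurable_prodMk_left).enorm).aemeasurable
  calc _ ≤ ∫⁻ y, ∫⁻ t, ρ t * ‖g (y - t) - g y‖ₑ ^ 2 ∂μ ∂μ := lintegral_mono hpt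
    _ = ∫⁻ t, ∫⁻ y, ρ t * ‖g (y - t) - g y‖ₑ ^ 2 ∂μ ∂μ := by
        refine lintegral_lintegral_swap (Measurable.aemeasurable ?_)
        exact (hρm.comp measurable_snd).mul (hgm2.enorm.pow_const 2)
    _ ≤ ∫⁻ t, ρ t * ε ∂μ := by
        refine lintegral_mono fun t ↦ ?_
        change ∫⁻ y, ρ t * ‖g (y - t) - g y‖ₑ ^ 2 ∂μ ≤ _
        rw [lintegral_const_mul' _ _ (by simp [hρ])]
        by_cases ht : ‖t‖ < δ
        · gcongr
          exact h t ht
        · have : φ.normed μ t = 0 := by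
            rw [← Function.notMem_support, φ.support_normed_eq, mem_ball_zero_iff]
            exact fun h' ↦ ht (h'.trans_le hφ)
          simp [hρ, this]
    _ = ε := by rw [lintegral_mul_const _ hρm, hρ1, one_mul]

/-- The derivative of a mollification is the mollification of the weak derivative. -/
theorem fderiv_normed_convolution (φ : ContDiffBump (0 : E)) {T : Set E} {v : E → ℝ}
    {w : E → E →L[ℝ] ℝ} (hv : LocallyIntegrable v μ) (hw : LocallyIntegrable w μ)
    (h : ∀ ψ : E → ℝ, ContDiff ℝ ∞ ψ → HasCompactSupport ψ → tsupport ψ ⊆ T → ∀ e : E,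
      ∫ y, v y * fderiv ℝ ψ y e ∂μ = -∫ y, w y e * ψ y ∂μ) {y : E}
    (hy : Metric.closedBall y φ.rOut ⊆ T) :
    fderiv ℝ (φ.normed μ ⋆[ContinuousLinearMap.lsmul ℝ ℝ, μ] v) y =
      (φ.normed μ ⋆[ContinuousLinearMap.lsmul ℝ ℝ, μ] w) y := by
  have hρ := φ.hasCompactSupport_normed (μ := μ)
  have hρs : ContDiff ℝ ∞ (φ.normed μ) := φ.contDiff_normed
  have hd := (hρ.hasFDerivAt_convolution_left (ContinuousLinearMap.lsmul ℝ ℝ)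
    (hρs.of_le (by simp)) hv y).fderiv
  rw [hd]
  ext e
  -- The reflected mollifier centred at y is the test function; its support is the ball assumed to
  -- lie in T.
  set ψ : E → ℝ := fun t ↦ φ.normed μ (y - t) with hψ
  have hψs : ContDiff ℝ ∞ ψ := hρs.comp (contDiff_const.sub contDiff_id)
  have hψsupp : Function.support ψ = Metric.ball y φ.rOut := by
    ext t
    have : t ∈ Function.support ψ ↔ y - t ∈ Function.support (φ.normed μ) := Iff.rfl
    rw [this, φ.support_normed_eq, mem_ball_zero_iff, Metric.mem_ball, dist_comm, dist_eq_norm]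
  have hψt : tsupport ψ = Metric.closedBall y φ.rOut := by
    rw [tsupport, hψsupp, closure_ball _ φ.rOut_pos.ne']
  have hψc : HasCompactSupport ψ := by
    rw [HasCompactSupport, hψt]; exact isCompact_closedBall _ _
  have hψd : ∀ t, fderiv ℝ ψ t e = -fderiv ℝ (φ.normed μ) (y - t) e := by
    intro t
    have h1 := ((hρs.differentiable (by simp)) (y - t)).hasFDerivAt.comp t
      ((hasFDerivAt_id t).const_sub y)
    have h2 : fderiv ℝ ψ t = _ := h1.fderiv
    rw [h2]; simp
  have key := h ψ hψs hψc (hψt.trans_subset hy) e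
  have hI1 : Integrable (fun t ↦ ((ContinuousLinearMap.lsmul ℝ ℝ).precompL E
      (fderiv ℝ (φ.normed μ) t)) (v (y - t))) μ :=
    (hρ.fderiv ℝ).convolutionExists_left _ (hρs.continuous_fderiv (by simp)) hv y
  have hI2 : Integrable (fun t ↦ (ContinuousLinearMap.lsmul ℝ ℝ (φ.normed μ t)) (w (y - t))) μ :=
    hρ.convolutionExists_left _ φ.continuous_normed hw y
  calc ((fderiv ℝ (φ.normed μ) ⋆[(ContinuousLinearMap.lsmul ℝ ℝ).precompL E, μ] v) y) e
      = ∫ t, fderiv ℝ (φ.normed μ) t e * v (y - t) ∂μ := by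
        rw [convolution_def, ContinuousLinearMap.integral_apply hI1]
        simp [ContinuousLinearMap.precompL_apply]
    _ = ∫ t, fderiv ℝ (φ.normed μ) (y - t) e * v t ∂μ := by
        rw [← integral_sub_left_eq_self _ μ y]
        simp
    _ = -∫ t, v t * fderiv ℝ ψ t e ∂μ := by
        rw [← integral_neg]
        refine integral_congr_ae (Eventually.of_forall fun t ↦ ?_)
        simp only [hψd t]; ring
    _ = ∫ t, w t e * ψ t ∂μ := by rw [key, neg_neg]
    _ = ∫ t, φ.normed μ t * w (y - t) e ∂μ := by
        rw [← integral_sub_left_eq_self _ μ y]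
        refine integral_congr_ae (Eventually.of_forall fun t ↦ ?_)
        simp only [hψ, sub_sub_cancel]; ring
    _ = ((φ.normed μ ⋆[ContinuousLinearMap.lsmul ℝ ℝ, μ] w) y) e := by
        rw [convolution_def, ContinuousLinearMap.integral_apply hI2]
        simp

end Mollification

/-! ### Measurability of vector fields and their reading in a chart. -/

section TangentBundle

/-- Compose k with simple approximations of σ. These compositions are simple even where the
approximations leave O, and they converge because k is continuous at the limit point `σ x` in O. -/
theorem AEStronglyMeasurable.comp_continuousOn_of_ae_mem {X Y Z : Type*} [MeasurableSpace X]
    [TopologicalSpace Y] [TopologicalSpace Z] [TopologicalSpace.PseudoMetrizableSpace Z]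
    {μ : Measure X} {σ : X → Y} (hσ : AEStronglyMeasurable σ μ) {k : Y → Z} {O : Set Y}
    (hO : IsOpen O) (hk : ContinuousOn k O) (h : ∀ᵐ x ∂μ, σ x ∈ O) :
    AEStronglyMeasurable (fun x ↦ k (σ x)) μ := by
  refine aestronglyMeasurable_of_tendsto_ae (u := atTop)
    (f := fun i x ↦ k (hσ.stronglyMeasurable_mk.approx i x)) (fun i ↦ ?_) ?_
  · exact ((hσ.stronglyMeasurable_mk.approx i).map k).stronglyMeasurable.aestronglyMeasurable
  · filter_upwards [h, hσ.ae_eq_mk] with x hx hx'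
    have h1 := hσ.stronglyMeasurable_mk.tendsto_approx x
    rw [← hx'] at h1
    exact (hk.continuousAt (hO.mem_nhds hx)).tendsto.comp h1

variable {n : ℕ} {M : Type*} [TopologicalSpace M]
  [ChartedSpace (EuclideanSpace ℝ (Fin n)) M] [IsManifold (𝓡 n) ∞ M]

theorem continuous_mvfderiv_apply {f : M → ℝ} (hf : ContMDiff (𝓡 n) 𝓘(ℝ, ℝ) ∞ f) :
    Continuous fun p : TangentBundle (𝓡 n) M ↦ mvfderiv (𝓡 n) f p.1 p.2 := by
  have h1 := hf.continuous_tangentMap (by simp)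
  exact (continuous_snd.comp (tangentBundleModelSpaceHomeomorph 𝓘(ℝ, ℝ)).continuous).comp h1

variable [RiemannianBundle (fun x : M ↦ TangentSpace (𝓡 n) x)]

/-- The covector `⟨v, ·⟩` at `x`, read in the preferred chart at `x₀`. -/
noncomputable def chartCovector (x₀ x : M) (v : TangentSpace (𝓡 n) x) :
    EuclideanSpace ℝ (Fin n) →L[ℝ] ℝ :=
  (innerSL ℝ v).comp (chartDerivSymm x₀ x)

theorem chartCovector_apply (x₀ x : M) (v : TangentSpace (𝓡 n) x) (e : EuclideanSpace ℝ (Fin n)) :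
    chartCovector x₀ x v e = inner ℝ v (chartDerivSymm x₀ x e) := rfl

theorem chartCovector_chartDeriv {x₀ x : M} (hx : x ∈ (extChartAt (𝓡 n) x₀).source)
    (v w : TangentSpace (𝓡 n) x) : chartCovector x₀ x v (chartDeriv x₀ x w) = inner ℝ v w := by
  rw [chartCovector_apply, chartDerivSymm_chartDeriv hx]

variable
  [IsContinuousRiemannianBundle (EuclideanSpace ℝ (Fin n)) (fun x : M ↦ TangentSpace (𝓡 n) x)]

theorem continuous_norm_tangentBundle :
    Continuous fun p : TangentBundle (𝓡 n) M ↦ ‖p.2‖ := by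
  have h : Continuous fun p : TangentBundle (𝓡 n) M ↦ inner ℝ p.2 p.2 :=
    Continuous.inner_bundle (F := EuclideanSpace ℝ (Fin n)) (E := fun x : M ↦ TangentSpace (𝓡 n) x)
      (b := fun p : TangentBundle (𝓡 n) M ↦ p.1) (v := fun p ↦ p.2) (w := fun p ↦ p.2) continuous_id continuous_id
  refine h.sqrt.congr fun p ↦ ?_
  rw [real_inner_self_eq_norm_sq, Real.sqrt_sq (norm_nonneg _)]

theorem continuousOn_inner_chartDerivSymm (x₀ : M) (e : EuclideanSpace ℝ (Fin n)) :
    ContinuousOn (fun p : TangentBundle (𝓡 n) M ↦ inner ℝ p.2 (chartDerivSymm x₀ p.1 e))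
      {p | p.1 ∈ (extChartAt (𝓡 n) x₀).source} := by
  set τ := trivializationAt (EuclideanSpace ℝ (Fin n)) (TangentSpace (𝓡 n)) x₀ with hτ
  have hb : ∀ x, x ∈ (extChartAt (𝓡 n) x₀).source → x ∈ τ.baseSet := fun x hx ↦ by
    simpa [hτ] using hx
  refine ContinuousOn.inner_bundle (F := EuclideanSpace ℝ (Fin n))
    (E := fun x : M ↦ TangentSpace (𝓡 n) x)
    (b := fun p : TangentBundle (𝓡 n) M ↦ p.1) (v := fun p ↦ p.2)
    (w := fun p ↦ chartDerivSymm x₀ p.1 e) continuousOn_id ?_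
  have h1 := τ.continuousOn_symm.comp
    ((FiberBundle.continuous_proj (EuclideanSpace ℝ (Fin n)) (fun x : M ↦ TangentSpace (𝓡 n) x)).prodMk
      (continuous_const (y := e))).continuousOn
    (s := {p : TangentBundle (𝓡 n) M | p.1 ∈ (extChartAt (𝓡 n) x₀).source})
    fun p hp ↦ ⟨hb _ hp, mem_univ _⟩
  refine h1.congr fun p hp ↦ ?_
  have h2 : chartDerivSymm x₀ p.1 e = τ.symm p.1 e := τ.symmL_apply (R := ℝ) (hb _ hp) e
  rw [h2]
  rfl

theorem continuousOn_chartCovector (x₀ : M) :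
    ContinuousOn (fun p : TangentBundle (𝓡 n) M ↦ chartCovector x₀ p.1 p.2)
      {p | p.1 ∈ (extChartAt (𝓡 n) x₀).source} := by
  refine continuousOn_clm_apply.2 fun e ↦ ?_
  exact continuousOn_inner_chartDerivSymm x₀ e

theorem aestronglyMeasurable_chartCovector [MeasurableSpace M] {V : Measure M}
    {G : ∀ x : M, TangentSpace (𝓡 n) x} (x₀ : M) {S : Set M} (hSm : MeasurableSet S)
    (hS : S ⊆ (extChartAt (𝓡 n) x₀).source)
    (hG : AEStronglyMeasurable (fun x ↦ (⟨x, G x⟩ : TangentBundle (𝓡 n) M)) V) :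
    AEStronglyMeasurable (fun x ↦ chartCovector x₀ x (G x)) (V.restrict S) := by
  refine AEStronglyMeasurable.comp_continuousOn_of_ae_mem (hG.restrict (s := S))
    (k := fun p : TangentBundle (𝓡 n) M ↦ chartCovector x₀ p.1 p.2)
    ((isOpen_extChartAt_source x₀).preimage
      (FiberBundle.continuous_proj (EuclideanSpace ℝ (Fin n)) (fun x : M ↦ TangentSpace (𝓡 n) x)))
    (continuousOn_chartCovector x₀) ?_
  filter_upwards [ae_restrict_mem hSm] with x hx using hS hx

end TangentBundle

/-! ### Charts with bounded derivatives. -/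

section GoodChart

variable {n : ℕ} {M : Type*} [EMetricSpace M]
  [ChartedSpace (EuclideanSpace ℝ (Fin n)) M] [IsManifold (𝓡 n) ∞ M]
  [RiemannianBundle (fun x : M ↦ TangentSpace (𝓡 n) x)]
  [IsContinuousRiemannianBundle (EuclideanSpace ℝ (Fin n)) (fun x : M ↦ TangentSpace (𝓡 n) x)]
  [IsRiemannianManifold (𝓡 n) M]

/-- A restriction of the preferred chart at `x₀` that is `K`-bilipschitz and has derivatives
bounded by `K`. -/
structure IsGoodChart (K : ℝ≥0) (x₀ : M)
    (Q : OpenPartialHomeomorph M (EuclideanSpace ℝ (Fin n))) : Prop where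
  source_subset : Q.source ⊆ (extChartAt (𝓡 n) x₀).source
  coe_eq : ∀ x, Q x = extChartAt (𝓡 n) x₀ x
  lipschitz : LipschitzOnWith K Q Q.source
  lipschitz_symm : LipschitzOnWith K Q.symm Q.target
  norm_deriv_le : ∀ x ∈ Q.source, ∀ v : TangentSpace (𝓡 n) x, ‖chartDeriv x₀ x v‖ ≤ K * ‖v‖
  norm_derivSymm_le : ∀ x ∈ Q.source, ∀ e : EuclideanSpace ℝ (Fin n),
    ‖chartDerivSymm x₀ x e‖ ≤ K * ‖e‖

theorem exists_isGoodChart (x₀ : M) : ∃ (K : ℝ≥0)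
    (Q : OpenPartialHomeomorph M (EuclideanSpace ℝ (Fin n))), x₀ ∈ Q.source ∧ IsGoodChart K x₀ Q := by
  obtain ⟨K, Q, hx₀, hs, hQ, h1, h2⟩ := exists_bilipschitz_chart (n := n) x₀
  have e1 := eventually_norm_chartDerivSymm_chartDeriv_le (n := n) x₀ one_lt_two
  have e2 := eventually_norm_chartDerivSymm_le (n := n) x₀ one_lt_two
  obtain ⟨U, hU, hUo, hxU⟩ := eventually_nhds_iff.1 (e1.and e2)
  set D := chartDeriv (n := n) x₀ x₀ with hD
  set S := chartDerivSymm (n := n) x₀ x₀ with hS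
  set K' : ℝ≥0 := K + 2 * ‖D‖₊ + 2 * ‖S‖₊ with hK'
  have hK : K ≤ K' := by rw [hK', add_assoc]; exact le_self_add
  have hDK : 2 * ‖D‖ ≤ K' := by
    have : 2 * ‖D‖₊ ≤ K' := (le_add_self (a := 2 * ‖D‖₊) (b := K)).trans le_self_add
    exact_mod_cast this
  have hSK : 2 * ‖S‖ ≤ K' := by
    have : 2 * ‖S‖₊ ≤ K' := le_add_self
    exact_mod_cast this
  refine ⟨K', Q.restrOpen U hUo, ⟨hx₀, hxU⟩, ?_, ?_, ?_, ?_, ?_, ?_⟩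
  · exact fun x hx ↦ hs hx.1
  · exact hQ
  · exact (h1.mono fun x hx ↦ hx.1).weaken hK
  · exact (h2.mono fun x hx ↦ hx.1).weaken hK
  · intro x hx v
    have h3 := (hU x hx.2).1 v
    have h4 := D.le_opNorm (S (chartDeriv x₀ x v))
    rw [chartDeriv_chartDerivSymm (mem_extChartAt_source (I := 𝓡 n) x₀)] at h4
    calc _ ≤ ‖D‖ * ‖S (chartDeriv x₀ x v)‖ := h4
      _ ≤ ‖D‖ * (2 * ‖v‖) := mul_le_mul_of_nonneg_left h3 (ContinuousLinearMap.opNorm_nonneg _)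
      _ = 2 * ‖D‖ * ‖v‖ := by ring
      _ ≤ _ := mul_le_mul_of_nonneg_right hDK (norm_nonneg _)
  · intro x hx e
    calc _ ≤ 2 * ‖S e‖ := (hU x hx.2).2 e
      _ ≤ 2 * (‖S‖ * ‖e‖) := mul_le_mul_of_nonneg_left (S.le_opNorm e) zero_le_two
      _ = 2 * ‖S‖ * ‖e‖ := by ring
      _ ≤ _ := mul_le_mul_of_nonneg_right hSK (norm_nonneg _)

end GoodChart

/-! ### Products of a cutoff function with a function in a chart. -/

section CutoffDerivative

variable {n : ℕ} {M : Type*} [TopologicalSpace M] [ChartedSpace (EuclideanSpace ℝ (Fin n)) M]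

theorem mvfderiv_eq_zero_of_notMem_tsupport {χ : M → ℝ} {x : M} (hx : x ∉ tsupport χ) :
    mvfderiv (𝓡 n) χ x = 0 := by
  have h : χ =ᶠ[𝓝 x] fun _ ↦ 0 := notMem_tsupport_iff_eventuallyEq.1 hx
  have h1 := h.mfderiv_eq (I := 𝓡 n) (I' := 𝓘(ℝ, ℝ))
  ext v
  have h2 := congrArg (fun T ↦ T v) (mvfderiv_const (I := 𝓡 n) (M := M) (0 : ℝ) (x := x))
  refine Eq.trans ?_ h2
  simp only [mvfderiv]
  erw [h1]
  rw [h.eq_of_nhds]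

variable [IsManifold (𝓡 n) ∞ M]

theorem contMDiff_mul_comp_extChartAt {χ : M → ℝ} (hχ : ContMDiff (𝓡 n) 𝓘(ℝ, ℝ) ∞ χ) {x₀ : M}
    (hs : tsupport χ ⊆ (extChartAt (𝓡 n) x₀).source) {k : EuclideanSpace ℝ (Fin n) → ℝ}
    (hk : ContDiff ℝ ∞ k) :
    ContMDiff (𝓡 n) 𝓘(ℝ, ℝ) ∞ (fun x ↦ χ x * k (extChartAt (𝓡 n) x₀ x)) := by
  refine contMDiff_of_tsupport fun x hx ↦ ?_
  have hx' := hs ((tsupport_mul_subset_left (f := χ)) hx)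
  refine (hχ x).mul (hk.contMDiff.contMDiffAt.comp x (contMDiffAt_extChartAt' (by simpa using hx')))

theorem mvfderiv_mul_comp_extChartAt {χ : M → ℝ} (hχ : ContMDiff (𝓡 n) 𝓘(ℝ, ℝ) ∞ χ) {x₀ x : M}
    (hx : x ∈ (extChartAt (𝓡 n) x₀).source) {k : EuclideanSpace ℝ (Fin n) → ℝ}
    (hk : ContDiff ℝ ∞ k) (v : TangentSpace (𝓡 n) x) :
    mvfderiv (𝓡 n) (fun x ↦ χ x * k (extChartAt (𝓡 n) x₀ x)) x v =
      mvfderiv (𝓡 n) χ x v * k (extChartAt (𝓡 n) x₀ x) +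
        χ x * fderiv ℝ k (extChartAt (𝓡 n) x₀ x) (chartDeriv x₀ x v) := by
  have hkd : MDifferentiableAt (𝓡 n) 𝓘(ℝ, ℝ) (fun x ↦ k (extChartAt (𝓡 n) x₀ x)) x :=
    (hk.contMDiff.contMDiffAt.comp x (contMDiffAt_extChartAt' (n := ∞)
      (by simpa using hx))).mdifferentiableAt (by simp)
  have h1 := mvfderiv_fun_mul ((hχ x).mdifferentiableAt (by simp)) hkd
  have h2 : fderiv ℝ ((fun x ↦ k (extChartAt (𝓡 n) x₀ x)) ∘ (extChartAt (𝓡 n) x₀).symm)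
      (extChartAt (𝓡 n) x₀ x) = fderiv ℝ k (extChartAt (𝓡 n) x₀ x) := by
    refine Filter.EventuallyEq.fderiv_eq ?_
    filter_upwards [(isOpen_extChartAt_target x₀).mem_nhds ((extChartAt (𝓡 n) x₀).map_source hx)]
      with y hy
    simp only [Function.comp_apply, (extChartAt (𝓡 n) x₀).right_inv hy]
  rw [h1, mvfderiv_eq_fderiv_comp_chartDeriv hx hkd, h2]
  simp only [add_apply, smul_apply,
    ContinuousLinearMap.comp_apply, smul_eq_mul]
  ring

end CutoffDerivative

theorem ennreal_add_sq_le (a b : ℝ≥0∞) : (a + b) ^ 2 ≤ 2 * (a ^ 2 + b ^ 2) := by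
  have := ENNReal.rpow_add_le_mul_rpow_add_rpow a b (p := 2) (by norm_num)
  norm_num at this
  exact this

theorem norm_chartCovector_le {n : ℕ} {M : Type*} [EMetricSpace M]
    [ChartedSpace (EuclideanSpace ℝ (Fin n)) M] [IsManifold (𝓡 n) ∞ M]
    [RiemannianBundle (fun x : M ↦ TangentSpace (𝓡 n) x)] {K : ℝ≥0}
    {Q : OpenPartialHomeomorph M (EuclideanSpace ℝ (Fin n))} {x₀ : M} (hQ : IsGoodChart K x₀ Q) {x : M} (hx : x ∈ Q.source)
    (v : TangentSpace (𝓡 n) x) : ‖chartCovector x₀ x v‖ ≤ K * ‖v‖ := by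
  refine ContinuousLinearMap.opNorm_le_bound _ (by positivity) fun e ↦ ?_
  rw [chartCovector_apply]
  calc ‖inner ℝ v (chartDerivSymm x₀ x e)‖ ≤ ‖v‖ * ‖chartDerivSymm x₀ x e‖ :=
        norm_inner_le_norm _ _
    _ ≤ ‖v‖ * (K * ‖e‖) := mul_le_mul_of_nonneg_left (hQ.norm_derivSymm_le x hx e) (norm_nonneg _)
    _ = _ := by ring

/-! ### Smooth approximation of an H¹ function inside one chart. -/

section LocalApproximation

open scoped Convolution

variable {n : ℕ} {M : Type*} [EMetricSpace M] [MeasurableSpace M] [BorelSpace M]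
  {K : ℝ≥0} {Q : OpenPartialHomeomorph M (EuclideanSpace ℝ (Fin n))}

theorem map_symm_absolutelyContinuous_restrict (hQ : LipschitzOnWith K Q Q.source) :
    (volume.restrict Q.target).map Q.symm ≪ (riemannianVolume n M).restrict Q.source :=
  (map_symm_le_riemannianVolume hQ).absolutelyContinuous.trans Measure.smul_absolutelyContinuous

theorem ae_source_of_ae_target (hQ : LipschitzOnWith K Q.symm Q.target)
    {p : EuclideanSpace ℝ (Fin n) → Prop} (h : ∀ᵐ y ∂(volume.restrict Q.target), p y) :
    ∀ᵐ x ∂((riemannianVolume n M).restrict Q.source), p (Q x) := by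
  rw [ae_restrict_iff' Q.open_target.measurableSet] at h
  rw [ae_restrict_iff' Q.open_source.measurableSet]
  have h1 := riemannianVolume_image_symm_le hQ
    (s := {y | ¬(y ∈ Q.target → p y)}) fun y hy ↦ (Classical.not_imp.1 hy).1
  rw [ae_iff.1 h, mul_zero] at h1
  refine measure_mono_null (fun x hx ↦ ?_) (le_antisymm h1 bot_le)
  obtain ⟨hx1, hx2⟩ := Classical.not_imp.1 hx
  exact ⟨Q x, fun h ↦ hx2 (h (Q.map_source hx1)), Q.left_inv hx1⟩

theorem aemeasurable_comp_openPartialHomeomorph {k : EuclideanSpace ℝ (Fin n) → ℝ≥0∞}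
    (hk : Measurable k) : AEMeasurable (fun x ↦ k (Q x)) ((riemannianVolume n M).restrict Q.source) :=
  hk.comp_aemeasurable (Q.continuousOn.aemeasurable Q.open_source.measurableSet)

theorem lintegral_source_comp_le (hQ : LipschitzOnWith K Q Q.source)
    (hQ' : LipschitzOnWith K Q.symm Q.target) {k : EuclideanSpace ℝ (Fin n) → ℝ≥0∞}
    (hk : Measurable k) :
    ∫⁻ x in Q.source, k (Q x) ∂(riemannianVolume n M) ≤ (K : ℝ≥0∞) ^ n * ∫⁻ y, k y := by
  refine (lintegral_source_le hQ' ((aemeasurable_comp_openPartialHomeomorph hk).mono_ac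
    (map_symm_absolutelyContinuous_restrict hQ))).trans (mul_le_mul' le_rfl ?_)
  calc ∫⁻ y in Q.target, k (Q (Q.symm y)) = ∫⁻ y in Q.target, k y :=
        setLIntegral_congr_fun Q.open_target.measurableSet fun y hy ↦ by
          simp only [Q.right_inv hy]
    _ ≤ ∫⁻ y, k y := setLIntegral_le_lintegral _ _

/-- The function is read in the chart, made strongly measurable and extended by zero, so that
convolution on the whole space applies to it. -/
theorem exists_euclidean_representative {H : Type*} [NormedAddCommGroup H]
    (hQ : LipschitzOnWith K Q Q.source) (hQ' : LipschitzOnWith K Q.symm Q.target) {f : M → H}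
    (hf : AEStronglyMeasurable f ((riemannianVolume n M).restrict Q.source))
    (hf2 : ∫⁻ x in Q.source, ‖f x‖ₑ ^ 2 ∂(riemannianVolume n M) < ⊤) :
    ∃ g : EuclideanSpace ℝ (Fin n) → H, StronglyMeasurable g ∧ MemLp g 2 volume ∧
      (∀ᵐ y ∂(volume.restrict Q.target), g y = f (Q.symm y)) ∧
      ∀ᵐ x ∂((riemannianVolume n M).restrict Q.source), g (Q x) = f x := by
  have h1 : AEStronglyMeasurable (f ∘ Q.symm) (volume.restrict Q.target) :=
    (hf.mono_ac (map_symm_absolutelyContinuous_restrict hQ)).comp_aemeasurable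
      aemeasurable_openPartialHomeomorph_symm
  have h2 : ∫⁻ y in Q.target, ‖f (Q.symm y)‖ₑ ^ 2 < ⊤ := by
    refine lt_of_le_of_lt ?_ (ENNReal.mul_lt_top (ENNReal.pow_lt_top (ENNReal.coe_lt_top
      (r := K)) (n := n)) hf2)
    have hm : AEMeasurable (fun x ↦ ‖f x‖ₑ ^ 2) ((riemannianVolume n M).restrict Q.source) :=
      hf.enorm.pow_const 2
    rw [← lintegral_map' (f := fun x ↦ ‖f x‖ₑ ^ 2)
      (hm.mono_ac (map_symm_absolutelyContinuous_restrict hQ))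
      aemeasurable_openPartialHomeomorph_symm, ← smul_eq_mul, ← lintegral_smul_measure]
    exact lintegral_mono' (map_symm_le_riemannianVolume hQ) le_rfl
  have h3 : MemLp (f ∘ Q.symm) 2 (volume.restrict Q.target) := by
    refine ⟨h1, (eLpNorm_lt_top_iff_lintegral_rpow_enorm_lt_top (by simp) (by simp)).2 ?_⟩
    simpa using h2
  have h4 : ∀ᵐ y ∂(volume.restrict Q.target),
      Q.target.indicator (h1.mk (f ∘ Q.symm)) y = f (Q.symm y) := by
    filter_upwards [ae_restrict_mem Q.open_target.measurableSet, h1.ae_eq_mk] with y hy hy'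
    rw [indicator_of_mem hy, ← hy']; rfl
  refine ⟨Q.target.indicator (h1.mk (f ∘ Q.symm)),
    h1.stronglyMeasurable_mk.indicator Q.open_target.measurableSet, ?_, h4, ?_⟩
  · rw [memLp_indicator_iff_restrict Q.open_target.measurableSet]
    exact h3.ae_eq h1.ae_eq_mk
  · filter_upwards [ae_source_of_ae_target hQ' h4, ae_restrict_mem Q.open_source.measurableSet]
      with x hx hx'
    rw [hx, Q.left_inv hx']

variable [ChartedSpace (EuclideanSpace ℝ (Fin n)) M] [IsManifold (𝓡 n) ∞ M]
  [RiemannianBundle (fun x : M ↦ TangentSpace (𝓡 n) x)]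
  [IsContinuousRiemannianBundle (EuclideanSpace ℝ (Fin n)) (fun x : M ↦ TangentSpace (𝓡 n) x)]
  [CompactSpace M]

/-- Local smooth approximation of an `H¹` function, by mollification in a chart. -/
theorem exists_local_approximation {u : M → ℝ} {G : ∀ x : M, TangentSpace (𝓡 n) x}
    (hu : IsSobolevH1 u G) {x₀ : M} (hQ : IsGoodChart K x₀ Q) {χ : M → ℝ}
    (hχ : ContMDiff (𝓡 n) 𝓘(ℝ, ℝ) ∞ χ) (hs : tsupport χ ⊆ Q.source) {ε : ℝ≥0∞} (hε : ε ≠ 0) :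
    ∃ (h : M → ℝ) (e : M → ℝ≥0∞), ContMDiff (𝓡 n) 𝓘(ℝ, ℝ) ∞ h ∧
      AEMeasurable e (riemannianVolume n M) ∧ ∫⁻ x, e x ^ 2 ∂(riemannianVolume n M) ≤ ε ∧
      ∀ᵐ x ∂(riemannianVolume n M), ‖h x - χ x * u x‖ₑ ≤ e x ∧
        ∀ v : TangentSpace (𝓡 n) x, ‖mvfderiv (𝓡 n) h x v -
          (mvfderiv (𝓡 n) χ x v * u x + χ x * inner ℝ (G x) v)‖ₑ ≤ e x * ‖v‖ₑ := by
  set V := riemannianVolume n M with hV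
  have hSm := Q.open_source.measurableSet
  have hTm := Q.open_target.measurableSet
  have hsymm : ∀ y ∈ Q.target, (extChartAt (𝓡 n) x₀).symm y = Q.symm y := by
    intro y hy
    have h1 := (extChartAt (𝓡 n) x₀).left_inv (hQ.source_subset (Q.map_target hy))
    rwa [← hQ.coe_eq, Q.right_inv hy] at h1
  -- representatives in the chart
  obtain ⟨U, hUm, hU2, hUT, hUS⟩ := exists_euclidean_representative hQ.lipschitz hQ.lipschitz_symm
    (f := u) hu.memLp.1.restrict (by
      have := (eLpNorm_lt_top_iff_lintegral_rpow_enorm_lt_top (by simp) (by simp)).1 hu.memLp.2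
      refine (setLIntegral_le_lintegral _ _).trans_lt ?_
      simpa using this)
  obtain ⟨w, hwm, hw2, hwT, hwS⟩ := exists_euclidean_representative hQ.lipschitz hQ.lipschitz_symm
    (f := fun x ↦ chartCovector x₀ x (G x))
    (aestronglyMeasurable_chartCovector x₀ hSm hQ.source_subset hu.aestronglyMeasurable) (by
      calc ∫⁻ x in Q.source, ‖chartCovector x₀ x (G x)‖ₑ ^ 2 ∂V
          ≤ ∫⁻ x in Q.source, (K : ℝ≥0∞) ^ 2 * ‖G x‖ₑ ^ 2 ∂V := by
            refine setLIntegral_mono' hSm fun x hx ↦ ?_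
            rw [← mul_pow]
            gcongr
            exact enorm_le_coe_mul_enorm_of_norm_le (norm_chartCovector_le hQ hx (G x))
        _ ≤ ∫⁻ x, (K : ℝ≥0∞) ^ 2 * ‖G x‖ₑ ^ 2 ∂V := setLIntegral_le_lintegral _ _
        _ = (K : ℝ≥0∞) ^ 2 * ∫⁻ x, ‖G x‖ₑ ^ 2 ∂V := lintegral_const_mul' _ _ (by finiteness)
        _ < ⊤ := ENNReal.mul_lt_top (by finiteness) hu.lintegral_lt_top)
  -- Off `Q.target` the test function and its derivative vanish, so replacing u and G by their
  -- representatives does not affect the integrals.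
  have hweak : ∀ ψ : EuclideanSpace ℝ (Fin n) → ℝ, ContDiff ℝ ∞ ψ → HasCompactSupport ψ →
      tsupport ψ ⊆ Q.target → ∀ e : EuclideanSpace ℝ (Fin n),
      ∫ y, U y * fderiv ℝ ψ y e = -∫ y, w y e * ψ y := by
    intro ψ hψ hψc hψT e
    have hTsub : Q.target ⊆ (extChartAt (𝓡 n) x₀).target := by
      intro y hy
      have := (extChartAt (𝓡 n) x₀).map_source (hQ.source_subset (Q.map_target hy))
      rwa [← hQ.coe_eq, Q.right_inv hy] at this
    rw [ae_restrict_iff' hTm] at hUT hwT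
    have h1 := hu.isWeakGradient x₀ ψ hψ hψc (hψT.trans hTsub) e
    have h2 : ∫ y, U y * fderiv ℝ ψ y e =
        ∫ y, u ((extChartAt (𝓡 n) x₀).symm y) * fderiv ℝ ψ y e := by
      refine integral_congr_ae ?_
      filter_upwards [hUT] with y hy
      by_cases hyT : y ∈ Q.target
      · simp only [hy hyT, hsymm y hyT]
      · have : fderiv ℝ ψ y = 0 := by
          have := support_fderiv_subset ℝ (f := ψ)
          by_contra h0
          exact hyT (hψT (this h0))
        simp [this]
    rw [h2, h1]
    congr 1
    refine integral_congr_ae ?_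
    filter_upwards [hwT] with y hy
    by_cases hyT : y ∈ Q.target
    · have hx := hQ.source_subset (Q.map_target hyT)
      have h3 := mfderiv_extChartAt_symm_apply (n := n) hx
      rw [← hQ.coe_eq, Q.right_inv hyT] at h3
      have h4 : w y e = inner ℝ (G (Q.symm y)) (chartDerivSymm x₀ (Q.symm y) e) := by
        rw [hy hyT, chartCovector_apply]
      rw [h4, ← h3, hsymm y hyT]
      rfl
    · have : ψ y = 0 := by
        by_contra h0
        exact hyT (hψT (subset_tsupport ψ h0))
      simp [this]
  -- bounds for the cutoff function
  obtain ⟨B₁, hB₁⟩ := isCompact_univ.exists_bound_of_continuousOn hχ.continuous.continuousOn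
  obtain ⟨B₂, hB₂⟩ := isCompact_univ.exists_bound_of_continuousOn
    (continuous_norm_mvfderiv hχ).continuousOn
  obtain ⟨B, hB1, hB2⟩ : ∃ B : ℝ≥0, (∀ x, ‖χ x‖ₑ ≤ B) ∧
      ∀ x (v : TangentSpace (𝓡 n) x), ‖mvfderiv (𝓡 n) χ x v‖ₑ ≤ B * ‖v‖ₑ := by
    refine ⟨(max B₁ B₂).toNNReal, fun x ↦ ?_, fun x v ↦ ?_⟩
    · rw [← ofReal_norm]
      exact ENNReal.ofReal_le_ofReal ((hB₁ x (mem_univ x)).trans (le_max_left _ _))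
    · refine enorm_le_coe_mul_enorm_of_norm_le ?_
      refine ((mvfderiv (𝓡 n) χ x).le_opNorm v).trans ?_
      refine mul_le_mul_of_nonneg_right ?_ (norm_nonneg _)
      have h1 := hB₂ x (mem_univ x)
      rw [Real.norm_eq_abs] at h1
      exact (le_abs_self _).trans (h1.trans ((le_max_right _ _).trans (Real.le_coe_toNNReal _)))
  -- choice of the mollification radius
  set C : ℝ≥0 := B * (1 + K) with hC
  -- The factors come from C in the pointwise error, (a + b)² ≤ 2(a² + b²), two mollification errors
  -- of at most ε' each, and `K ^ n` for the volume.
  obtain ⟨ε', hε'0, hε'⟩ := ENNReal.exists_nnreal_pos_mul_lt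
    (a := (C : ℝ≥0∞) ^ 2 * (2 * ((K : ℝ≥0∞) ^ n * 2))) (by finiteness) hε
  have hε'0 : (ε' : ℝ≥0∞) ≠ 0 := by exact_mod_cast hε'0.ne'
  obtain ⟨δ₁, hδ₁, h1⟩ := exists_forall_lintegral_convolution_sub_le hUm hU2 hε'0
  obtain ⟨δ₂, hδ₂, h2⟩ := exists_forall_lintegral_convolution_sub_le hwm hw2 hε'0
  have hKT : Q '' tsupport χ ⊆ Q.target := by
    rintro _ ⟨x, hx, rfl⟩; exact Q.map_source (hs hx)
  -- Below this radius, mollification at points of the support of χ sees only `Q.target`, where the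
  -- weak derivative is known.
  obtain ⟨δ₃, hδ₃, h3⟩ := ((isClosed_tsupport χ).isCompact.image_of_continuousOn
    (Q.continuousOn.mono hs)).exists_cthickening_subset_open Q.open_target hKT
  set δ := min (min δ₁ δ₂) δ₃ with hδ
  have hδ0 : 0 < δ := lt_min (lt_min hδ₁ hδ₂) hδ₃
  let φ : ContDiffBump (0 : EuclideanSpace ℝ (Fin n)) := ⟨δ / 2, δ, by positivity, by linarith⟩
  have h1 := h1 φ ((min_le_left _ _).trans (min_le_left _ _))
  have h2 := h2 φ ((min_le_left _ _).trans (min_le_right _ _))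
  have hUl := hU2.locallyIntegrable (by norm_num)
  have hwl := hw2.locallyIntegrable (by norm_num)
  set U' := φ.normed volume ⋆[ContinuousLinearMap.lsmul ℝ ℝ, volume] U with hU'
  set w' := φ.normed volume ⋆[ContinuousLinearMap.lsmul ℝ ℝ, volume] w with hw'
  have hU's : ContDiff ℝ ∞ U' := contDiff_normed_convolution φ hUl
  have hw's : ContDiff ℝ ∞ w' := contDiff_normed_convolution φ hwl
  have hder : ∀ x ∈ tsupport χ, fderiv ℝ U' (Q x) = w' (Q x) := fun x hx ↦
    fderiv_normed_convolution φ hUl hwl hweak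
      (((Metric.closedBall_subset_closedBall (min_le_right _ _)).trans
        (Metric.closedBall_subset_cthickening (mem_image_of_mem _ hx) _)).trans h3)
  set a : EuclideanSpace ℝ (Fin n) → ℝ≥0∞ := fun y ↦ ‖U' y - U y‖ₑ with ha
  set b : EuclideanSpace ℝ (Fin n) → ℝ≥0∞ := fun y ↦ ‖w' y - w y‖ₑ with hb
  have ham : Measurable a := (hU's.continuous.stronglyMeasurable.sub hUm).enorm
  have hbm : Measurable b := (hw's.continuous.stronglyMeasurable.sub hwm).enorm
  set e : M → ℝ≥0∞ := Q.source.indicator fun x ↦ C * (a (Q x) + b (Q x)) with he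
  refine ⟨fun x ↦ χ x * U' (extChartAt (𝓡 n) x₀ x), e,
    contMDiff_mul_comp_extChartAt hχ (hs.trans hQ.source_subset) hU's, ?_, ?_, ?_⟩
  · rw [he, aemeasurable_indicator_iff hSm]
    exact aemeasurable_comp_openPartialHomeomorph (k := fun y ↦ C * (a y + b y))
      ((ham.add hbm).const_mul _)
  · have hk : Measurable fun y ↦ (C * (a y + b y)) ^ 2 := ((ham.add hbm).const_mul _).pow_const 2
    calc ∫⁻ x, e x ^ 2 ∂V = ∫⁻ x in Q.source, (C * (a (Q x) + b (Q x))) ^ 2 ∂V := by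
          rw [← lintegral_indicator hSm]
          refine lintegral_congr fun x ↦ ?_
          by_cases hx : x ∈ Q.source <;> simp [he, hx]
      _ ≤ (K : ℝ≥0∞) ^ n * ∫⁻ y, (C * (a y + b y)) ^ 2 :=
          lintegral_source_comp_le hQ.lipschitz hQ.lipschitz_symm hk
      _ ≤ (K : ℝ≥0∞) ^ n * ∫⁻ y, (C : ℝ≥0∞) ^ 2 * (2 * (a y ^ 2 + b y ^ 2)) := by
          gcongr with y
          rw [mul_pow]
          gcongr
          exact ennreal_add_sq_le _ _
      _ = (K : ℝ≥0∞) ^ n * ((C : ℝ≥0∞) ^ 2 * (2 * ((∫⁻ y, a y ^ 2) + ∫⁻ y, b y ^ 2))) := by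
          rw [lintegral_const_mul' ((C : ℝ≥0∞) ^ 2) _ (by finiteness),
            lintegral_const_mul' 2 _ (by simp),
            lintegral_add_left (ham.pow_const 2)]
      _ ≤ (K : ℝ≥0∞) ^ n * ((C : ℝ≥0∞) ^ 2 * (2 * (ε' + ε'))) := by gcongr
      _ = ε' * ((C : ℝ≥0∞) ^ 2 * (2 * ((K : ℝ≥0∞) ^ n * 2))) := by ring
      _ ≤ ε := hε'.le
  · rw [ae_restrict_iff' hSm] at hUS hwS
    filter_upwards [hUS, hwS] with x hUx hwx
    by_cases hx : x ∈ tsupport χ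
    · have hxS := hs hx
      have hxφ := hQ.source_subset hxS
      have hex : e x = C * (a (Q x) + b (Q x)) := by simp [he, hxS]
      have hBC : (B : ℝ≥0∞) ≤ C := by
        rw [hC]; exact_mod_cast le_mul_of_one_le_right bot_le le_self_add
      have hBKC : (B : ℝ≥0∞) * K ≤ C := by
        rw [hC]; exact_mod_cast mul_le_mul_right le_add_self B
      refine ⟨?_, fun v ↦ ?_⟩
      · rw [← hQ.coe_eq, ← hUx hxS, ← mul_sub, enorm_mul, hex]
        exact mul_le_mul' ((hB1 x).trans hBC) le_self_add
      · rw [mvfderiv_mul_comp_extChartAt hχ hxφ hU's, ← hQ.coe_eq, hder x hx,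
          ← chartCovector_chartDeriv hxφ, ← hwx hxS, ← hUx hxS]
        have heq : mvfderiv (𝓡 n) χ x v * U' (Q x) + χ x * w' (Q x) (chartDeriv x₀ x v) -
            (mvfderiv (𝓡 n) χ x v * U (Q x) + χ x * w (Q x) (chartDeriv x₀ x v)) =
            mvfderiv (𝓡 n) χ x v * (U' (Q x) - U (Q x)) +
              χ x * (w' (Q x) - w (Q x)) (chartDeriv x₀ x v) := by
          rw [sub_apply]; ring
        rw [heq, hex]
        have hD : ‖chartDeriv x₀ x v‖ₑ ≤ K * ‖v‖ₑ :=
          enorm_le_coe_mul_enorm_of_norm_le (hQ.norm_deriv_le x hxS v)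
        calc _ ≤ ‖mvfderiv (𝓡 n) χ x v‖ₑ * a (Q x) +
              ‖χ x‖ₑ * ‖(w' (Q x) - w (Q x)) (chartDeriv x₀ x v)‖ₑ := by
              refine (enorm_add_le _ _).trans_eq ?_
              rw [enorm_mul, enorm_mul]
          _ ≤ (B * ‖v‖ₑ) * a (Q x) + B * (b (Q x) * (K * ‖v‖ₑ)) := by
              refine add_le_add (mul_le_mul' (hB2 x v) le_rfl) (mul_le_mul' (hB1 x) ?_)
              exact (ContinuousLinearMap.le_opENorm _ _).trans (mul_le_mul' le_rfl hD)
          _ = (B * a (Q x) + B * K * b (Q x)) * ‖v‖ₑ := by ring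
          _ ≤ (C * a (Q x) + C * b (Q x)) * ‖v‖ₑ := by gcongr
          _ = _ := by rw [mul_add]
    · have hχ0 : χ x = 0 := image_eq_zero_of_notMem_tsupport hx
      have hd0 := mvfderiv_eq_zero_of_notMem_tsupport (n := n) hx
      have hd0' := mvfderiv_eq_zero_of_notMem_tsupport (n := n)
        (fun h ↦ hx ((tsupport_mul_subset_left (f := χ)
          (g := fun x ↦ U' (extChartAt (𝓡 n) x₀ x))) h))
      refine ⟨by simp [hχ0], fun v ↦ ?_⟩
      rw [hd0, hd0']
      simp [hχ0]

end LocalApproximation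

/-! ### Density of smooth functions in H¹. -/

section Density

theorem mvfderiv_finset_sum {n : ℕ} {M ι : Type*} [TopologicalSpace M]
    [ChartedSpace (EuclideanSpace ℝ (Fin n)) M] (s : Finset ι) {f : ι → M → ℝ} {x : M}
    (hf : ∀ i, MDifferentiableAt (𝓡 n) 𝓘(ℝ, ℝ) (f i) x) (v : TangentSpace (𝓡 n) x) :
    MDifferentiableAt (𝓡 n) 𝓘(ℝ, ℝ) (fun y ↦ ∑ i ∈ s, f i y) x ∧
      mvfderiv (𝓡 n) (fun y ↦ ∑ i ∈ s, f i y) x v = ∑ i ∈ s, mvfderiv (𝓡 n) (f i) x v := by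
  classical
  induction s using Finset.induction_on with
  | empty =>
    simp only [Finset.sum_empty]
    refine ⟨mdifferentiableAt_const, ?_⟩
    rw [mvfderiv_const]; rfl
  | insert i s hi ih =>
    simp only [Finset.sum_insert hi]
    refine ⟨(hf i).add ih.1, ?_⟩
    rw [mvfderiv_fun_add (hf i) ih.1, add_apply, ih.2]

theorem ennreal_sum_sq_le {ι : Type*} (s : Finset ι) (a : ι → ℝ≥0∞) :
    (∑ i ∈ s, a i) ^ 2 ≤ s.card * ∑ i ∈ s, a i ^ 2 := by
  have := ENNReal.rpow_sum_le_const_mul_sum_rpow s a (p := 2) (by norm_num)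
  norm_num at this
  exact this

variable {n : ℕ} {M : Type*} [EMetricSpace M] [MeasurableSpace M] [BorelSpace M]
  [ChartedSpace (EuclideanSpace ℝ (Fin n)) M] [IsManifold (𝓡 n) ∞ M]
  [RiemannianBundle (fun x : M ↦ TangentSpace (𝓡 n) x)]
  [IsContinuousRiemannianBundle (EuclideanSpace ℝ (Fin n)) (fun x : M ↦ TangentSpace (𝓡 n) x)]
  [IsRiemannianManifold (𝓡 n) M] [CompactSpace M]

/-- Smooth functions are dense in `H¹(M)`. -/
theorem exists_smooth_approximation {u : M → ℝ} {G : ∀ x : M, TangentSpace (𝓡 n) x}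
    (hu : IsSobolevH1 u G) {ε : ℝ≥0∞} (hε : ε ≠ 0) :
    ∃ (f : M → ℝ) (e : M → ℝ≥0∞), ContMDiff (𝓡 n) 𝓘(ℝ, ℝ) ∞ f ∧
      AEMeasurable e (riemannianVolume n M) ∧ ∫⁻ x, e x ^ 2 ∂(riemannianVolume n M) ≤ ε ∧
      ∀ᵐ x ∂(riemannianVolume n M), ‖f x - u x‖ₑ ≤ e x ∧
        ∀ v : TangentSpace (𝓡 n) x,
          ‖mvfderiv (𝓡 n) f x v - inner ℝ (G x) v‖ₑ ≤ e x * ‖v‖ₑ := by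
  choose K Q hx hQ using exists_isGoodChart (n := n) (M := M)
  obtain ⟨t, ht⟩ := finite_cover_nhds fun x ↦ (Q x).open_source.mem_nhds (hx x)
  obtain ⟨χ, hχ⟩ := SmoothPartitionOfUnity.exists_isSubordinate (𝓡 n) (s := (univ : Set M))
    isClosed_univ (fun c : t ↦ (Q c).source) (fun c ↦ (Q c).open_source) (by
      intro x _
      have : x ∈ ⋃ c ∈ t, (Q c).source := by rw [ht]; exact mem_univ x
      simp only [mem_iUnion] at this ⊢
      obtain ⟨c, hc, hxc⟩ := this
      exact ⟨⟨c, hc⟩, hxc⟩)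
  have hsum : ∀ x, ∑ c, χ c x = 1 := fun x ↦ by
    rw [← finsum_eq_sum_of_fintype]; exact χ.sum_eq_one (mem_univ x)
  set N : ℝ≥0∞ := ((Finset.univ : Finset t).card : ℝ≥0∞) with hN
  obtain ⟨ε', hε'0, hε'⟩ := ENNReal.exists_nnreal_pos_mul_lt (a := N * N) (by finiteness) hε
  have hε'0 : (ε' : ℝ≥0∞) ≠ 0 := by exact_mod_cast hε'0.ne'
  choose h e hh hem he hae using fun c : t ↦
    exists_local_approximation hu (hQ c) (χ c).contMDiff (hχ c) hε'0
  refine ⟨fun x ↦ ∑ c, h c x, fun x ↦ ∑ c, e c x, contMDiff_finsetSum fun c _ ↦ hh c,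
    Finset.aemeasurable_fun_sum _ fun c _ ↦ hem c, ?_, ?_⟩
  · calc ∫⁻ x, (∑ c, e c x) ^ 2 ∂(riemannianVolume n M)
        ≤ ∫⁻ x, N * ∑ c, e c x ^ 2 ∂(riemannianVolume n M) :=
          lintegral_mono fun x ↦ ennreal_sum_sq_le _ _
      _ = N * ∑ c, ∫⁻ x, e c x ^ 2 ∂(riemannianVolume n M) := by
          rw [lintegral_const_mul' _ _ (by finiteness),
            lintegral_finsetSum' _ fun c _ ↦ (hem c).pow_const 2]
      _ ≤ N * ∑ _c : t, (ε' : ℝ≥0∞) := by gcongr with c; exact he c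
      _ = ε' * (N * N) := by rw [Finset.sum_const, nsmul_eq_mul]; ring
      _ ≤ ε := hε'.le
  · filter_upwards [ae_all_iff.2 hae] with x hx
    refine ⟨?_, fun v ↦ ?_⟩
    · have : ∑ c, h c x - u x = ∑ c, (h c x - χ c x * u x) := by
        rw [Finset.sum_sub_distrib, ← Finset.sum_mul, hsum, one_mul]
      rw [this]
      exact (enorm_sum_le _ _).trans (Finset.sum_le_sum fun c _ ↦ (hx c).1)
    -- The partition of unity sums to 1, so the terms in which u is multiplied by a derivative of a
    -- cutoff cancel.
    · have hd0 : ∑ c, mvfderiv (𝓡 n) (χ c) x v = 0 := by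
        rw [← (mvfderiv_finset_sum Finset.univ (f := fun c ↦ χ c)
          (fun c ↦ (χ c).contMDiff.mdifferentiableAt (by simp)) v).2]
        simp only [hsum]
        rw [mvfderiv_const]; rfl
      have h1 := (mvfderiv_finset_sum Finset.univ (f := h)
          (fun c ↦ (hh c).mdifferentiableAt (by simp)) v).2
      have h2 : ∑ c, mvfderiv (𝓡 n) (h c) x v - inner ℝ (G x) v =
          ∑ c, (mvfderiv (𝓡 n) (h c) x v -
            (mvfderiv (𝓡 n) (χ c) x v * u x + χ c x * inner ℝ (G x) v)) := by
        rw [Finset.sum_sub_distrib, Finset.sum_add_distrib, ← Finset.sum_mul, ← Finset.sum_mul,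
          hsum, hd0]
        ring
      rw [h1, h2, Finset.sum_mul]
      exact (enorm_sum_le _ _).trans (Finset.sum_le_sum fun c _ ↦ (hx c).2 v)

end Density

/-! ### The equation and Cheeger's inequality for functions of an H¹ function. -/

section Keys

theorem memLp_two_of_lintegral_lt_top {X : Type*} [MeasurableSpace X] {μ : Measure X} {f : X → ℝ}
    (hf : AEStronglyMeasurable f μ) (h : ∫⁻ x, ‖f x‖ₑ ^ 2 ∂μ < ⊤) : MemLp f 2 μ := by
  refine ⟨hf, (eLpNorm_lt_top_iff_lintegral_rpow_enorm_lt_top (by simp) (by simp)).2 ?_⟩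
  simpa using h

theorem tendsto_of_abs_sub_le {a e : ℕ → ℝ} {b : ℝ} (he : Tendsto e atTop (𝓝 0))
    (h : ∀ k, |a k - b| ≤ e k) : Tendsto a atTop (𝓝 b) :=
  tendsto_iff_dist_tendsto_zero.2 (squeeze_zero (fun _ ↦ dist_nonneg)
    (fun k ↦ by rw [Real.dist_eq]; exact h k) he)

section

variable {n : ℕ} {M : Type*} [TopologicalSpace M] [ChartedSpace (EuclideanSpace ℝ (Fin n)) M]

theorem mvfderiv_comp_smooth {F : ℝ → ℝ} (hF : ContDiff ℝ ∞ F) {f : M → ℝ}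
    (hf : ContMDiff (𝓡 n) 𝓘(ℝ, ℝ) ∞ f) (x : M) :
    mvfderiv (𝓡 n) (fun y ↦ F (f y)) x = deriv F (f x) • mvfderiv (𝓡 n) f x := by
  rw [mvfderiv_comp_left (hF.differentiable (by simp) _) ((hf x).mdifferentiableAt (by simp))]
  ext v
  simp [fderiv_eq_smul_deriv, mul_comm]

theorem aestronglyMeasurable_mvfderiv_apply [IsManifold (𝓡 n) ∞ M]
    {G : ∀ x : M, TangentSpace (𝓡 n) x} [MeasurableSpace M]
    {V : Measure M}
    (hG : AEStronglyMeasurable (fun x ↦ (⟨x, G x⟩ : TangentBundle (𝓡 n) M)) V)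
    {f : M → ℝ} (hf : ContMDiff (𝓡 n) 𝓘(ℝ, ℝ) ∞ f) :
    AEStronglyMeasurable (fun x ↦ mvfderiv (𝓡 n) f x (G x)) V :=
  AEStronglyMeasurable.comp_continuousOn_of_ae_mem hG isOpen_univ
    (continuous_mvfderiv_apply hf).continuousOn (Eventually.of_forall fun _ ↦ mem_univ _)

end

variable {n : ℕ} {M : Type*} [EMetricSpace M] [MeasurableSpace M] [BorelSpace M]
  [ChartedSpace (EuclideanSpace ℝ (Fin n)) M] [IsManifold (𝓡 n) ∞ M]
  [RiemannianBundle (fun x : M ↦ TangentSpace (𝓡 n) x)]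
  [IsContinuousRiemannianBundle (EuclideanSpace ℝ (Fin n)) (fun x : M ↦ TangentSpace (𝓡 n) x)]

theorem IsSobolevH1.memLp_norm {u : M → ℝ} {G : ∀ x : M, TangentSpace (𝓡 n) x}
    (hu : IsSobolevH1 u G) : MemLp (fun x ↦ ‖G x‖) 2 (riemannianVolume n M) := by
  refine memLp_two_of_lintegral_lt_top ?_ ?_
  · exact AEStronglyMeasurable.comp_continuousOn_of_ae_mem
      (k := fun p : TangentBundle (𝓡 n) M ↦ ‖p.2‖) hu.aestronglyMeasurable isOpen_univ
      continuous_norm_tangentBundle.continuousOn (Eventually.of_forall fun _ ↦ mem_univ _)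
  · simpa only [enorm_norm] using hu.lintegral_lt_top

variable [IsRiemannianManifold (𝓡 n) M] [CompactSpace M]

/-- Approximations are chosen with summable squared L² errors. The sum of the squared error
functions is then integrable, hence finite almost everywhere: the errors tend to 0 pointwise and the
root E of the sum dominates all of them, as dominated convergence requires. -/
theorem exists_smooth_approximation_seq {u : M → ℝ} {G : ∀ x : M, TangentSpace (𝓡 n) x}
    (hu : IsSobolevH1 u G) :
    ∃ (f : ℕ → M → ℝ) (e : ℕ → M → ℝ) (E : M → ℝ), (∀ k, ContMDiff (𝓡 n) 𝓘(ℝ, ℝ) ∞ (f k)) ∧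
      (∀ k, AEMeasurable (e k) (riemannianVolume n M)) ∧
      MemLp E 2 (riemannianVolume n M) ∧
      ∀ᵐ x ∂(riemannianVolume n M), Tendsto (fun k ↦ e k x) atTop (𝓝 0) ∧
        ∀ k, 0 ≤ e k x ∧ e k x ≤ E x ∧ |f k x - u x| ≤ e k x ∧ ∀ v : TangentSpace (𝓡 n) x,
          |mvfderiv (𝓡 n) (f k) x v - inner ℝ (G x) v| ≤ e k x * ‖v‖ := by
  obtain ⟨δ, hδ0, hδ⟩ := ENNReal.exists_pos_sum_of_countable (ε := 1) one_ne_zero ℕ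
  choose f e hf hem he hfe using fun k ↦ exists_smooth_approximation hu (ε := (δ k : ℝ≥0∞))
    (by exact_mod_cast (hδ0 k).ne')
  set V := riemannianVolume n M
  set S : M → ℝ≥0∞ := fun x ↦ ∑' k, e k x ^ 2 with hS
  have hSm : AEMeasurable S V := AEMeasurable.tsum fun k ↦ (hem k).pow_const 2
  have hSi : ∫⁻ x, S x ∂V ≤ 1 := by
    rw [lintegral_tsum fun k ↦ (hem k).pow_const 2]
    exact (ENNReal.tsum_le_tsum he).trans hδ.le
  have hSfin := ae_lt_top' hSm (hSi.trans_lt ENNReal.one_lt_top).ne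
  refine ⟨f, fun k x ↦ (e k x).toReal, fun x ↦ √(S x).toReal, hf, fun k ↦ (hem k).ennreal_toReal,
    ?_, ?_⟩
  · refine memLp_two_of_lintegral_lt_top hSm.ennreal_toReal.sqrt.aestronglyMeasurable ?_
    refine (le_trans (lintegral_mono_ae ?_) hSi).trans_lt ENNReal.one_lt_top
    filter_upwards [hSfin] with x hx
    rw [Real.enorm_of_nonneg (Real.sqrt_nonneg _), ← ENNReal.ofReal_pow (Real.sqrt_nonneg _),
      Real.sq_sqrt ENNReal.toReal_nonneg]
    exact ENNReal.ofReal_toReal_le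
  · filter_upwards [hSfin, ae_all_iff.2 hfe] with x hx hfx
    have hle : ∀ k, e k x ^ 2 ≤ S x := fun k ↦ ENNReal.le_tsum k
    have hefin : ∀ k, e k x ≠ ⊤ := fun k h ↦ by
      have := (hle k).trans_lt hx
      simp [h] at this
    have hleR : ∀ k, (e k x).toReal ^ 2 ≤ (S x).toReal := fun k ↦ by
      rw [← ENNReal.toReal_pow]
      exact ENNReal.toReal_mono hx.ne (hle k)
    refine ⟨?_, fun k ↦ ⟨ENNReal.toReal_nonneg, Real.le_sqrt_of_sq_le (hleR k), ?_, fun v ↦ ?_⟩⟩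
    · have h1 := ENNReal.tendsto_atTop_zero_of_tsum_ne_top hx.ne
      have h2 := (ENNReal.tendsto_toReal ENNReal.zero_ne_top).comp h1
      have h3 := (Real.continuous_sqrt.tendsto _).comp h2
      simp only [ENNReal.toReal_zero, Real.sqrt_zero] at h3
      refine h3.congr fun k ↦ ?_
      simp only [Function.comp_apply, ENNReal.toReal_pow]
      exact Real.sqrt_sq ENNReal.toReal_nonneg
    · have := ENNReal.toReal_mono (hefin k) (hfx k).1
      simpa using this
    · have := ENNReal.toReal_mono (ENNReal.mul_ne_top (hefin k) enorm_ne_top) ((hfx k).2 v)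
      rw [ENNReal.toReal_mul, toReal_enorm, toReal_enorm, Real.norm_eq_abs] at this
      exact this

/-- Testing the equation with a smooth bounded function of the solution. -/
theorem integral_deriv_comp_mul_sq_norm_add {u : M → ℝ} {G : ∀ x : M, TangentSpace (𝓡 n) x}
    (hu : IsSobolevH1 u G) {g : M → ℝ} (hg : Integrable g (riemannianVolume n M)) {a b : ℝ}
    (h : ∀ φ : M → ℝ, ContMDiff (𝓡 n) 𝓘(ℝ, ℝ) ∞ φ →
      a * ∫ x, mvfderiv (𝓡 n) φ x (G x) ∂(riemannianVolume n M) +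
        b * ∫ x, g x * φ x ∂(riemannianVolume n M) = 0)
    {F : ℝ → ℝ} (hF : ContDiff ℝ ∞ F) {B : ℝ} (hB : ∀ s, |F s| ≤ B) (hB' : ∀ s, |deriv F s| ≤ B) :
    a * ∫ x, deriv F (u x) * ‖G x‖ ^ 2 ∂(riemannianVolume n M) +
        b * ∫ x, g x * F (u x) ∂(riemannianVolume n M) = 0 := by
  obtain ⟨f, e, E, hf, hem, hE, hae⟩ := exists_smooth_approximation_seq hu
  have hB0 : 0 ≤ B := (abs_nonneg _).trans (hB 0)
  have hF'c : Continuous (deriv F) := hF.continuous_deriv (by simp)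
  set V := riemannianVolume n M
  -- F(u) need not be smooth, so the equation is tested with F of the approximations.
  have hφ : ∀ k, ContMDiff (𝓡 n) 𝓘(ℝ, ℝ) ∞ fun x ↦ F (f k x) := fun k ↦
    hF.contMDiff.comp (hf k)
  have hfu : ∀ᵐ x ∂V, Tendsto (fun k ↦ f k x) atTop (𝓝 (u x)) := by
    filter_upwards [hae] with x hx
    exact tendsto_of_abs_sub_le hx.1 fun k ↦ (hx.2 k).2.2.1
  have t1 : Tendsto (fun k ↦ ∫ x, mvfderiv (𝓡 n) (fun y ↦ F (f k y)) x (G x) ∂V) atTop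
      (𝓝 (∫ x, deriv F (u x) * ‖G x‖ ^ 2 ∂V)) := by
    refine tendsto_integral_of_dominated_convergence (fun x ↦ B * ((‖G x‖ + E x) * ‖G x‖))
      (fun k ↦ aestronglyMeasurable_mvfderiv_apply hu.aestronglyMeasurable (hφ k)) ?_ (fun k ↦ ?_) ?_
    · exact ((hu.memLp_norm.add hE).integrable_mul hu.memLp_norm).const_mul B
    · filter_upwards [hae] with x hx
      obtain ⟨h0, h1, -, h3⟩ := hx.2 k
      have h4 := h3 (G x)
      have h5 : |inner ℝ (G x) (G x)| ≤ ‖G x‖ * ‖G x‖ := abs_real_inner_le_norm _ _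
      have h6 : |mvfderiv (𝓡 n) (f k) x (G x)| ≤ (‖G x‖ + E x) * ‖G x‖ := by
        have h7 := abs_add_le (mvfderiv (𝓡 n) (f k) x (G x) - inner ℝ (G x) (G x))
          (inner ℝ (G x) (G x))
        rw [sub_add_cancel] at h7
        have h8 : e k x * ‖G x‖ ≤ E x * ‖G x‖ := by gcongr
        linarith
      rw [mvfderiv_comp_smooth hF (hf k), smul_apply, smul_eq_mul, Real.norm_eq_abs, abs_mul]
      exact mul_le_mul (hB' _) h6 (abs_nonneg _) hB0
    · filter_upwards [hae, hfu] with x hx hx'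
      have h1 : Tendsto (fun k ↦ mvfderiv (𝓡 n) (f k) x (G x)) atTop (𝓝 (inner ℝ (G x) (G x))) := by
        refine tendsto_of_abs_sub_le (e := fun k ↦ e k x * ‖G x‖) ?_ fun k ↦ (hx.2 k).2.2.2 (G x)
        simpa using hx.1.mul_const ‖G x‖
      rw [real_inner_self_eq_norm_sq] at h1
      refine (((hF'c.tendsto _).comp hx').mul h1).congr fun k ↦ ?_
      rw [mvfderiv_comp_smooth hF (hf k)]
      rfl
  -- Since g is only integrable, the bound on F is what provides the dominating function.
  have t2 : Tendsto (fun k ↦ ∫ x, g x * F (f k x) ∂V) atTop (𝓝 (∫ x, g x * F (u x) ∂V)) := by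
    refine tendsto_integral_of_dominated_convergence (fun x ↦ ‖g x‖ * B)
      (fun k ↦ hg.1.mul (hφ k).continuous.aestronglyMeasurable) (hg.norm.mul_const B)
      (fun k ↦ ?_) ?_
    · refine Eventually.of_forall fun x ↦ ?_
      rw [norm_mul]
      exact mul_le_mul_of_nonneg_left (hB _) (norm_nonneg _)
    · filter_upwards [hfu] with x hx
      exact ((hF.continuous.tendsto _).comp hx).const_mul _
  have t3 := (t1.const_mul a).add (t2.const_mul b)
  refine tendsto_nhds_unique t3 ?_
  simp only [h _ (hφ _)]
  exact tendsto_const_nhds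

/-- Cheeger's inequality for smooth bounded functions of an `H¹` function. -/
theorem mul_crossVolume_comp_le {u : M → ℝ} {G : ∀ x : M, TangentSpace (𝓡 n) x}
    (hu : IsSobolevH1 u G) {c : ℝ≥0} (hc : c ≤ cheegerConstant n M)
    {F : ℝ → ℝ} (hF : ContDiff ℝ ∞ F) {B : ℝ} (hB : ∀ s, |F s| ≤ B) (hB' : ∀ s, |deriv F s| ≤ B) :
    c * crossVolume (riemannianVolume n M) (fun x ↦ F (u x)) ≤
      ∫⁻ x, ENNReal.ofReal (|deriv F (u x)| * ‖G x‖) ∂(riemannianVolume n M) := by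
  obtain ⟨f, e, E, hf, hem, hE, hae⟩ := exists_smooth_approximation_seq hu
  have hB0 : 0 ≤ B := (abs_nonneg _).trans (hB 0)
  have hF'c : Continuous (deriv F) := hF.continuous_deriv (by simp)
  have := isFiniteMeasure_riemannianVolume n M
  set V := riemannianVolume n M
  have hum : AEMeasurable u V := hu.memLp.1.aemeasurable
  have hqm : AEMeasurable (fun x ↦ ‖G x‖) V := hu.memLp_norm.1.aemeasurable
  have hfu : ∀ᵐ x ∂V, Tendsto (fun k ↦ f k x) atTop (𝓝 (u x)) := by
    filter_upwards [hae] with x hx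
    exact tendsto_of_abs_sub_le hx.1 fun k ↦ (hx.2 k).2.2.1
  -- By `crossVolume_le_add` this L¹ distance bounds the loss in passing from F(f k) to F(u).
  have t1 : Tendsto (fun k ↦ ∫⁻ x, ENNReal.ofReal |F (u x) - F (f k x)| ∂V) atTop (𝓝 0) := by
    have := tendsto_lintegral_of_dominated_convergence' (μ := V)
      (F := fun k x ↦ ENNReal.ofReal |F (u x) - F (f k x)|) (f := fun _ ↦ 0)
      (fun _ ↦ ENNReal.ofReal (2 * B)) (fun k ↦ ?_) (fun k ↦ ?_) ?_ ?_
    · simpa using this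
    · exact (((hF.continuous.measurable.comp_aemeasurable hum).sub
        (hF.continuous.comp (hf k).continuous).aemeasurable).abs).ennreal_ofReal
    · refine Eventually.of_forall fun x ↦ ENNReal.ofReal_le_ofReal ?_
      have := abs_sub (F (u x)) (F (f k x))
      linarith [hB (u x), hB (f k x)]
    · rw [lintegral_const]; finiteness
    · filter_upwards [hfu] with x hx
      have h1 := ((hF.continuous.tendsto _).comp hx).const_sub (F (u x))
      rw [sub_self] at h1
      have h2 := (ENNReal.continuous_ofReal.tendsto _).comp h1.abs
      simpa [Function.comp_def] using h2
  have t2 : Tendsto (fun k ↦ ∫⁻ x, ENNReal.ofReal (|deriv F (f k x)| * (‖G x‖ + e k x)) ∂V) atTop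
      (𝓝 (∫⁻ x, ENNReal.ofReal (|deriv F (u x)| * ‖G x‖) ∂V)) := by
    refine tendsto_lintegral_of_dominated_convergence'
      (fun x ↦ ENNReal.ofReal (B * (‖G x‖ + E x))) (fun k ↦ ?_) (fun k ↦ ?_) ?_ ?_
    · exact ((hF'c.comp (hf k).continuous).aemeasurable.abs.mul (hqm.add (hem k))).ennreal_ofReal
    · filter_upwards [hae] with x hx
      obtain ⟨h0, h1, -, -⟩ := hx.2 k
      refine ENNReal.ofReal_le_ofReal (mul_le_mul (hB' _) (by linarith) ?_ hB0)
      exact add_nonneg (norm_nonneg _) h0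
    · have h1 := ((hu.memLp_norm.add hE).integrable (by norm_num)).const_mul B
      exact h1.lintegral_lt_top.ne
    · filter_upwards [hae, hfu] with x hx hx'
      have h1 := ((hF'c.tendsto _).comp hx').abs.mul (hx.1.const_add ‖G x‖)
      rw [add_zero] at h1
      exact (ENNReal.continuous_ofReal.tendsto _).comp h1
  have t3 := t2.add (ENNReal.Tendsto.const_mul t1 (Or.inr (ENNReal.coe_ne_top (r := c))))
  rw [mul_zero, add_zero] at t3
  refine ge_of_tendsto' t3 fun k ↦ ?_
  have hφ : ContMDiff (𝓡 n) 𝓘(ℝ, ℝ) ∞ fun x ↦ F (f k x) := hF.contMDiff.comp (hf k)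
  calc c * crossVolume V (fun x ↦ F (u x))
      ≤ c * (crossVolume V (fun x ↦ F (f k x)) + ∫⁻ x, ENNReal.ofReal |F (u x) - F (f k x)| ∂V) := by
        gcongr
        exact crossVolume_le_add (hF.continuous.measurable.comp_aemeasurable hum)
          hφ.continuous.aemeasurable
    _ = c * crossVolume V (fun x ↦ F (f k x)) +
          c * ∫⁻ x, ENNReal.ofReal |F (u x) - F (f k x)| ∂V := mul_add _ _ _
    _ ≤ _ := by
        refine add_le_add ((mul_crossVolume_le hφ hc).trans (lintegral_mono_ae ?_)) le_rfl
        filter_upwards [hae] with x hx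
        obtain ⟨h0, -, -, h3⟩ := hx.2 k
        refine ENNReal.ofReal_le_ofReal ?_
        rw [mvfderiv_comp_smooth hF (hf k)]
        refine ContinuousLinearMap.opNorm_le_bound _ (by positivity) fun v ↦ ?_
        have h4 := h3 v
        have h5 : |inner ℝ (G x) v| ≤ ‖G x‖ * ‖v‖ := abs_real_inner_le_norm _ _
        have h7 := abs_add_le (mvfderiv (𝓡 n) (f k) x v - inner ℝ (G x) v) (inner ℝ (G x) v)
        rw [sub_add_cancel] at h7
        rw [smul_apply, smul_eq_mul, Real.norm_eq_abs, abs_mul, mul_assoc]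
        gcongr
        linarith

end Keys

/-! ### Smooth test functions of one variable. -/

section TestFunctions

theorem exists_abs_deriv_smoothTransition_le :
    ∃ B : ℝ, 1 ≤ B ∧ ∀ s, |deriv Real.smoothTransition s| ≤ B := by
  have hc : Continuous (deriv Real.smoothTransition) :=
    (Real.smoothTransition.contDiff (n := 1)).continuous_deriv le_rfl
  obtain ⟨B, hB⟩ := (isCompact_Icc (a := (0 : ℝ)) (b := 1)).exists_bound_of_continuousOn
    hc.continuousOn
  refine ⟨max B 1, le_max_right _ _, fun s ↦ ?_⟩
  rcases lt_or_ge s 0 with h0 | h0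
  · have : Real.smoothTransition =ᶠ[𝓝 s] fun _ ↦ 0 := by
      filter_upwards [gt_mem_nhds h0] with t ht
      exact Real.smoothTransition.zero_of_nonpos (le_of_lt ht)
    rw [this.deriv_eq]; simp
  rcases lt_or_ge 1 s with h1 | h1
  · have : Real.smoothTransition =ᶠ[𝓝 s] fun _ ↦ 1 := by
      filter_upwards [lt_mem_nhds h1] with t ht
      exact Real.smoothTransition.one_of_one_le (le_of_lt ht)
    rw [this.deriv_eq]; simp
  exact (hB s ⟨h0, h1⟩).trans (le_max_left _ _)

/-- A smooth function agrees near `[-1, 1]` with a bounded one with bounded derivative. -/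
theorem exists_bounded_eventuallyEq {F : ℝ → ℝ} (hF : ContDiff ℝ ∞ F) :
    ∃ (F₁ : ℝ → ℝ) (B : ℝ), ContDiff ℝ ∞ F₁ ∧ (∀ s, |F₁ s| ≤ B) ∧ (∀ s, |deriv F₁ s| ≤ B) ∧
      ∀ s, |s| ≤ 1 → F₁ s = F s ∧ deriv F₁ s = deriv F s := by
  let χ : ContDiffBump (0 : ℝ) := ⟨2, 3, by norm_num, by norm_num⟩
  have hs : ContDiff ℝ ∞ fun s ↦ χ s * F s := χ.contDiff.mul hF
  have hc : HasCompactSupport fun s ↦ χ s * F s := χ.hasCompactSupport.mul_right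
  obtain ⟨B₁, h1⟩ := hs.continuous.bounded_above_of_compact_support hc
  obtain ⟨B₂, h2⟩ := (hs.continuous_deriv (by simp)).bounded_above_of_compact_support hc.deriv
  refine ⟨_, max B₁ B₂, hs, fun s ↦ (h1 s).trans (le_max_left _ _),
    fun s ↦ (h2 s).trans (le_max_right _ _), fun s hs' ↦ ?_⟩
  have : (fun s ↦ χ s * F s) =ᶠ[𝓝 s] F := by
    have : Metric.ball (0 : ℝ) 2 ∈ 𝓝 s := Metric.isOpen_ball.mem_nhds (by
      rw [mem_ball_zero_iff, Real.norm_eq_abs]; linarith)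
    filter_upwards [this] with t ht
    rw [χ.one_of_mem_closedBall (Metric.ball_subset_closedBall ht), one_mul]
  exact ⟨this.eq_of_nhds, this.deriv_eq⟩

theorem contDiff_infty_primitive {k : ℝ → ℝ} (hk : ContDiff ℝ ∞ k) (a : ℝ) :
    ContDiff ℝ ∞ (fun s ↦ ∫ t in a..s, k t) ∧ deriv (fun s ↦ ∫ t in a..s, k t) = k := by
  have hd : ∀ s, HasDerivAt (fun s ↦ ∫ t in a..s, k t) (k s) s := fun s ↦
    hk.continuous.integral_hasStrictDerivAt a s |>.hasDerivAt
  have he : deriv (fun s ↦ ∫ t in a..s, k t) = k := funext fun s ↦ (hd s).deriv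
  exact ⟨contDiff_infty_iff_deriv.2 ⟨fun s ↦ (hd s).differentiableAt, by rwa [he]⟩, he⟩

/-- A smooth approximation of `s ↦ (s - γ)⁺`. -/
theorem exists_smooth_positive_part (γ : ℝ) {δ : ℝ} (hδ : 0 < δ) :
    ∃ K F : ℝ → ℝ, ContDiff ℝ ∞ K ∧ ContDiff ℝ ∞ F ∧ (∀ s, deriv F s = deriv K s ^ 2) ∧
      (∀ s, s ≤ γ → K s = 0 ∧ F s = 0) ∧
      ∀ s, γ ≤ s → 0 ≤ F s ∧ F s ≤ s - γ ∧ 0 ≤ K s ∧ s - γ - δ ≤ K s := by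
  -- K and F are the primitives from γ of k and of k². The relation F' = (K')² makes the gradient
  -- term of the equation tested with F(u) equal to the Dirichlet integral of K(u).
  set k : ℝ → ℝ := fun s ↦ Real.smoothTransition ((s - γ) / δ) with hk
  have hks : ContDiff ℝ ∞ k :=
    Real.smoothTransition.contDiff.comp ((contDiff_id.sub contDiff_const).div_const _)
  have hk2s : ContDiff ℝ ∞ fun s ↦ k s ^ 2 := hks.pow 2
  have hk0 : ∀ s, 0 ≤ k s := fun s ↦ Real.smoothTransition.nonneg _
  have hk1 : ∀ s, k s ≤ 1 := fun s ↦ Real.smoothTransition.le_one _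
  have hkz : ∀ s, s ≤ γ → k s = 0 := fun s hs ↦ Real.smoothTransition.zero_of_nonpos
    (div_nonpos_of_nonpos_of_nonneg (by linarith) hδ.le)
  have hko : ∀ s, γ + δ ≤ s → k s = 1 := fun s hs ↦ Real.smoothTransition.one_of_one_le
    ((one_le_div hδ).2 (by linarith))
  obtain ⟨hK, hK'⟩ := contDiff_infty_primitive hks γ
  obtain ⟨hF, hF'⟩ := contDiff_infty_primitive hk2s γ
  have hki : ∀ a b, IntervalIntegrable k volume a b := fun a b ↦ hks.continuous.intervalIntegrable a b
  refine ⟨_, _, hK, hF, fun s ↦ by rw [hK', hF'],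
    fun s hs ↦ ?_, fun s hs ↦ ?_⟩
  · have hz : ∀ t ∈ uIcc γ s, k t = 0 := fun t ht ↦ by
      rw [uIcc_of_ge hs] at ht; exact hkz t ht.2
    constructor
    · rw [intervalIntegral.integral_congr (g := fun _ ↦ 0) hz]; simp
    · rw [intervalIntegral.integral_congr (g := fun _ ↦ 0) fun t ht ↦ by simp [hz t ht]]; simp
  · have hKn : ∀ a b, a ≤ b → 0 ≤ ∫ t in a..b, k t := fun a b hab ↦
      intervalIntegral.integral_nonneg hab fun t _ ↦ hk0 t
    refine ⟨intervalIntegral.integral_nonneg hs fun t _ ↦ sq_nonneg _, ?_, hKn _ _ hs, ?_⟩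
    · calc ∫ t in γ..s, k t ^ 2 ≤ ∫ _ in γ..s, (1 : ℝ) :=
            intervalIntegral.integral_mono_on hs (hk2s.continuous.intervalIntegrable _ _)
              (by simp) fun t _ ↦ pow_le_one₀ (hk0 t) (hk1 t)
        _ = s - γ := by simp
    · rcases le_total s (γ + δ) with h | h
      · linarith [hKn γ s hs]
      · have h1 := intervalIntegral.integral_add_adjacent_intervals (hki γ (γ + δ)) (hki (γ + δ) s)
        have h2 : ∫ t in (γ + δ)..s, k t = s - (γ + δ) := by
          rw [intervalIntegral.integral_congr (g := fun _ ↦ (1 : ℝ)) fun t ht ↦ ?_]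
          · simp
          · rw [uIcc_of_le h] at ht; exact hko t ht.1
        linarith [hKn γ (γ + δ) (by linarith)]

end TestFunctions

/-! ### The abstract problem: bounds and a Poincaré inequality. -/

section Rigidity

/-- The sign conditions, with constant `C`, satisfied by the derivative of a double-well
potential. -/
structure IsBistable (v : ℝ → ℝ) (γ C : ℝ) : Prop where
  continuous : Continuous v
  gamma_mem : γ ∈ Ioo (-1 : ℝ) 1
  pos_of_one_lt : ∀ s, 1 < s → 0 < v s
  neg_of_lt_neg_one : ∀ s, s < -1 → v s < 0
  neg_of_mem : ∀ s ∈ Ioo γ 1, v s < 0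
  pos_of_mem : ∀ s ∈ Ioo (-1) γ, 0 < v s
  apply_neg_one : v (-1) = 0
  apply_gamma : v γ = 0
  apply_one : v 1 = 0
  neg_le : ∀ s ∈ Icc γ 1, -v s ≤ C * (s - γ)
  le_mul : ∀ s ∈ Icc (-1) γ, v s ≤ C * (γ - s)

/-- The reflection u ↦ -u exchanges the wells, and with them the cases in which {u > γ} or its
complement is the smaller set. -/
theorem IsBistable.reflect {v : ℝ → ℝ} {γ C : ℝ} (h : IsBistable v γ C) :
    IsBistable (fun s ↦ -v (-s)) (-γ) C where
  continuous := (h.continuous.comp continuous_neg).neg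
  gamma_mem := ⟨by linarith [h.gamma_mem.2], by linarith [h.gamma_mem.1]⟩
  pos_of_one_lt s hs := neg_pos.2 (h.neg_of_lt_neg_one _ (by linarith))
  neg_of_lt_neg_one s hs := neg_neg_of_pos (h.pos_of_one_lt _ (by linarith))
  neg_of_mem s hs := neg_neg_of_pos (h.pos_of_mem _ ⟨by linarith [hs.2], by linarith [hs.1]⟩)
  pos_of_mem s hs := neg_pos.2 (h.neg_of_mem _ ⟨by linarith [hs.2], by linarith [hs.1]⟩)
  apply_neg_one := by simp [h.apply_one]
  apply_gamma := by simp [h.apply_gamma]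
  apply_one := by simp [h.apply_neg_one]
  neg_le s hs := by
    have := h.le_mul (-s) ⟨by linarith [hs.2], by linarith [hs.1]⟩
    rw [neg_neg]; exact this.trans_eq (by ring)
  le_mul s hs := by
    have := h.neg_le (-s) ⟨by linarith [hs.2], by linarith [hs.1]⟩
    exact this.trans_eq (by ring)

variable {X : Type*} [MeasurableSpace X] {μ : Measure X}

/-- `u` satisfies the equation `-a Δu + b v(u) = 0`, tested with functions of `u`, and Cheeger's
inequality with constant `c`; here `q` plays the role of `|∇u|`. -/
structure IsTestedSolution (μ : Measure X) (u q : X → ℝ) (v : ℝ → ℝ) (a b : ℝ) (c : ℝ≥0) :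
    Prop where
  aemeasurable : AEMeasurable u μ
  memLp : MemLp q 2 μ
  nonneg : ∀ x, 0 ≤ q x
  integrable : Integrable (fun x ↦ v (u x)) μ
  equation : ∀ (F : ℝ → ℝ) (B : ℝ), ContDiff ℝ ∞ F → (∀ s, |F s| ≤ B) → (∀ s, |deriv F s| ≤ B) →
    a * ∫ x, deriv F (u x) * q x ^ 2 ∂μ + b * ∫ x, v (u x) * F (u x) ∂μ = 0
  cheeger : ∀ (F : ℝ → ℝ) (B : ℝ), ContDiff ℝ ∞ F → (∀ s, |F s| ≤ B) → (∀ s, |deriv F s| ≤ B) →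
    c * crossVolume μ (fun x ↦ F (u x)) ≤ ∫⁻ x, ENNReal.ofReal (|deriv F (u x)| * q x) ∂μ

namespace IsTestedSolution

variable {u q : X → ℝ} {v : ℝ → ℝ} {a b γ C : ℝ} {c : ℝ≥0}

theorem reflect (h : IsTestedSolution μ u q v a b c) :
    IsTestedSolution μ (fun x ↦ -u x) q (fun s ↦ -v (-s)) a b c where
  aemeasurable := h.aemeasurable.neg
  memLp := h.memLp
  nonneg := h.nonneg
  integrable := by simpa using h.integrable.neg
  equation F B hF hB hB' := by
    have hd : ∀ s, deriv (fun s ↦ -F (-s)) s = deriv F (-s) := fun s ↦ by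
      rw [deriv.fun_neg, deriv_comp_neg, neg_neg]
    have := h.equation (fun s ↦ -F (-s)) B (hF.comp contDiff_neg).neg
      (fun s ↦ by rw [abs_neg]; exact hB _) (fun s ↦ by rw [hd]; exact hB' _)
    simp only [hd] at this
    simpa using this
  cheeger F B hF hB hB' := by
    have hd : ∀ s, deriv (fun s ↦ F (-s)) s = -deriv F (-s) := fun s ↦ deriv_comp_neg _ _
    have := h.cheeger (fun s ↦ F (-s)) B (hF.comp contDiff_neg)
      (fun s ↦ hB _) (fun s ↦ by rw [hd, abs_neg]; exact hB' _)
    simpa only [hd, abs_neg] using this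

/-- Maximum principle: the test function F is increasing, zero up to 1 and positive beyond. Both
terms of the equation are nonnegative, so `v (u x) * F (u x)` vanishes almost everywhere, which
fails wherever u > 1. -/
theorem ae_le_one (h : IsTestedSolution μ u q v a b c) (ha : 0 < a) (hb : 0 < b)
    (hv : ∀ s, 1 < s → 0 < v s) : ∀ᵐ x ∂μ, u x ≤ 1 := by
  obtain ⟨B, hB1, hB⟩ := exists_abs_deriv_smoothTransition_le
  set F : ℝ → ℝ := fun s ↦ Real.smoothTransition (s - 1) with hF
  have hFs : ContDiff ℝ ∞ F := Real.smoothTransition.contDiff.comp (contDiff_id.sub contDiff_const)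
  have hd : ∀ s, deriv F s = deriv Real.smoothTransition (s - 1) := fun s ↦ deriv_comp_sub_const _ _ _
  have hF0 : ∀ s, 0 ≤ F s := fun s ↦ Real.smoothTransition.nonneg _
  have hF1 : ∀ s, F s ≤ 1 := fun s ↦ Real.smoothTransition.le_one _
  have hd0 : ∀ s, 0 ≤ deriv F s := fun s ↦ by
    rw [hd]; exact Real.smoothTransition.monotone.deriv_nonneg
  have key := h.equation F B hFs (fun s ↦ by rw [abs_of_nonneg (hF0 s)]; exact (hF1 s).trans hB1)
    (fun s ↦ by rw [hd]; exact hB _)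
  have hvF : ∀ s, 0 ≤ v s * F s := fun s ↦ by
    rcases le_or_gt s 1 with hs | hs
    · have : F s = 0 := Real.smoothTransition.zero_of_nonpos (by linarith)
      rw [this, mul_zero]
    · exact mul_nonneg (hv s hs).le (hF0 s)
  have h1 : 0 ≤ ∫ x, deriv F (u x) * q x ^ 2 ∂μ :=
    integral_nonneg fun x ↦ mul_nonneg (hd0 _) (sq_nonneg _)
  have h2 : 0 ≤ ∫ x, v (u x) * F (u x) ∂μ := integral_nonneg fun x ↦ hvF _
  have h3 : ∫ x, v (u x) * F (u x) ∂μ = 0 := by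
    have := mul_nonneg ha.le h1
    have h4 : b * ∫ x, v (u x) * F (u x) ∂μ ≤ 0 := by linarith
    exact le_antisymm (nonpos_of_mul_nonpos_right h4 hb) h2
  have hi : Integrable (fun x ↦ v (u x) * F (u x)) μ :=
    h.integrable.mul_bdd (c := 1)
      (hFs.continuous.measurable.comp_aemeasurable h.aemeasurable).aestronglyMeasurable
      (Eventually.of_forall fun x ↦ by
        rw [Real.norm_eq_abs, abs_of_nonneg (hF0 _)]; exact hF1 _)
  rw [integral_eq_zero_iff_of_nonneg (fun x ↦ hvF _) hi] at h3
  filter_upwards [h3] with x hx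
  by_contra! hlt
  exact (mul_pos (hv _ hlt) (Real.smoothTransition.pos_of_pos (by linarith))).ne' hx

theorem ae_abs_le_one (h : IsTestedSolution μ u q v a b c) (ha : 0 < a) (hb : 0 < b)
    (hv : IsBistable v γ C) : ∀ᵐ x ∂μ, |u x| ≤ 1 := by
  filter_upwards [h.ae_le_one ha hb hv.pos_of_one_lt,
    h.reflect.ae_le_one ha hb hv.reflect.pos_of_one_lt] with x h1 h2
  exact abs_le.2 ⟨by linarith, h1⟩

/-- Once |u| ≤ 1, only the values of F near [-1, 1] matter, and the bounds on F and its derivative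
can be dropped. -/
theorem equation_of_contDiff (h : IsTestedSolution μ u q v a b c) (hu : ∀ᵐ x ∂μ, |u x| ≤ 1)
    {F : ℝ → ℝ} (hF : ContDiff ℝ ∞ F) :
    a * ∫ x, deriv F (u x) * q x ^ 2 ∂μ + b * ∫ x, v (u x) * F (u x) ∂μ = 0 := by
  obtain ⟨F₁, B, h1, h2, h3, h4⟩ := exists_bounded_eventuallyEq hF
  rw [← h.equation F₁ B h1 h2 h3]
  congr 2 <;> refine integral_congr_ae ?_ <;> filter_upwards [hu] with x hx
  · simp only [(h4 _ hx).2]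
  · simp only [(h4 _ hx).1]

theorem cheeger_of_contDiff (h : IsTestedSolution μ u q v a b c) (hu : ∀ᵐ x ∂μ, |u x| ≤ 1)
    {F : ℝ → ℝ} (hF : ContDiff ℝ ∞ F) :
    c * crossVolume μ (fun x ↦ F (u x)) ≤ ∫⁻ x, ENNReal.ofReal (|deriv F (u x)| * q x) ∂μ := by
  obtain ⟨F₁, B, h1, h2, h3, h4⟩ := exists_bounded_eventuallyEq hF
  convert h.cheeger F₁ B h1 h2 h3 using 1
  · congr 1
    refine crossVolume_congr_ae ?_
    filter_upwards [hu] with x hx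
    rw [(h4 _ hx).1]
  · refine lintegral_congr_ae ?_
    filter_upwards [hu] with x hx
    rw [(h4 _ hx).2]

end IsTestedSolution

/-- For t > 0 the smaller of the two sets is {w > t}, because it lies in {w > 0} while {w < t}
contains {w ≤ 0}. The layer cake formula gives the rest. -/
theorem lintegral_le_crossVolume [IsFiniteMeasure μ] {w : X → ℝ} (hw : AEMeasurable w μ)
    (h0 : ∀ᵐ x ∂μ, 0 ≤ w x) (hμ : μ {x | 0 < w x} ≤ μ {x | w x ≤ 0}) :
    ∫⁻ x, ENNReal.ofReal (w x) ∂μ ≤ crossVolume μ w := by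
  rw [lintegral_eq_lintegral_meas_lt μ h0 hw, crossVolume]
  refine (setLIntegral_mono' (g := fun t ↦ min (μ {x | t < w x}) (μ {x | w x < t}))
    measurableSet_Ioi fun t ht ↦ ?_).trans (setLIntegral_le_lintegral _ _)
  have ht : 0 < t := ht
  refine le_min le_rfl ?_
  calc μ {x | t < w x} ≤ μ {x | 0 < w x} := measure_mono fun x hx ↦ ht.trans hx
    _ ≤ μ {x | w x ≤ 0} := hμ
    _ ≤ μ {x | w x < t} := measure_mono fun x hx ↦ lt_of_le_of_lt hx ht

namespace IsTestedSolution

variable {u q : X → ℝ} {v : ℝ → ℝ} {a b γ C : ℝ} {c : ℝ≥0}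

/-- The Poincaré type inequality that follows from Cheeger's inequality. -/
theorem sq_mul_lintegral_sq_le [IsFiniteMeasure μ] (h : IsTestedSolution μ u q v a b c)
    (hu : ∀ᵐ x ∂μ, |u x| ≤ 1) (hμ : μ {x | γ < u x} ≤ μ {x | u x ≤ γ}) {K : ℝ → ℝ}
    (hK : ContDiff ℝ ∞ K) (hK0 : ∀ s, s ≤ γ → K s = 0) :
    (c : ℝ≥0∞) ^ 2 * ∫⁻ x, ENNReal.ofReal (K (u x) ^ 2) ∂μ ≤
      4 * ∫⁻ x, ENNReal.ofReal (deriv K (u x) ^ 2 * q x ^ 2) ∂μ := by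
  have hum := h.aemeasurable
  have hK'c : Continuous (deriv K) := hK.continuous_deriv (by simp)
  have hKm : AEMeasurable (fun x ↦ K (u x)) μ := hK.continuous.measurable.comp_aemeasurable hum
  have hK'm : AEMeasurable (fun x ↦ deriv K (u x)) μ := hK'c.measurable.comp_aemeasurable hum
  set I := ∫⁻ x, ENNReal.ofReal (K (u x) ^ 2) ∂μ with hI
  set J := ∫⁻ x, ENNReal.ofReal (deriv K (u x) ^ 2 * q x ^ 2) ∂μ with hJ
  have hIfin : I ≠ ⊤ := by
    obtain ⟨B, hB⟩ := (isCompact_Icc (a := (-1 : ℝ)) (b := 1)).exists_bound_of_continuousOn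
      (hK.pow 2).continuous.continuousOn
    refine ((lintegral_mono_ae (g := fun _ ↦ ENNReal.ofReal B) ?_).trans_lt ?_).ne
    · filter_upwards [hu] with x hx
      exact ENNReal.ofReal_le_ofReal ((le_abs_self _).trans (hB _ (abs_le.1 hx)))
    · rw [lintegral_const]; finiteness
  -- K(u)² is positive only where u > γ, which is at most half of the space.
  have h1 : I ≤ crossVolume μ (fun x ↦ K (u x) ^ 2) := by
    refine lintegral_le_crossVolume (hKm.pow_const 2) (Eventually.of_forall fun _ ↦ sq_nonneg _) ?_
    calc μ {x | 0 < K (u x) ^ 2} ≤ μ {x | γ < u x} := by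
          refine measure_mono fun x hx ↦ ?_
          by_contra! hle
          have hx : 0 < K (u x) ^ 2 := hx
          rw [hK0 _ (not_lt.1 hle)] at hx
          simp at hx
      _ ≤ μ {x | u x ≤ γ} := hμ
      _ ≤ _ := measure_mono fun x hx ↦ by
          change K (u x) ^ 2 ≤ 0
          rw [hK0 _ hx]; simp
  have hd : ∀ s, deriv (fun s ↦ K s ^ 2) s = 2 * K s * deriv K s := fun s ↦ by
    have := ((hK.differentiable (by simp)) s).hasDerivAt.pow 2
    exact this.deriv.trans (by norm_num)
  have h2 := h.cheeger_of_contDiff hu (hK.pow 2)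
  simp only [hd] at h2
  have h3 : ∫⁻ x, ENNReal.ofReal (|2 * K (u x) * deriv K (u x)| * q x) ∂μ =
      2 * ∫⁻ x, ENNReal.ofReal |K (u x)| * ENNReal.ofReal (|deriv K (u x)| * q x) ∂μ := by
    rw [← lintegral_const_mul' _ _ (by simp)]
    refine lintegral_congr fun x ↦ ?_
    rw [← ENNReal.ofReal_mul (abs_nonneg _), ← ENNReal.ofReal_ofNat 2, ← ENNReal.ofReal_mul (by norm_num),
      abs_mul, abs_mul, abs_two]
    ring_nf
  have h4 := sq_lintegral_mul_le hKm.abs.ennreal_ofReal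
    ((hK'm.abs.mul h.memLp.1.aemeasurable).ennreal_ofReal)
  have h5 : ∀ x, ENNReal.ofReal |K (u x)| ^ 2 = ENNReal.ofReal (K (u x) ^ 2) := fun x ↦ by
    rw [← ENNReal.ofReal_pow (abs_nonneg _), sq_abs]
  have h6 : ∀ x, ENNReal.ofReal (|deriv K (u x)| * q x) ^ 2 =
      ENNReal.ofReal (deriv K (u x) ^ 2 * q x ^ 2) := fun x ↦ by
    rw [← ENNReal.ofReal_pow (mul_nonneg (abs_nonneg _) (h.nonneg x)), mul_pow, sq_abs]
  simp only [Pi.mul_apply, h5, h6] at h4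
  have h7 : c * I ≤ 2 * ∫⁻ x, ENNReal.ofReal |K (u x)| * ENNReal.ofReal (|deriv K (u x)| * q x) ∂μ := by
    rw [← h3]; exact (mul_le_mul' le_rfl h1).trans h2
  -- Cheeger's inequality for K(u)² and Cauchy–Schwarz give (c I)² ≤ 4 I J; the finite factor I is
  -- then cancelled.
  have h8 : I * (c ^ 2 * I) ≤ I * (4 * J) := by
    calc I * (c ^ 2 * I) = (c * I) ^ 2 := by ring
      _ ≤ (2 * ∫⁻ x, ENNReal.ofReal |K (u x)| * ENNReal.ofReal (|deriv K (u x)| * q x) ∂μ) ^ 2 := by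
          gcongr
      _ ≤ 2 ^ 2 * (I * J) := by rw [mul_pow]; exact mul_le_mul' le_rfl h4
      _ = I * (4 * J) := by ring
  by_cases hI0 : I = 0
  · rw [hI0]; simp
  · exact (ENNReal.mul_le_mul_iff_right hI0 hIfin).1 h8

end IsTestedSolution

end Rigidity

/-! ### The abstract problem: solutions are constant. -/

section RigidityConclusion

variable {X : Type*} [MeasurableSpace X] {μ : Measure X}

namespace IsTestedSolution

variable {u q : X → ℝ} {v : ℝ → ℝ} {a b γ C : ℝ} {c : ℝ≥0}

theorem integrable_comp [IsFiniteMeasure μ] (h : IsTestedSolution μ u q v a b c)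
    (hu : ∀ᵐ x ∂μ, |u x| ≤ 1) {g : ℝ → ℝ} (hg : Continuous g) :
    Integrable (fun x ↦ g (u x)) μ := by
  obtain ⟨B, hB⟩ := (isCompact_Icc (a := (-1 : ℝ)) (b := 1)).exists_bound_of_continuousOn
    hg.continuousOn
  refine Integrable.of_bound (hg.measurable.comp_aemeasurable h.aemeasurable).aestronglyMeasurable
    B ?_
  filter_upwards [hu] with x hx using hB _ (abs_le.1 hx)

theorem integrable_comp_mul_sq (h : IsTestedSolution μ u q v a b c)
    (hu : ∀ᵐ x ∂μ, |u x| ≤ 1) {g : ℝ → ℝ} (hg : Continuous g) :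
    Integrable (fun x ↦ g (u x) * q x ^ 2) μ := by
  obtain ⟨B, hB⟩ := (isCompact_Icc (a := (-1 : ℝ)) (b := 1)).exists_bound_of_continuousOn
    hg.continuousOn
  refine h.memLp.integrable_sq.bdd_mul
    (hg.measurable.comp_aemeasurable h.aemeasurable).aestronglyMeasurable (c := B) ?_
  filter_upwards [hu] with x hx using hB _ (abs_le.1 hx)

/-- Let A be the integral of ((u - γ)⁺)². The equation bounds a times the Dirichlet integral of K(u)
by `b * C * A`, and the Poincaré inequality bounds c² ∫ K(u)² by four times that Dirichlet integral.
As δ → 0 this becomes `c ^ 2 * a * A ≤ 4 * b * C * A`, and `hc` forces A = 0. -/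
theorem ae_le_gamma [IsFiniteMeasure μ] (h : IsTestedSolution μ u q v a b c) (ha : 0 < a)
    (hb : 0 < b) (hv : IsBistable v γ C) (hu : ∀ᵐ x ∂μ, |u x| ≤ 1) (hc : 4 * b * C < c ^ 2 * a)
    (hμ : μ {x | γ < u x} ≤ μ {x | u x ≤ γ}) : ∀ᵐ x ∂μ, u x ≤ γ := by
  have hγ := hv.gamma_mem
  set P : ℝ → ℝ := fun s ↦ max (s - γ) 0 ^ 2 with hP
  have hPc : Continuous P := by fun_prop
  have hPi := h.integrable_comp hu hPc
  set A := ∫ x, P (u x) ∂μ with hA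
  set m := μ.real univ with hm
  have key : ∀ δ : ℝ, 0 < δ → c ^ 2 * a * (A - 4 * δ * m) ≤ 4 * b * C * A := by
    intro δ hδ
    obtain ⟨K, F, hK, hF, hFK, hz, hp⟩ := exists_smooth_positive_part γ hδ
    have hKi : Integrable (fun x ↦ K (u x) ^ 2) μ := h.integrable_comp hu (hK.continuous.pow 2)
    have hK'i : Integrable (fun x ↦ deriv K (u x) ^ 2 * q x ^ 2) μ := 
      h.integrable_comp_mul_sq hu ((hK.continuous_deriv (by simp)).pow 2)
    have h1 := h.sq_mul_lintegral_sq_le hu hμ hK fun s hs ↦ (hz s hs).1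
    rw [← ofReal_integral_eq_lintegral_ofReal hKi (Eventually.of_forall fun _ ↦ sq_nonneg _),
      ← ofReal_integral_eq_lintegral_ofReal hK'i
        (Eventually.of_forall fun _ ↦ mul_nonneg (sq_nonneg _) (sq_nonneg _)),
      ← ENNReal.ofReal_coe_nnreal, ← ENNReal.ofReal_pow (NNReal.coe_nonneg c), ← ENNReal.ofReal_mul (by positivity),
      ← ENNReal.ofReal_ofNat 4, ← ENNReal.ofReal_mul (by norm_num),
      ENNReal.ofReal_le_ofReal_iff (mul_nonneg (by norm_num) (integral_nonneg fun _ ↦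
        mul_nonneg (sq_nonneg _) (sq_nonneg _)))] at h1
    have h2 := h.equation_of_contDiff hu hF
    simp only [hFK] at h2
    have h3 : -∫ x, v (u x) * F (u x) ∂μ ≤ C * A := by
      rw [← integral_neg, hA, ← integral_const_mul]
      refine integral_mono_ae (h.integrable_comp hu (hv.continuous.mul hF.continuous)).neg
        (hPi.const_mul C) ?_
      filter_upwards [hu] with x hx
      change -(v (u x) * F (u x)) ≤ C * P (u x)
      rcases le_total (u x) γ with hle | hge
      · rw [(hz _ hle).2]
        simp [hP, hle]
      · obtain ⟨p1, p2, -, -⟩ := hp _ hge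
        have hx1 := (abs_le.1 hx).2
        have hv1 := hv.neg_le _ ⟨hge, hx1⟩
        have hv0 : 0 ≤ -v (u x) := by
          rcases hge.eq_or_lt with he | hlt
          · rw [← he, hv.apply_gamma, neg_zero]
          rcases hx1.eq_or_lt with he | hlt'
          · rw [he, hv.apply_one, neg_zero]
          exact (neg_pos.2 (hv.neg_of_mem _ ⟨hlt, hlt'⟩)).le
        have hPx : P (u x) = (u x - γ) * (u x - γ) := by
          simp only [hP]; rw [max_eq_left (by linarith), sq]
        rw [hPx]
        calc -(v (u x) * F (u x)) = -v (u x) * F (u x) := by ring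
          _ ≤ -v (u x) * (u x - γ) := mul_le_mul_of_nonneg_left p2 hv0
          _ ≤ C * (u x - γ) * (u x - γ) := mul_le_mul_of_nonneg_right hv1 (by linarith)
          _ = _ := by ring
    -- With w = u - γ ≤ 2 one has (w - δ)² ≥ w² - 4δ, and for w ≤ δ the right side is not positive.
    have h4 : A - 4 * δ * m ≤ ∫ x, K (u x) ^ 2 ∂μ := by
      have h5 : A - 4 * δ * m = ∫ x, (P (u x) - 4 * δ) ∂μ := by
        rw [integral_sub hPi (integrable_const _), integral_const, smul_eq_mul]; ring
      rw [h5]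
      refine integral_mono_ae (hPi.sub (integrable_const _)) hKi ?_
      filter_upwards [hu] with x hx
      change P (u x) - 4 * δ ≤ K (u x) ^ 2
      rcases le_total (u x) γ with hle | hge
      · have : P (u x) = 0 := by simp [hP, hle]
        rw [this, (hz _ hle).1]
        linarith
      · obtain ⟨-, -, p3, p4⟩ := hp _ hge
        have hPx : P (u x) = (u x - γ) ^ 2 := by
          simp only [hP]; rw [max_eq_left (by linarith)]
        rw [hPx]
        have hw2 : u x - γ ≤ 2 := by linarith [(abs_le.1 hx).2, hγ.1]
        rcases le_total δ (u x - γ) with hd | hd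
        · have : (u x - γ - δ) ^ 2 ≤ K (u x) ^ 2 := pow_le_pow_left₀ (by linarith) p4 2
          nlinarith
        · nlinarith [sq_nonneg (K (u x))]
    have h6 : a * ∫ x, deriv K (u x) ^ 2 * q x ^ 2 ∂μ ≤ b * (C * A) := by
      have := mul_le_mul_of_nonneg_left h3 hb.le
      linarith
    calc c ^ 2 * a * (A - 4 * δ * m) ≤ c ^ 2 * a * ∫ x, K (u x) ^ 2 ∂μ := by gcongr
      _ = a * (c ^ 2 * ∫ x, K (u x) ^ 2 ∂μ) := by ring
      _ ≤ a * (4 * ∫ x, deriv K (u x) ^ 2 * q x ^ 2 ∂μ) := by gcongr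
      _ = 4 * (a * ∫ x, deriv K (u x) ^ 2 * q x ^ 2 ∂μ) := by ring
      _ ≤ 4 * (b * (C * A)) := by gcongr
      _ = _ := by ring
  have hA0 : 0 ≤ A := integral_nonneg fun x ↦ sq_nonneg _
  have hAz : A = 0 := by
    refine le_antisymm ?_ hA0
    by_contra! hpos
    have hm0 : 0 ≤ m := measureReal_nonneg
    set D := c ^ 2 * a - 4 * b * C with hD
    have hDpos : 0 < D := by linarith
    have hE : 0 ≤ (c : ℝ) ^ 2 * a := by positivity
    -- This δ makes the error term at most half of `D * A`; the added 1 covers m = 0.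
    have h1 := key (D * A / (8 * (c ^ 2 * a * m + 1))) (by positivity)
    have h2 : (c : ℝ) ^ 2 * a * (4 * (D * A / (8 * (c ^ 2 * a * m + 1))) * m) ≤ D * A / 2 := by
      have h3 : (c : ℝ) ^ 2 * a * m ≤ c ^ 2 * a * m + 1 := by linarith
      have h4 : (c : ℝ) ^ 2 * a * (4 * (D * A / (8 * (c ^ 2 * a * m + 1))) * m) =
          D * A / 2 * (c ^ 2 * a * m / (c ^ 2 * a * m + 1)) := by
        field_simp
        ring
      rw [h4]
      refine mul_le_of_le_one_right (by positivity) ?_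
      exact (div_le_one (by positivity)).2 h3
    have h5 : 0 < D * A := by positivity
    have h6 : D * A = c ^ 2 * a * A - 4 * b * C * A := by rw [hD]; ring
    rw [mul_sub] at h1
    linarith
  rw [hA, integral_eq_zero_iff_of_nonneg (fun x ↦ sq_nonneg _) hPi] at hAz
  filter_upwards [hAz] with x hx
  by_contra! hlt
  have hx : max (u x - γ) 0 ^ 2 = 0 := hx
  rw [max_eq_left (by linarith)] at hx
  have : 0 < u x - γ := by linarith
  exact absurd hx (by positivity)

/-- Here v(u) ≥ 0, so the test function 1 gives v(u) = 0 and the values -1 and γ, and the test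
function u gives q = 0. Cheeger's inequality with c > 0 plays the role of connectedness:
`crossVolume` of u vanishes, hence at some level between -1 and γ one of the two sides is null. -/
theorem ae_eq_or_of_ae_le_gamma [IsFiniteMeasure μ] (h : IsTestedSolution μ u q v a b c)
    (ha : 0 < a) (hb : 0 < b) (hc : 0 < c) (hv : IsBistable v γ C) (hu : ∀ᵐ x ∂μ, |u x| ≤ 1)
    (hγ : ∀ᵐ x ∂μ, u x ≤ γ) : (∀ᵐ x ∂μ, u x = -1) ∨ ∀ᵐ x ∂μ, u x = γ := by
  have hγm := hv.gamma_mem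
  have hv0 : ∀ᵐ x ∂μ, 0 ≤ v (u x) := by
    filter_upwards [hu, hγ] with x hx hx'
    rcases hx'.eq_or_lt with he | hlt
    · rw [he, hv.apply_gamma]
    rcases (abs_le.1 hx).1.eq_or_lt with he | hlt'
    · rw [← he, hv.apply_neg_one]
    exact (hv.pos_of_mem _ ⟨hlt', hlt⟩).le
  have h1 := h.equation_of_contDiff hu (F := fun _ ↦ 1) contDiff_const
  have hvz : ∀ᵐ x ∂μ, v (u x) = 0 := by
    simp only [deriv_const, zero_mul, integral_zero, mul_zero, zero_add, mul_one] at h1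
    have h2 := (mul_eq_zero.1 h1).resolve_left hb.ne'
    exact (integral_eq_zero_iff_of_nonneg_ae hv0 h.integrable).1 h2
  have hval : ∀ᵐ x ∂μ, u x = -1 ∨ u x = γ := by
    filter_upwards [hu, hγ, hvz] with x hx hx' hz
    by_contra! hne
    have := hv.pos_of_mem (u x) ⟨lt_of_le_of_ne (abs_le.1 hx).1 (Ne.symm hne.1),
      lt_of_le_of_ne hx' hne.2⟩
    exact this.ne' hz
  have hq : ∀ᵐ x ∂μ, q x = 0 := by
    have h2 := h.equation_of_contDiff hu (F := fun s ↦ s) contDiff_id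
    have h3 : ∫ x, v (u x) * u x ∂μ = 0 := by
      rw [integral_congr_ae (g := fun _ ↦ 0)]
      · simp
      · filter_upwards [hvz] with x hx
        rw [hx, zero_mul]
    simp only [deriv_id'', one_mul, h3, mul_zero, add_zero] at h2
    have h4 := (mul_eq_zero.1 h2).resolve_left ha.ne'
    rw [integral_eq_zero_iff_of_nonneg (fun x ↦ sq_nonneg _) h.memLp.integrable_sq] at h4
    filter_upwards [h4] with x hx
    exact pow_eq_zero_iff two_ne_zero |>.1 hx
  have hcross : crossVolume μ u = 0 := by
    have h2 := h.cheeger_of_contDiff hu (F := fun s ↦ s) contDiff_id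
    have h3 : ∫⁻ x, ENNReal.ofReal (|deriv (fun s : ℝ ↦ s) (u x)| * q x) ∂μ = 0 := by
      rw [lintegral_congr_ae (g := fun _ ↦ 0)]
      · simp
      · filter_upwards [hq] with x hx
        simp [hx]
    rw [h3] at h2
    exact (mul_eq_zero.1 (le_antisymm h2 bot_le)).resolve_left (by exact_mod_cast hc.ne')
  have hanti : Antitone fun t ↦ μ {x | t < u x} := fun s t hst ↦
    measure_mono fun x (hx : t < u x) ↦ lt_of_le_of_lt hst hx
  have hmono : Monotone fun t ↦ μ {x | u x < t} := fun s t hst ↦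
    measure_mono fun x (hx : u x < s) ↦ lt_of_lt_of_le hx hst
  have hzero := (lintegral_eq_zero_iff (hanti.measurable.min hmono.measurable)).1 hcross
  -- The integrand of `crossVolume` is zero for almost every t, and the interval has positive
  -- length.
  obtain ⟨t, ht, htm⟩ : ∃ t ∈ Ioo (-1) γ, min (μ {x | t < u x}) (μ {x | u x < t}) = 0 := by
    by_contra! hne
    have h5 : volume (Ioo (-1) γ) = 0 := measure_mono_null (fun t ht ↦ hne t ht) hzero
    rw [Real.volume_Ioo, ENNReal.ofReal_eq_zero] at h5
    linarith [hγm.1]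
  rcases min_eq_bot.1 htm with h0 | h0
  · left
    filter_upwards [hval, measure_eq_zero_iff_ae_notMem.1 h0] with x hx hx'
    refine hx.resolve_right fun he ↦ hx' ?_
    rw [he]; exact ht.2
  · right
    filter_upwards [hval, measure_eq_zero_iff_ae_notMem.1 h0] with x hx hx'
    refine hx.resolve_left fun he ↦ hx' ?_
    rw [he]; exact ht.1

theorem ae_eq_const [IsFiniteMeasure μ] (h : IsTestedSolution μ u q v a b c)
    (ha : 0 < a) (hb : 0 < b) (hc0 : 0 < c) (hv : IsBistable v γ C)
    (hc : 4 * b * C < c ^ 2 * a) :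
    (∀ᵐ x ∂μ, u x = 1) ∨ (∀ᵐ x ∂μ, u x = -1) ∨ ∀ᵐ x ∂μ, u x = γ := by
  have hu := h.ae_abs_le_one ha hb hv
  rcases le_total (μ {x | γ < u x}) (μ {x | u x ≤ γ}) with hμ | hμ
  · exact Or.inr (h.ae_eq_or_of_ae_le_gamma ha hb hc0 hv hu
      (h.ae_le_gamma ha hb hv hu hc hμ))
  · have hu' : ∀ᵐ x ∂μ, |-u x| ≤ 1 := by simpa only [abs_neg] using hu
    have hμ' : μ {x | -γ < -u x} ≤ μ {x | -u x ≤ -γ} := by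
      simp only [neg_lt_neg_iff, neg_le_neg_iff]
      calc μ {x | u x < γ} ≤ μ {x | u x ≤ γ} := measure_mono fun x (hx : u x < γ) ↦ hx.le
        _ ≤ μ {x | γ < u x} := hμ
        _ ≤ _ := measure_mono fun x (hx : γ < u x) ↦ hx.le
    have h1 := h.reflect.ae_le_gamma ha hb hv.reflect hu' hc hμ'
    rcases h.reflect.ae_eq_or_of_ae_le_gamma ha hb hc0 hv.reflect hu' h1 with h2 | h2
    · left
      filter_upwards [h2] with x hx using neg_inj.1 hx
    · right; right
      filter_upwards [h2] with x hx using neg_inj.1 hx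

end IsTestedSolution

end RigidityConclusion

/-! ### Signs of W' and the constant C. -/

section DoubleWell

variable {W : ℝ → ℝ} {γ : ℝ}

theorem forall_pos_of_forall_ne_zero {v : ℝ → ℝ} {s : Set ℝ} (hs : s.OrdConnected)
    (hv : ContinuousOn v s) (h : ∀ x ∈ s, v x ≠ 0) {x₀ : ℝ} (hx₀ : x₀ ∈ s) (hpos : 0 < v x₀) :
    ∀ x ∈ s, 0 < v x := by
  intro x hx
  by_contra! hlt
  obtain ⟨z, hz, hz0⟩ := hs.isPreconnected.intermediate_value hx hx₀ hv ⟨hlt, hpos.le⟩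
  exact h z hz hz0

theorem eventually_pos_nhdsGT {v : ℝ → ℝ} {v' t : ℝ} (h : HasDerivAt v v' t) (h0 : v t = 0)
    (hv' : 0 < v') : ∀ᶠ s in 𝓝[>] t, 0 < v s := by
  have := (hasDerivAt_iff_tendsto_slope.1 h).eventually (eventually_gt_nhds hv')
  have h2 : ∀ᶠ s in 𝓝[>] t, 0 < slope v t s :=
    this.filter_mono (nhdsWithin_mono _ fun s (hs : t < s) ↦ hs.ne')
  filter_upwards [h2, self_mem_nhdsWithin] with s hs (hts : t < s)
  rw [slope_def_field, h0, sub_zero] at hs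
  exact (div_pos_iff_of_pos_right (sub_pos.2 hts)).1 hs

theorem eventually_neg_nhdsLT {v : ℝ → ℝ} {v' t : ℝ} (h : HasDerivAt v v' t) (h0 : v t = 0)
    (hv' : 0 < v') : ∀ᶠ s in 𝓝[<] t, v s < 0 := by
  have := (hasDerivAt_iff_tendsto_slope.1 h).eventually (eventually_gt_nhds hv')
  have h2 : ∀ᶠ s in 𝓝[<] t, 0 < slope v t s :=
    this.filter_mono (nhdsWithin_mono _ fun s (hs : s < t) ↦ hs.ne)
  filter_upwards [h2, self_mem_nhdsWithin] with s hs (hts : s < t)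
  rw [slope_def_field, h0, sub_zero] at hs
  by_contra! hn
  exact hs.not_ge (div_nonpos_of_nonneg_of_nonpos hn (sub_nonpos.2 hts.le))

namespace IsDoubleWell

theorem contDiff_deriv (h : IsDoubleWell W γ) : ContDiff ℝ 1 (deriv W) :=
  ((contDiff_succ_iff_deriv (n := 1) (f := W)).1 (h.contDiff.of_le (by norm_num))).2.2

theorem continuous_deriv (h : IsDoubleWell W γ) : Continuous (deriv W) :=
  h.contDiff_deriv.continuous

theorem hasDerivAt_deriv (h : IsDoubleWell W γ) (s : ℝ) :
    HasDerivAt (deriv W) (deriv (deriv W) s) s :=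
  (h.contDiff_deriv.differentiable one_ne_zero s).hasDerivAt

theorem deriv_ne_zero (h : IsDoubleWell W γ) {s : ℝ} (h1 : s ≠ -1) (h2 : s ≠ γ) (h3 : s ≠ 1) :
    deriv W s ≠ 0 := fun h0 ↦ by
  rcases (h.critical_iff s).1 h0 with h' | h' | h' <;> contradiction

theorem deriv_neg_one (h : IsDoubleWell W γ) : deriv W (-1) = 0 := by simp [h.critical_iff]

theorem deriv_gamma (h : IsDoubleWell W γ) : deriv W γ = 0 := by simp [h.critical_iff]

theorem deriv_one (h : IsDoubleWell W γ) : deriv W 1 = 0 := by simp [h.critical_iff]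

/-- W' has no zero on each of the four intervals cut out by the critical points, so its sign there
is constant. It is read off next to a well, where W'' > 0. The next three lemmas use the same
argument. -/
theorem deriv_pos_of_one_lt (h : IsDoubleWell W γ) : ∀ s ∈ Ioi (1 : ℝ), 0 < deriv W s := by
  have hγ := h.gamma_mem
  obtain ⟨s, hs, hs1⟩ := ((eventually_pos_nhdsGT (h.hasDerivAt_deriv 1) h.deriv_one
    h.deriv2_one).and self_mem_nhdsWithin).exists
  refine forall_pos_of_forall_ne_zero ordConnected_Ioi h.continuous_deriv.continuousOn
    (fun x (hx : 1 < x) ↦ h.deriv_ne_zero ?_ ?_ hx.ne') hs1 hs <;> linarith [hγ.2, hx]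

theorem deriv_pos_of_mem (h : IsDoubleWell W γ) : ∀ s ∈ Ioo (-1) γ, 0 < deriv W s := by
  have hγ := h.gamma_mem
  obtain ⟨s, hs, hs1⟩ := ((eventually_pos_nhdsGT (h.hasDerivAt_deriv (-1)) h.deriv_neg_one
    h.deriv2_neg_one).and (Ioo_mem_nhdsGT hγ.1)).exists
  exact forall_pos_of_forall_ne_zero ordConnected_Ioo h.continuous_deriv.continuousOn
    (fun x hx ↦ h.deriv_ne_zero hx.1.ne' hx.2.ne (hx.2.trans hγ.2).ne) hs1 hs

theorem deriv_neg_of_mem (h : IsDoubleWell W γ) : ∀ s ∈ Ioo γ 1, deriv W s < 0 := by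
  have hγ := h.gamma_mem
  obtain ⟨s, hs, hs1⟩ := ((eventually_neg_nhdsLT (h.hasDerivAt_deriv 1) h.deriv_one
    h.deriv2_one).and (Ioo_mem_nhdsLT hγ.2)).exists
  intro x hx
  exact neg_pos.1 (forall_pos_of_forall_ne_zero (v := fun s ↦ -deriv W s) ordConnected_Ioo
    h.continuous_deriv.neg.continuousOn
    (fun x hx ↦ neg_ne_zero.2 (h.deriv_ne_zero (hγ.1.trans hx.1).ne' hx.1.ne' hx.2.ne)) hs1
    (neg_pos.2 hs) x hx)

theorem deriv_neg_of_lt_neg_one (h : IsDoubleWell W γ) : ∀ s ∈ Iio (-1 : ℝ), deriv W s < 0 := by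
  have hγ := h.gamma_mem
  obtain ⟨s, hs, hs1⟩ := ((eventually_neg_nhdsLT (h.hasDerivAt_deriv (-1)) h.deriv_neg_one
    h.deriv2_neg_one).and self_mem_nhdsWithin).exists
  intro x hx
  exact neg_pos.1 (forall_pos_of_forall_ne_zero (v := fun s ↦ -deriv W s) ordConnected_Iio
    h.continuous_deriv.neg.continuousOn
    (fun x (hx : x < -1) ↦ neg_ne_zero.2 (h.deriv_ne_zero hx.ne (hx.trans hγ.1).ne
      (hx.trans (hγ.1.trans hγ.2)).ne)) hs1 (neg_pos.2 hs) x hx)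

/-- The quotient is minus the divided difference `dslope` of W' at γ, which is continuous because W'
is differentiable there. -/
theorem continuous_wellQuotient (h : IsDoubleWell W γ) : Continuous (wellQuotient W γ) := by
  have hd : Continuous (dslope (deriv W) γ) := by
    rw [← continuousOn_univ, continuousOn_dslope univ_mem]
    exact ⟨h.continuous_deriv.continuousOn, (h.hasDerivAt_deriv γ).differentiableAt⟩
  refine hd.neg.congr fun s ↦ ?_
  unfold wellQuotient
  split_ifs with hs
  · rw [hs]; simp
  · rw [Pi.neg_apply, dslope_of_ne _ hs, slope_def_field, h.deriv_gamma, sub_zero, neg_div]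

theorem isGreatest_wellConstant (h : IsDoubleWell W γ) :
    IsGreatest (wellQuotient W γ '' Icc (-1) 1) (wellConstant W γ) :=
  (isCompact_Icc.image h.continuous_wellQuotient).isGreatest_sSup
    ((nonempty_Icc.2 (by norm_num)).image _)

theorem wellConstant_pos (h : IsDoubleWell W γ) : 0 < wellConstant W γ := by
  obtain ⟨s, hs⟩ := nonempty_Ioo.2 h.gamma_mem.2
  refine lt_of_lt_of_le ?_ (h.isGreatest_wellConstant.2
    ⟨s, ⟨(h.gamma_mem.1.trans hs.1).le, hs.2.le⟩, rfl⟩)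
  unfold wellQuotient
  rw [if_neg hs.1.ne']
  exact div_pos (neg_pos.2 (h.deriv_neg_of_mem s hs)) (sub_pos.2 hs.1)

theorem neg_deriv_div_le (h : IsDoubleWell W γ) {s : ℝ} (hs : s ∈ Icc (-1) 1) (hsγ : s ≠ γ) :
    -deriv W s / (s - γ) ≤ wellConstant W γ := by
  have := h.isGreatest_wellConstant.2 ⟨s, hs, rfl⟩
  unfold wellQuotient at this
  rwa [if_neg hsγ] at this

theorem isBistable (h : IsDoubleWell W γ) : IsBistable (deriv W) γ (wellConstant W γ) where
  continuous := h.continuous_deriv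
  gamma_mem := h.gamma_mem
  pos_of_one_lt := h.deriv_pos_of_one_lt
  neg_of_lt_neg_one := h.deriv_neg_of_lt_neg_one
  neg_of_mem := h.deriv_neg_of_mem
  pos_of_mem := h.deriv_pos_of_mem
  apply_neg_one := h.deriv_neg_one
  apply_gamma := h.deriv_gamma
  apply_one := h.deriv_one
  neg_le s hs := by
    rcases hs.1.eq_or_lt with rfl | hlt
    · simp [h.deriv_gamma]
    · exact (div_le_iff₀ (sub_pos.2 hlt)).1
        (h.neg_deriv_div_le ⟨(h.gamma_mem.1.trans hlt).le, hs.2⟩ hlt.ne')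
  le_mul s hs := by
    rcases hs.2.eq_or_lt with rfl | hlt
    · simp [h.deriv_gamma]
    · refine (div_le_iff₀ (sub_pos.2 hlt)).1 ?_
      rw [← neg_div_neg_eq, neg_sub]
      exact h.neg_deriv_div_le ⟨hs.1, (hlt.trans h.gamma_mem.2).le⟩ hlt.ne

end IsDoubleWell

end DoubleWell

/-! ### Critical points of W give constant solutions. -/

section ConstantSolutions

theorem integral_fderiv_apply_eq_zero {n : ℕ} {ψ : EuclideanSpace ℝ (Fin n) → ℝ}
    (hψ : ContDiff ℝ ∞ ψ) (hc : HasCompactSupport ψ) (e : EuclideanSpace ℝ (Fin n)) :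
    ∫ y, fderiv ℝ ψ y e = 0 := by
  have hi : Integrable fun y ↦ fderiv ℝ ψ y e :=
    ((hψ.continuous_fderiv (by simp)).clm_apply continuous_const).integrable_of_hasCompactSupport
      (hc.fderiv_apply ℝ e)
  have := integral_mul_fderiv_eq_neg_fderiv_mul_of_integrable (𝕜 := ℝ) (μ := volume)
    (f := fun _ : EuclideanSpace ℝ (Fin n) ↦ (1 : ℝ)) (g := ψ) (v := e) (by simp)
    (by simpa using hi) (by simpa using hψ.continuous.integrable_of_hasCompactSupport hc)
    (fun _ _ ↦ differentiableAt_const _) (fun _ _ ↦ hψ.differentiable (by simp) _)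
  simpa using this

variable {n : ℕ} {M : Type*} [EMetricSpace M] [MeasurableSpace M] [BorelSpace M]
  [ChartedSpace (EuclideanSpace ℝ (Fin n)) M] [IsManifold (𝓡 n) ∞ M]
  [RiemannianBundle (fun x : M ↦ TangentSpace (𝓡 n) x)]
  [IsContinuousRiemannianBundle (EuclideanSpace ℝ (Fin n)) (fun x : M ↦ TangentSpace (𝓡 n) x)]
  [IsRiemannianManifold (𝓡 n) M]

/-- `IsWeakGradient` integrates over the whole target of a chart, where no bilipschitz bound is
available. Near each point one passes to a good chart centred there; the transition map is
differentiable and so preserves null sets. -/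
theorem ae_comp_extChartAt_symm {p : M → Prop} (h : ∀ᵐ x ∂(riemannianVolume n M), p x) (x₀ : M) :
    ∀ᵐ y ∂(volume.restrict (extChartAt (𝓡 n) x₀).target),
      p ((extChartAt (𝓡 n) x₀).symm y) := by
  rw [ae_restrict_iff' (isOpen_extChartAt_target x₀).measurableSet, ae_iff]
  refine measure_null_of_locally_null _ fun y hy ↦ ?_
  obtain ⟨hyT, -⟩ := Classical.not_imp.1 hy
  set φ := extChartAt (𝓡 n) x₀ with hφ
  obtain ⟨K, Q, hx, hQ⟩ := exists_isGoodChart (n := n) (φ.symm y)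
  set φ' := extChartAt (𝓡 n) (φ.symm y) with hφ'
  have hN := quasiMeasurePreserving_symm hQ.lipschitz h
  rw [ae_restrict_iff' Q.open_target.measurableSet, ae_iff] at hN
  set N := {z | ¬(z ∈ Q.target → p (Q.symm z))} with hNdef
  have hsymm : ∀ z ∈ Q.target, φ'.symm z = Q.symm z := by
    intro z hz
    have h1 := φ'.left_inv (hQ.source_subset (Q.map_target hz))
    rwa [← hQ.coe_eq, Q.right_inv hz] at h1
  have himage : volume ((φ ∘ φ'.symm) '' (N ∩ (φ'.symm ≫ φ).source)) = 0 := by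
    refine addHaar_image_eq_zero_of_differentiableOn_of_addHaar_eq_zero volume ?_
      (measure_mono_null inter_subset_left hN)
    exact ((contDiffOn_ext_coord_change (n := ∞) x₀ (φ.symm y)).differentiableOn
      (by simp)).mono inter_subset_right
  refine ⟨_, inter_mem_nhdsWithin _ ((continuousAt_extChartAt_symm'' hyT).preimage_mem_nhds
    (Q.open_source.mem_nhds hx)), measure_mono_null ?_ himage⟩
  rintro w ⟨hw, hwQ⟩
  obtain ⟨hwT, hwp⟩ := Classical.not_imp.1 hw
  have hwQ : φ.symm w ∈ Q.source := hwQ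
  have h2 : φ'.symm (Q (φ.symm w)) = φ.symm w := by
    rw [hsymm _ (Q.map_source hwQ), Q.left_inv hwQ]
  refine ⟨Q (φ.symm w), ⟨?_, ?_, ?_⟩, ?_⟩
  · refine fun hz ↦ hwp ?_
    have := hz (Q.map_source hwQ)
    rwa [Q.left_inv hwQ] at this
  · rw [hQ.coe_eq]
    exact φ'.map_source (hQ.source_subset hwQ)
  · rw [mem_preimage, PartialEquiv.symm_symm, h2]
    exact φ.map_target hwT
  · rw [Function.comp_apply, h2, φ.right_inv hwT]

variable [CompactSpace M]

theorem isSobolevH1_of_ae_eq_const {u : M → ℝ} {c : ℝ}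
    (hu : u =ᵐ[riemannianVolume n M] fun _ ↦ c) :
    IsSobolevH1 u (fun x ↦ (0 : TangentSpace (𝓡 n) x)) where
  memLp := by
    have := isFiniteMeasure_riemannianVolume n M
    exact (memLp_congr_ae hu).2 (memLp_const c)
  aestronglyMeasurable :=
    ((Bundle.Trivialization.continuous_zeroSection (F := EuclideanSpace ℝ (Fin n))
      (E := fun x : M ↦ TangentSpace (𝓡 n) x) ℝ).comp_stronglyMeasurable
      stronglyMeasurable_id).aestronglyMeasurable
  lintegral_lt_top := by simp
  isWeakGradient x₀ ψ hψ hψc hψT e := by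
    have h1 := ae_comp_extChartAt_symm hu x₀
    rw [ae_restrict_iff' (isOpen_extChartAt_target x₀).measurableSet] at h1
    have h2 : ∫ y, u ((extChartAt (𝓡 n) x₀).symm y) * fderiv ℝ ψ y e =
        ∫ y, c * fderiv ℝ ψ y e := by
      refine integral_congr_ae ?_
      filter_upwards [h1] with y hy
      by_cases hyT : y ∈ (extChartAt (𝓡 n) x₀).target
      · rw [hy hyT]
      · have : fderiv ℝ ψ y = 0 := by
          by_contra h0
          exact hyT (hψT (support_fderiv_subset ℝ h0))
        simp [this]
    rw [h2, integral_const_mul, integral_fderiv_apply_eq_zero hψ hψc]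
    simp only [inner_zero_left, zero_mul, integral_zero, mul_zero, neg_zero]

theorem isAllenCahnSolution_of_ae_eq_const {W : ℝ → ℝ} {u : M → ℝ} {c : ℝ} (ε : ℝ)
    (hu : u =ᵐ[riemannianVolume n M] fun _ ↦ c) (hc : deriv W c = 0) :
    IsAllenCahnSolution n W ε u := by
  have h0 : ∀ᵐ x ∂(riemannianVolume n M), deriv W (u x) = 0 := by
    filter_upwards [hu] with x hx
    rw [hx, hc]
  refine ⟨_, isSobolevH1_of_ae_eq_const hu, (integrable_congr h0).2 (integrable_zero _ _ _),
    fun φ _ ↦ ?_⟩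
  have h1 : ∫ x, deriv W (u x) * φ x ∂(riemannianVolume n M) = 0 := by
    refine integral_eq_zero_of_ae ?_
    filter_upwards [h0] with x hx
    simp [hx]
  simp [h1]

end ConstantSolutions

/-! ### The theorem. -/

section Main

/-- A finite positive c replaces the Cheeger constant h: h itself if it is finite, `3 * √C / ε` if
it is infinite. The case h = 0 is excluded because the quotient is then infinite. -/
theorem exists_nnreal_le_of_mul_div_lt {C ε : ℝ} {h : ℝ≥0∞} (hC : 0 < C)
    (hε : 2 * ENNReal.ofReal (√C) / h < ENNReal.ofReal ε) :
    0 < ε ∧ ∃ c : ℝ≥0, (c : ℝ≥0∞) ≤ h ∧ 0 < c ∧ 4 * (1 / ε) * C < (c : ℝ) ^ 2 * ε := by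
  have hε0 : 0 < ε := ENNReal.ofReal_pos.1 (bot_le.trans_lt hε)
  have hsC := Real.sqrt_pos.2 hC
  refine ⟨hε0, ?_⟩
  obtain ⟨c, hch, hc0, hc⟩ : ∃ c : ℝ≥0, (c : ℝ≥0∞) ≤ h ∧ 0 < c ∧ 2 * √C < c * ε := by
    rcases eq_or_ne h ⊤ with rfl | htop
    · refine ⟨(3 * √C / ε).toNNReal, le_top, Real.toNNReal_pos.2 (by positivity), ?_⟩
      rw [Real.coe_toNNReal _ (by positivity), div_mul_cancel₀ _ hε0.ne']
      linarith
    · have hh0 : h ≠ 0 := by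
        rintro rfl
        rw [ENNReal.div_zero (by simpa using hsC)] at hε
        exact not_top_lt hε
      lift h to ℝ≥0 using htop
      have hh0' : 0 < h := pos_iff_ne_zero.2 (by exact_mod_cast hh0)
      refine ⟨h, le_rfl, hh0', ?_⟩
      rw [ENNReal.div_lt_iff (Or.inl hh0) (Or.inl ENNReal.coe_ne_top), ← ENNReal.ofReal_ofNat 2,
        ← ENNReal.ofReal_mul (by norm_num), ← ENNReal.ofReal_coe_nnreal,
        ← ENNReal.ofReal_mul hε0.le, ENNReal.ofReal_lt_ofReal_iff (by positivity)] at hε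
      linarith
  refine ⟨c, hch, hc0, ?_⟩
  have h1 : (2 * √C) ^ 2 < (c * ε) ^ 2 := by gcongr
  rw [mul_pow, Real.sq_sqrt hC.le] at h1
  have h2 : 4 * (1 / ε) * C = 2 ^ 2 * C / ε := by ring
  rw [h2, div_lt_iff₀ hε0]
  linarith

theorem proposition2 {n : ℕ} {M : Type*} [EMetricSpace M] [CompactSpace M]
    [MeasurableSpace M] [BorelSpace M]
    [ChartedSpace (EuclideanSpace ℝ (Fin n)) M] [IsManifold (𝓡 n) ∞ M]
    [RiemannianBundle (fun x : M ↦ TangentSpace (𝓡 n) x)]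
    [IsContMDiffRiemannianBundle (𝓡 n) ∞ (EuclideanSpace ℝ (Fin n))
      (fun x : M ↦ TangentSpace (𝓡 n) x)]
    [IsRiemannianManifold (𝓡 n) M]
    (W : ℝ → ℝ) (γ : ℝ) (hW : IsDoubleWell W γ) :
    IsGreatest (wellQuotient W γ '' Icc (-1) 1) (wellConstant W γ) ∧ 0 < wellConstant W γ ∧
    ∀ ε : ℝ, 2 * ENNReal.ofReal (√(wellConstant W γ)) / cheegerConstant n M < ENNReal.ofReal ε →
      ∀ u : M → ℝ, IsAllenCahnSolution n W ε u ↔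
        u =ᵐ[riemannianVolume n M] (fun _ ↦ 1) ∨ u =ᵐ[riemannianVolume n M] (fun _ ↦ -1) ∨
          u =ᵐ[riemannianVolume n M] (fun _ ↦ γ) := by
  have := isContinuousRiemannianBundle_of_contMDiff (n := n) (M := M)
  have := isFiniteMeasure_riemannianVolume n M
  refine ⟨hW.isGreatest_wellConstant, hW.wellConstant_pos, fun ε hε u ↦ ⟨?_, ?_⟩⟩
  · rintro ⟨G, hG, hi, heq⟩
    obtain ⟨hε0, c, hc, hc0, hlt⟩ := exists_nnreal_le_of_mul_div_lt hW.wellConstant_pos hε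
    -- The manifold enters the uniqueness argument only here, with q = |∇u|, a = ε and b = 1/ε.
    have hu : IsTestedSolution (riemannianVolume n M) u (fun x ↦ ‖G x‖) (deriv W) ε (1 / ε) c :=
      { aemeasurable := hG.memLp.1.aemeasurable
        memLp := hG.memLp_norm
        nonneg := fun x ↦ norm_nonneg _
        integrable := hi
        equation := fun F B hF hB hB' ↦ integral_deriv_comp_mul_sq_norm_add hG hi heq hF hB hB'
        cheeger := fun F B hF hB hB' ↦ mul_crossVolume_comp_le hG hc hF hB hB' }
    exact hu.ae_eq_const hε0 (by positivity) hc0 hW.isBistable hlt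
  · rintro (hu | hu | hu)
    · exact isAllenCahnSolution_of_ae_eq_const ε hu hW.deriv_one
    · exact isAllenCahnSolution_of_ae_eq_const ε hu hW.deriv_neg_one
    · exact isAllenCahnSolution_of_ae_eq_const ε hu hW.deriv_gamma

end Main
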